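/- Let $D=\mathbb{Q}\langle 1,\mathbf i,\mathbf j,\mathbf k\rangle$ be Hamilton's quaternion algebra over $\mathbb{Q}$ (ramified exactly at $2$ and $\infty$), $\mathcal{O}_D$ its Hurwitz maximal order, $D_f^\times=(D\otimes\mathbb{A}_f)^\times$, and let $\nu\in\mathbb{Z}_5$ be the square root of $-1$ with $\nu\equiv 2 \bmod 5$. Identify $D\otimes\mathbb{Q}_5$ with $\mathrm{M}_2(\mathbb{Q}_5)$ by $\mathbf i\mapsto\begin{pmatrix}0&1\\-1&0\end{pmatrix}$, $\mathbf j\mapsto\begin{pmatrix}\nu&0\\0&-\nu\end{pmatrix}$, $\mathbf k\mapsto\begin{pmatrix}0&-\nu\\-\nu&0\end{pmatrix}$. Let $\widehat\Gamma_1(5)$, respectively $\widehat{\mathrm{GL}}_2(\mathbb{Z}_5)$, be the subgroup of $D_f^\times$ of elements with component in $(\mathcal{O}_D\otimes\mathbb{Z}_\ell)^\times$ at every prime $\ell\neq5$ and with component $u_5$ at $5$ in $\begin{pmatrix}\mathbb{Z}_5^\times&\mathbb{Z}_5\\5\mathbb{Z}_5&1+5\mathbb{Z}_5\end{pmatrix}$,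 respectively in $\mathrm{GL}_2(\mathbb{Z}_5)$. For $\gamma=\begin{pmatrix}\alpha&\beta\\\gamma'&\delta\end{pmatrix}$ put $(f\|_k\gamma)(z)=(\gamma' z+\delta)^{k-2}f\big(\tfrac{\alpha z+\beta}{\gamma' z+\delta}\big)$. For $k\in\mathbb{Z}$ let $S_k^{D,\dagger}$ be the space of functions $\varphi:D^\times\backslash D_f^\times\to\mathbb{Q}_5\langle z\rangle$ with $\varphi(gu)=\varphi(g)\|_k u_5$ for all $u\in\widehat\Gamma_1(5)$; the map $\varphi\mapsto\varphi(1)$ identifies it with the Tate algebra $\mathbb{Q}_5\langle z\rangle$. Let $U_5(\varphi)(g)=\sum_{i=0}^4\varphi(gv_i^{-1})\|_kv_i$ with $v_i=\begin{pmatrix}5&0\\5i&1\end{pmatrix}$ placed at $5$, let $(P_{i,j})_{i,j\ge0}$ be the matrix of $U_5$ on $\mathbb{Q}_5\langle z\rangle$ in the basis $1,z,z^2,\dots$ (column $j$ is the image of $z^j$), and for $a\in\{0,1,2,3\}$ let $P_n(k,a)=(P_{4i+a,4j+a})_{0\le i,j\le n-1}$. For an integer $l\ge2$ let $S_l^D(U)$,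 for $U=\widehat\Gamma_1(5)$ or $\widehat{\mathrm{GL}}_2(\mathbb{Z}_5)$, be the space of functions $\varphi:D^\times\backslash D_f^\times\to\mathbb{Q}_5[z]^{\deg\le l-2}$ with $\varphi(gu)=\varphi(g)\|_lu_5$ for all $u\in U$. Let $(U_2\varphi)(g)=\varphi(g\pi_2)$ with $\pi_2$ a uniformizer of $D\otimes\mathbb{Q}_2$ placed at $2$, and let $d_{l,a}^{\mathrm{Iw}}$, respectively $d_{l,a}^{\mathrm{unr}}$, be the dimension of the subspace of $S_l^D(\widehat\Gamma_1(5))$, respectively $S_l^D(\widehat{\mathrm{GL}}_2(\mathbb{Z}_5))$, on which $U_2=\big(\tfrac{-1-\nu}{2}\big)^{l-2}(-\nu)^a$. Put $w_k=\exp(5(k-2))-1\in\mathbb{Z}_5$, $$m_n^{(a)}(l)=\begin{cases}\min\{n-d_{l,a}^{\mathrm{unr}},\ d_{l,a}^{\mathrm{Iw}}-d_{l,a}^{\mathrm{unr}}-n\}&\text{if } d_{l,a}^{\mathrm{unr}}<n<d_{l,a}^{\mathrm{Iw}}-d_{l,a}^{\mathrm{unr}},\\0&\text{otherwise,}\end{cases}$$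 and define the ghost coefficient $$g_n^{(a)}(w)=\prod_{\substack{l\ge2\\ l\equiv 2a+2\bmod 4}}(w-w_l)^{m_n^{(a)}(l)}\in\mathbb{Z}_5[w],$$ a finite product. **Corollary.** For all integers $n\ge0$, all $a\in\{0,1,2,3\}$ and all integers $k$, the determinant of $P_n(k,a)$ lies in $\mathbb{Z}_5$ and is divisible by $g_n^{(a)}(w_k)$ in $\mathbb{Z}_5$. -/

import Mathlib

open scoped Quaternion PowerSeries Polynomial

noncomputable section

namespace QuatHecke

instance factPrimeFive : Fact (Nat.Prime 5) := ⟨by norm_num⟩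

instance factPrime (p : Nat.Primes) : Fact (Nat.Prime (p : ℕ)) := ⟨p.2⟩

/-! ### The definite quaternion algebra of discriminant two and its finite ideles

`D` is Hamilton's quaternion algebra `ℍ[ℚ]`, which ramifies exactly at `2` and `∞`, and
`D ⊗ ℚ_p` is `ℍ[ℚ_[p]]`. -/

/-- The quaternion `a + b i + c j + d k`. -/
def quat {R : Type} [CommRing R] (a b c d : R) : ℍ[R] := ⟨a, b, c, d⟩

section

variable {R : Type} [CommRing R] (a b c d : R)

@[simp] theorem quat_re : (quat a b c d).re = a := rfl

@[simp] theorem quat_imI : (quat a b c d).imI = b := rfl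

@[simp] theorem quat_imJ : (quat a b c d).imJ = c := rfl

@[simp] theorem quat_imK : (quat a b c d).imK = d := rfl

end

theorem padicInt_coe_two (p : ℕ) [Fact p.Prime] : ((2 : ℤ_[p]) : ℚ_[p]) = 2 :=
  map_ofNat (PadicInt.Coe.ringHom (p := p)) 2

/-- The maximal order `ℤ_p ω + ℤ_p i + ℤ_p j + ℤ_p k` of `D ⊗ ℚ_p`, the completion of the Hurwitz
order; here `ω = (1 + i + j + k) / 2`. -/
def localOrder (p : ℕ) [Fact p.Prime] : Subring ℍ[ℚ_[p]] where
  carrier := {x | ∃ a b c d : ℤ_[p],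
    x = quat ((a : ℚ_[p]) / 2) (a / 2 + b) (a / 2 + c) (a / 2 + d)}
  zero_mem' := ⟨0, 0, 0, 0, by ext <;> simp⟩
  one_mem' := ⟨2, -1, -1, -1, by ext <;> simp [padicInt_coe_two]⟩
  add_mem' := by
    rintro _ _ ⟨a, b, c, d, rfl⟩ ⟨a', b', c', d', rfl⟩
    refine ⟨a + a', b + b', c + c', d + d', ?_⟩
    ext <;> simp <;> ring
  neg_mem' := by
    rintro _ ⟨a, b, c, d, rfl⟩
    refine ⟨-a, -b, -c, -d, ?_⟩
    ext <;> simp <;> ring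
  mul_mem' := by
    rintro _ _ ⟨a, b, c, d, rfl⟩ ⟨a', b', c', d', rfl⟩
    refine ⟨-(a * a' + a * (b' + c' + d') + (b + c + d) * a' + 2 * (b * b' + c * c' + d * d')),
      a * a' + a * (b' + d') + (b + c) * a' + b * b' + c * c' + d * d' + c * d' - d * c',
      a * a' + a * (b' + c') + (c + d) * a' + b * b' + c * c' + d * d' + d * b' - b * d',
      a * a' + a * (c' + d') + (b + d) * a' + b * b' + c * c' + d * d' + b * c' - c * b', ?_⟩
    ext <;> simp [padicInt_coe_two] <;> ring

/-- The unit group of the maximal order. For `p = 2` it is the maximal compact subgroup of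
`(D ⊗ ℚ_2)ˣ`; for odd `p` it is `GL₂(ℤ_p)` in suitable coordinates. -/
def localUnits (p : ℕ) [Fact p.Prime] : Subgroup (ℍ[ℚ_[p]])ˣ :=
  (localOrder p).toSubmonoid.units

/-- The group `D_fˣ = (D ⊗ 𝔸_f)ˣ`, as the restricted product of the groups `(D ⊗ ℚ_p)ˣ`. -/
abbrev Df : Type :=
  RestrictedProduct (fun p : Nat.Primes => (ℍ[ℚ_[(p : ℕ)]])ˣ)
    (fun p => (localUnits (p : ℕ) : Set (ℍ[ℚ_[(p : ℕ)]])ˣ)) Filter.cofinite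

/-- The inclusion of `D` into `D ⊗ ℚ_p`. -/
def toLocal (p : ℕ) [Fact p.Prime] : ℍ[ℚ] →+* ℍ[ℚ_[p]] where
  toFun x := quat (x.re : ℚ_[p]) x.imI x.imJ x.imK
  map_one' := by ext <;> simp
  map_zero' := by ext <;> simp
  map_add' x y := by ext <;> simp
  map_mul' x y := by ext <;> simp

theorem finite_not_integral (q : ℚ) :
    {p : Nat.Primes | ¬ ‖(q : ℚ_[(p : ℕ)])‖ ≤ 1}.Finite := by
  have h : {p : ℕ | p ∣ q.den}.Finite :=
    (Set.finite_le_nat q.den).subset fun p hp => Nat.le_of_dvd q.pos hp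
  refine (h.preimage (Subtype.val_injective.injOn)).subset fun (p : Nat.Primes) hp => ?_
  by_contra hn
  exact hp (@Padic.norm_rat_le_one (p : ℕ) (factPrime p) q hn)

theorem mem_localOrder_of_integral (p : ℕ) [Fact p.Prime] (x : ℍ[ℚ_[p]])
    (h0 : ‖x.re‖ ≤ 1) (h1 : ‖x.imI‖ ≤ 1) (h2 : ‖x.imJ‖ ≤ 1) (h3 : ‖x.imK‖ ≤ 1) :
    x ∈ localOrder p := by
  obtain ⟨r, hr⟩ : ∃ r : ℤ_[p], (r : ℚ_[p]) = x.re := ⟨⟨_, h0⟩, rfl⟩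
  obtain ⟨s, hs⟩ : ∃ s : ℤ_[p], (s : ℚ_[p]) = x.imI := ⟨⟨_, h1⟩, rfl⟩
  obtain ⟨t, ht⟩ : ∃ t : ℤ_[p], (t : ℚ_[p]) = x.imJ := ⟨⟨_, h2⟩, rfl⟩
  obtain ⟨u, hu⟩ : ∃ u : ℤ_[p], (u : ℚ_[p]) = x.imK := ⟨⟨_, h3⟩, rfl⟩
  refine ⟨2 * r, s - r, t - r, u - r, ?_⟩
  ext <;> simp [padicInt_coe_two, hr, hs, ht, hu]

theorem eventually_mem_localOrder (x : ℍ[ℚ]) :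
    ∀ᶠ p : Nat.Primes in Filter.cofinite, toLocal (p : ℕ) x ∈ localOrder (p : ℕ) := by
  have h := fun q : ℚ => Filter.eventually_cofinite.mpr (finite_not_integral q)
  filter_upwards [h x.re, h x.imI, h x.imJ, h x.imK] with p h0 h1 h2 h3
  exact mem_localOrder_of_integral _ _ h0 h1 h2 h3

/-- The diagonal embedding of `Dˣ` into `D_fˣ`. -/
def diag (x : (ℍ[ℚ])ˣ) : Df :=
  ⟨fun p => Units.map (toLocal (p : ℕ)).toMonoidHom x, by
    filter_upwards [eventually_mem_localOrder (x : ℍ[ℚ]),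
      eventually_mem_localOrder ((x⁻¹ : (ℍ[ℚ])ˣ) : ℍ[ℚ])] with p h1 h2
    exact Submonoid.mem_units_iff _ _ |>.mpr ⟨h1, h2⟩⟩

open Classical in
/-- The element of `D_fˣ` that is `u` at `p` and `1` at all other primes. -/
def single (p : Nat.Primes) (u : (ℍ[ℚ_[(p : ℕ)]])ˣ) : Df :=
  ⟨Function.update 1 p u, by
    filter_upwards [(Set.finite_singleton p).compl_mem_cofinite] with q hq
    rw [Function.update_of_ne (by simpa using hq)]
    exact one_mem (localUnits (q : ℕ))⟩

/-! ### The splitting at five -/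

theorem exists_nu : ∃ x : ℤ_[5], x ^ 2 = -1 ∧ (5 : ℤ_[5]) ∣ x - 2 := by
  have e5 : ‖(5 : ℤ_[5])‖ = 5⁻¹ := by
    simpa using PadicInt.norm_p (p := 5)
  have e4 : ‖(4 : ℤ_[5])‖ = 1 := by
    have := (PadicInt.norm_natCast_eq_one_iff (p := 5) (n := 4)).mpr (by norm_num)
    simpa using this
  have a1 : (Polynomial.X ^ 2 + 1 : ℤ_[5][X]).aeval (2 : ℤ_[5]) = 5 := by
    simp; norm_num
  have a2 : (Polynomial.X ^ 2 + 1 : ℤ_[5][X]).derivative.aeval (2 : ℤ_[5]) = 4 := by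
    simp; norm_num
  obtain ⟨z, hz, hz2, -⟩ := hensels_lemma (p := 5) (F := (Polynomial.X ^ 2 + 1 : ℤ_[5][X]))
    (a := (2 : ℤ_[5])) (by rw [a1, a2, e5, e4]; norm_num)
  refine ⟨z, by simp at hz; linear_combination hz, ?_⟩
  rw [a2, e4] at hz2
  have := (PadicInt.norm_lt_one_iff_dvd (p := 5) (z - 2)).mp hz2
  simpa using this

/-- The square root of `-1` in `ℤ_5` that is congruent to `2` modulo `5`. -/
def nuInt : ℤ_[5] := exists_nu.choose

/-- The same square root, as an element of `ℚ_5`. -/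
def nu : ℚ_[5] := (nuInt : ℚ_[5])

theorem nu_sq : nu ^ 2 = -1 := by
  have := congrArg (fun x : ℤ_[5] => (x : ℚ_[5])) exists_nu.choose_spec.1
  simpa [nu, nuInt] using this

/-- The isomorphism of `D ⊗ ℚ_5` with `M₂(ℚ_5)` that sends `i`, `j`, `k` to the matrices
`(0, 1; -1, 0)`, `(ν, 0; 0, -ν)`, `(0, -ν; -ν, 0)`. -/
def split : ℍ[ℚ_[5]] ≃+* Matrix (Fin 2) (Fin 2) ℚ_[5] where
  toFun x := !![x.re + nu * x.imJ, x.imI - nu * x.imK; -x.imI - nu * x.imK, x.re - nu * x.imJ]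
  invFun M := quat ((M 0 0 + M 1 1) / 2) ((M 0 1 - M 1 0) / 2) (-nu * (M 0 0 - M 1 1) / 2)
    (nu * (M 0 1 + M 1 0) / 2)
  left_inv x := by
    have h := nu_sq
    ext <;> simp
    · linear_combination (-x.imJ) * h
    · linear_combination (-x.imK) * h
  right_inv M := by
    have h := nu_sq
    ext i j
    fin_cases i <;> fin_cases j <;> simp
    · linear_combination (-(M 0 0 - M 1 1) / 2) * h
    · linear_combination (-(M 0 1 + M 1 0) / 2) * h
    · linear_combination (-(M 0 1 + M 1 0) / 2) * h
    · linear_combination ((M 0 0 - M 1 1) / 2) * h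
  map_add' x y := by
    ext i j
    fin_cases i <;> fin_cases j <;> simp <;> ring
  map_mul' x y := by
    have h := nu_sq
    ext i j
    fin_cases i <;> fin_cases j <;> simp [Matrix.mul_apply, Fin.sum_univ_two]
    · linear_combination (-(x.imJ * y.imJ) - x.imK * y.imK) * h
    · linear_combination (-(x.imK * y.imJ) + x.imJ * y.imK) * h
    · linear_combination (-(x.imJ * y.imK) + x.imK * y.imJ) * h
    · linear_combination (-(x.imJ * y.imJ) - x.imK * y.imK) * h

/-- The prime `5`, as an index of the restricted product. -/
abbrev five : Nat.Primes := ⟨5, by norm_num⟩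

/-- The `5`-component of an element of `D_fˣ`, as a matrix over `ℚ_5`. -/
def mat5 (g : Df) : Matrix (Fin 2) (Fin 2) ℚ_[5] := split ((g five : (ℍ[ℚ_[5]])ˣ) : ℍ[ℚ_[5]])

/-- The element of `D_fˣ` with `5`-component the given matrix and all other components `1`. -/
def at5 (M : GL (Fin 2) ℚ_[5]) : Df :=
  single five (Units.map split.symm.toMonoidHom M)

/-! ### Level structures -/

/-- Matrices in `GL₂(ℤ_5)`. -/
def IsGL2Z5 (M : Matrix (Fin 2) (Fin 2) ℚ_[5]) : Prop :=
  (∀ i j, ‖M i j‖ ≤ 1) ∧ ‖M.det‖ = 1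

/-- Matrices in `Iw_{5,1}`: upper left entry in `ℤ_5ˣ`, upper right entry in `ℤ_5`, lower left
entry in `5ℤ_5`, lower right entry in `1 + 5ℤ_5`. -/
def IsIw51 (M : Matrix (Fin 2) (Fin 2) ℚ_[5]) : Prop :=
  ‖M 0 0‖ = 1 ∧ ‖M 0 1‖ ≤ 1 ∧ ‖M 1 0‖ < 1 ∧ ‖M 1 1 - 1‖ < 1

/-- The open compact subgroup with `5`-component `GL₂(ℤ_5)`, maximal at all other primes. -/
def fullLevel : Set Df :=
  {u | (∀ p : Nat.Primes, p ≠ five → u p ∈ localUnits (p : ℕ)) ∧ IsGL2Z5 (mat5 u)}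

/-- The open compact subgroup with `5`-component `Iw_{5,1}`, maximal at all other primes. -/
def gamma1Level : Set Df :=
  {u | (∀ p : Nat.Primes, p ≠ five → u p ∈ localUnits (p : ℕ)) ∧ IsIw51 (mat5 u)}

/-! ### The weight `k` action -/

/-- The series `(c z + d) ^ m` for an integer `m`. -/
def linPow (c d : ℚ_[5]) : ℤ → ℚ_[5]⟦X⟧
  | .ofNat m => (PowerSeries.C d + PowerSeries.C c * PowerSeries.X) ^ m
  | .negSucc m => ((PowerSeries.C d + PowerSeries.C c * PowerSeries.X)⁻¹) ^ (m + 1)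

/-- The action `(f ‖_k γ)(z) = (c z + d)^(k-2) f((a z + b) / (c z + d))` for
`γ = (a, b; c, d)`, expanded as `∑ₙ fₙ (a z + b)^n (c z + d)^(k-2-n)` for `f = ∑ₙ fₙ zⁿ`. It is
used for `f ∈ ℚ_5⟨z⟩`, with `d ∈ 1 + 5ℤ_5` and `c ∈ 5ℤ_5`, and for polynomials `f` of degree at
most `k - 2`. -/
def slash (k : ℤ) (γ : Matrix (Fin 2) (Fin 2) ℚ_[5]) (f : ℚ_[5]⟦X⟧) : ℚ_[5]⟦X⟧ :=
  PowerSeries.mk fun i => ∑' n : ℕ, PowerSeries.coeff n f *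
    PowerSeries.coeff i ((PowerSeries.C (γ 0 1) + PowerSeries.C (γ 0 0) * PowerSeries.X) ^ n *
      linPow (γ 1 0) (γ 1 1) (k - 2 - n))

/-- The Tate algebra `ℚ_5⟨z⟩`: power series whose coefficients tend to `0`. -/
def IsTate (f : ℚ_[5]⟦X⟧) : Prop :=
  Filter.Tendsto (fun n : ℕ => PowerSeries.coeff n f) Filter.atTop (nhds 0)

/-! ### Automorphic forms and Hecke operators -/

/-- Overconvergent automorphic forms of weight `k` and level `gamma1Level`. -/
def IsOverconvergentForm (k : ℤ) (φ : Df → ℚ_[5]⟦X⟧) : Prop :=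
  (∀ g, IsTate (φ g)) ∧ (∀ (δ : (ℍ[ℚ])ˣ) (g : Df), φ (diag δ * g) = φ g) ∧
    ∀ g, ∀ u ∈ gamma1Level, φ (g * u) = slash k (mat5 u) (φ g)

/-- The matrix `v_i = (5, 0; 5i, 1)`. -/
def vMat (i : ℕ) : GL (Fin 2) ℚ_[5] :=
  Matrix.GeneralLinearGroup.mkOfDetNeZero !![5, 0; 5 * (i : ℚ_[5]), 1]
    (by simp [Matrix.det_fin_two])

/-- The Hecke operator `U_5`: `(U_5 φ)(g) = ∑ᵢ φ(g v_i⁻¹) ‖_k v_i`, `i = 0, …, 4`. -/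
def heckeU5 (k : ℤ) (φ : Df → ℚ_[5]⟦X⟧) : Df → ℚ_[5]⟦X⟧ := fun g =>
  ∑ i ∈ Finset.range 5, slash k (vMat i : Matrix (Fin 2) (Fin 2) ℚ_[5]) (φ (g * (at5 (vMat i))⁻¹))

open Classical in
/-- The overconvergent form `φ` of weight `k` with `φ(1) = z^j`. (It exists and is unique, since
`φ ↦ φ(1)` is an isomorphism from overconvergent forms onto `ℚ_5⟨z⟩`.) -/
def basisForm (k : ℤ) (j : ℕ) : Df → ℚ_[5]⟦X⟧ :=
  if h : ∃ φ, IsOverconvergentForm k φ ∧ φ 1 = PowerSeries.X ^ j then h.choose else 0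

/-- The entry `P_{i,j}` of the matrix of `U_5` with respect to the power basis `1, z, z², …`, where
forms are identified with elements of `ℚ_5⟨z⟩` by `φ ↦ φ(1)`. -/
def heckeEntry (k : ℤ) (i j : ℕ) : ℚ_[5] :=
  PowerSeries.coeff i (heckeU5 k (basisForm k j) 1)

/-- The upper left minor `P_n(k, a) = (P_{4i+a, 4j+a})`, `0 ≤ i, j ≤ n - 1`. -/
def heckeMinor (n : ℕ) (k : ℤ) (a : ℕ) : Matrix (Fin n) (Fin n) ℚ_[5] :=
  Matrix.of fun i j => heckeEntry k (4 * (i : ℕ) + a) (4 * (j : ℕ) + a)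

/-! ### Classical automorphic forms and their dimensions -/

/-- Polynomials of degree at most `k - 2`, as power series. -/
def IsPolyOfWeight (k : ℕ) (f : ℚ_[5]⟦X⟧) : Prop :=
  ∀ n : ℕ, k < n + 2 → PowerSeries.coeff n f = 0

theorem summable_slash {k : ℕ} {f : ℚ_[5]⟦X⟧} (hf : IsPolyOfWeight k f) (c : ℕ → ℚ_[5]) :
    Summable fun n : ℕ => PowerSeries.coeff n f * c n := by
  refine summable_of_hasFiniteSupport ((Set.finite_le_nat k).subset fun n hn => ?_)
  by_contra h
  exact hn (by simp [hf n (by simp at h; omega)])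

theorem slash_add {k : ℕ} (γ : Matrix (Fin 2) (Fin 2) ℚ_[5]) {f g : ℚ_[5]⟦X⟧}
    (hf : IsPolyOfWeight k f) (hg : IsPolyOfWeight k g) :
    slash k γ (f + g) = slash k γ f + slash k γ g := by
  ext i
  simp only [slash, PowerSeries.coeff_mk, map_add, add_mul]
  exact (summable_slash hf _).tsum_add (summable_slash hg _)

theorem slash_smul (k : ℕ) (γ : Matrix (Fin 2) (Fin 2) ℚ_[5]) (r : ℚ_[5]) (f : ℚ_[5]⟦X⟧) :
    slash k γ (r • f) = r • slash k γ f := by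
  ext i
  simp [slash, PowerSeries.coeff_mk, mul_assoc, tsum_mul_left]

theorem slash_zero (k : ℕ) (γ : Matrix (Fin 2) (Fin 2) ℚ_[5]) : slash k γ 0 = 0 := by
  ext i
  simp [slash]

/-- Classical automorphic forms of weight `k` and level `U`. -/
def classicalForms (k : ℕ) (U : Set Df) : Submodule ℚ_[5] (Df → ℚ_[5]⟦X⟧) where
  carrier := {φ | (∀ g, IsPolyOfWeight k (φ g)) ∧
    (∀ (δ : (ℍ[ℚ])ˣ) (g : Df), φ (diag δ * g) = φ g) ∧
    ∀ g, ∀ u ∈ U, φ (g * u) = slash k (mat5 u) (φ g)}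
  zero_mem' := ⟨fun _ _ _ => by simp, fun _ _ => rfl, fun _ _ _ => (slash_zero k _).symm⟩
  add_mem' := by
    rintro φ ψ ⟨h1, h2, h3⟩ ⟨h1', h2', h3'⟩
    refine ⟨fun g n hn => by simp [h1 g n hn, h1' g n hn], fun δ g => by simp [h2, h2'],
      fun g u hu => ?_⟩
    simp only [Pi.add_apply, h3 g u hu, h3' g u hu, slash_add _ (h1 g) (h1' g)]
  smul_mem' := by
    rintro r φ ⟨h1, h2, h3⟩
    refine ⟨fun g n hn => by simp [h1 g n hn], fun δ g => by simp [h2], fun g u hu => ?_⟩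
    simp only [Pi.smul_apply, h3 g u hu, slash_smul]

/-- The element `1 + j` of `D ⊗ ℚ_2`, a uniformizer of this division algebra. -/
def unif2 : (ℍ[ℚ_[2]])ˣ where
  val := quat 1 0 1 0
  inv := quat (1 / 2) 0 (-1 / 2) 0
  val_inv := by ext <;> simp <;> norm_num
  inv_val := by ext <;> simp <;> norm_num

/-- The operator `U_2`: `φ ↦ φ(· π₂)`, with `π₂` a uniformizer of `D ⊗ ℚ_2`. On forms whose level
is maximal at `2` it does not depend on the uniformizer. -/
def heckeU2 : Module.End ℚ_[5] (Df → ℚ_[5]⟦X⟧) :=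
  LinearMap.funLeft ℚ_[5] ℚ_[5]⟦X⟧ fun g : Df => g * single ⟨2, Nat.prime_two⟩ unif2

/-- The part of the space of classical forms on which `U_2` acts as it does on `z^a`, that is, by
`((-1 - ν) / 2)^(k-2) (-ν)^a`. -/
def classicalPart (k a : ℕ) (U : Set Df) : Submodule ℚ_[5] (Df → ℚ_[5]⟦X⟧) :=
  classicalForms k U ⊓
    Module.End.eigenspace heckeU2 (((-1 - nu) / 2) ^ (k - 2) * (-nu) ^ a)

/-- The dimension `d_{k,a}^unr`. -/
def dUnr (k a : ℕ) : ℕ := Module.finrank ℚ_[5] (classicalPart k a fullLevel)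

/-- The dimension `d_{k,a}^Iw`. -/
def dIw (k a : ℕ) : ℕ := Module.finrank ℚ_[5] (classicalPart k a gamma1Level)

/-! ### Ghost coefficients -/

theorem norm_exp_sub_one_le (m : ℤ) :
    ‖NormedSpace.exp (5 * (m : ℚ_[5])) - 1‖ ≤ 1 := by
  have term (n : ℕ) : ‖(5 * (m : ℚ_[5])) ^ n / (n.factorial : ℚ_[5])‖ ≤ 1 := by
    have hn : (n.factorial : ℚ_[5]) ≠ 0 := by exact_mod_cast n.factorial_ne_zero
    have e5 : ‖(5 : ℚ_[5])‖ = 5⁻¹ := by simpa using Padic.norm_p (p := 5)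
    rw [norm_div, div_le_one (norm_pos_iff.mpr hn), mul_pow, norm_mul, norm_pow, norm_pow, e5,
      Padic.norm_eq_zpow_neg_valuation hn, Padic.valuation_natCast]
    have h1 : ‖(m : ℚ_[5])‖ ^ n ≤ 1 := pow_le_one₀ (norm_nonneg _) (Padic.norm_int_le_one m)
    have h2 : ((5 : ℝ)⁻¹) ^ n ≤ (5 : ℝ) ^ (-(padicValNat 5 n.factorial : ℤ)) := by
      rw [inv_pow, ← zpow_natCast, ← zpow_neg]
      exact zpow_le_zpow_right₀ (by norm_num) (by
        have := padicValNat_factorial_le (p := 5) n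
        omega)
    calc ((5 : ℝ)⁻¹) ^ n * ‖(m : ℚ_[5])‖ ^ n ≤ ((5 : ℝ)⁻¹) ^ n * 1 := by gcongr
      _ ≤ _ := by simpa using h2
  have fin (s : Finset ℕ) :
      ‖∑ n ∈ s, (5 * (m : ℚ_[5])) ^ n / (n.factorial : ℚ_[5])‖ ≤ 1 :=
    IsUltrametricDist.norm_sum_le_of_forall_le_of_nonneg zero_le_one fun n _ => term n
  have main : ‖NormedSpace.exp (5 * (m : ℚ_[5]))‖ ≤ 1 := by
    rw [NormedSpace.exp_eq_tsum_div]
    by_cases h : Summable fun n : ℕ => (5 * (m : ℚ_[5])) ^ n / (n.factorial : ℚ_[5])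
    · exact le_of_tendsto h.hasSum.norm (Filter.Eventually.of_forall fin)
    · simp [tsum_eq_zero_of_not_summable h]
  rw [sub_eq_add_neg]
  exact (IsUltrametricDist.norm_add_le_max _ _).trans (max_le main (by simp))

/-- The point `w_k = exp(5 (k - 2)) - 1` of `ℤ_5`. -/
def weightPoint (k : ℤ) : ℤ_[5] :=
  ⟨NormedSpace.exp (5 * ((k - 2 : ℤ) : ℚ_[5])) - 1, norm_exp_sub_one_le (k - 2)⟩

/-- The exponent `m_n^{(a)}(l)`. -/
def ghostMult (n a l : ℕ) : ℕ :=
  if dUnr l a < n ∧ n + dUnr l a < dIw l a then min (n - dUnr l a) (dIw l a - dUnr l a - n) else 0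

/-- The ghost coefficient `g_n^{(a)}(w) = ∏ (w - w_l)^{m_n^{(a)}(l)}`, the product over all weights
`l ≥ 2` with `l ≡ 2a + 2 mod 4`; all but finitely many factors are `1`. -/
def ghostCoeff (n a : ℕ) : ℤ_[5][X] :=
  ∏ᶠ l ∈ {l : ℕ | 2 ≤ l ∧ l ≡ 2 * a + 2 [MOD 4]},
    (Polynomial.X - Polynomial.C (weightPoint (l : ℤ))) ^ ghostMult n a l

end QuatHecke

end

open scoped Quaternion PowerSeries Polynomial

noncomputable section

namespace QuatHecke

/-! ### Power series with geometrically bounded coefficients -/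

/-! The determinant is studied as a function of the weight. It has forced zeros at classical
weights, and its Taylor coefficients are highly divisible by 5; together these give the
divisibility.

Explicit quaternions. Five quaternions `heckeQuat s` of norm 5 turn `U_5` on values at 1 into the
sum of the `f ‖_k heckeQuat s` (`heckeEntry_eq`), so every matrix entry is explicit in `k`.

Zeros. In weight `l = 2a + 4x + 2` the operator acts on polynomials of degree at most `l - 2`.
Modulo powers of `j` there are six Hurwitz units, and the five quaternions are five of these times
`heckeQuat 0`. Hence the sum is the trace over all units followed by `heckeQuat 0`, minus one term
that reverses the order of monomials, as an Atkin-Lehner operator does. The trace lands in invariant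
polynomials, which are values at 1 of forms of full level; the reversing term has at most `2n - (x +
1)` nonzero columns in the `n × n` corner. Since the Iwahori dimension is at most `x + 1`, the
corank is at least the ghost multiplicity (`rank_slashMinor_le`, `ghostMult_add_le`), and corank `m`
forces a zero of order `m` of the determinant (`linearFactor_pow_dvd_det`).

Size. In the variable `X = k - 2`, powers of one-units and binomial coefficients become power series
of slope `3/4 = 1 - 1/4`, the loss `1/4` coming from factorials. Replacing `z^j` by `(z^5 - z)^q
z^r`, `j = 5q + r`, is unipotent and extracts `5^q`, because each Hecke matrix sends `z` to a
constant `ζ` with `ζ^5 = ζ` modulo `5z`. A further gain comes from digit sums in base 5. The result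
is that the `m`-th coefficient of the determinant has valuation at least `(3m + E)/4`, with `E ≥
detBound a n` (`exists_characteristic_matrix`, `detBound_le_sum_shifts`).

Comparison. Dividing out one zero raises `E` by 3, so after removing all `M` forced zeros the
cofactor `c` has valuation at least `(E + 3M)/4`. As `|w_k - w_l| = |5 (k - l)|`, it remains to see
that `c` has valuation at least `M`. Valuations being integers, `M ≤ E + 1` is enough. This is the
counting statement `sum_ghostMult_le`, whose input is a lower bound for the unramified dimension
from Klein's octahedral forms. -/

/-- Power series whose `m`-th coefficient has valuation at least `(3 m + E) / 4`. -/
def HasBound (E : ℤ) (f : ℚ_[5]⟦X⟧) : Prop :=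
  -- Fourth powers of norms keep the quarter-integral slope in integer exponents.
  ∀ m : ℕ, ‖PowerSeries.coeff m f‖ ^ 4 ≤ (5 : ℝ) ^ (-(3 * (m : ℤ) + E))

theorem norm_add_pow_four_le {a b : ℚ_[5]} {r : ℝ} (ha : ‖a‖ ^ 4 ≤ r) (hb : ‖b‖ ^ 4 ≤ r) :
    ‖a + b‖ ^ 4 ≤ r := by
  rcases le_total ‖a‖ ‖b‖ with h | h
  · exact (pow_le_pow_left₀ (norm_nonneg _) ((Padic.nonarchimedean a b).trans
      (max_le h le_rfl)) 4).trans hb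
  · exact (pow_le_pow_left₀ (norm_nonneg _) ((Padic.nonarchimedean a b).trans
      (max_le le_rfl h)) 4).trans ha

theorem norm_sum_pow_four_le {ι : Type*} (s : Finset ι) (f : ι → ℚ_[5]) {r : ℝ} (hr : 0 ≤ r)
    (h : ∀ i ∈ s, ‖f i‖ ^ 4 ≤ r) : ‖∑ i ∈ s, f i‖ ^ 4 ≤ r := by
  classical
  induction s using Finset.induction_on with
  | empty => simpa using hr
  | insert i s hi ih =>
    rw [Finset.sum_insert hi]
    exact norm_add_pow_four_le (h i (by simp)) (ih fun j hj => h j (by simp [hj]))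

namespace HasBound

variable {E E' : ℤ} {f g : ℚ_[5]⟦X⟧}

theorem mono (h : HasBound E f) (hE : E' ≤ E) : HasBound E' f := fun m =>
  (h m).trans (zpow_le_zpow_right₀ (by norm_num) (by omega))

theorem zero : HasBound E 0 := fun m => by simp; positivity

theorem add (hf : HasBound E f) (hg : HasBound E g) : HasBound E (f + g) := fun m => by
  rw [map_add]; exact norm_add_pow_four_le (hf m) (hg m)

theorem neg (hf : HasBound E f) : HasBound E (-f) := fun m => by
  rw [map_neg, norm_neg]; exact hf m

theorem sum {ι : Type*} (s : Finset ι) (F : ι → ℚ_[5]⟦X⟧) (h : ∀ i ∈ s, HasBound E (F i)) :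
    HasBound E (∑ i ∈ s, F i) := fun m => by
  rw [map_sum]
  exact norm_sum_pow_four_le _ _ (by positivity) fun i hi => h i hi m

theorem mul (hf : HasBound E f) (hg : HasBound E' g) : HasBound (E + E') (f * g) := fun m => by
  rw [PowerSeries.coeff_mul]
  refine norm_sum_pow_four_le _ _ (by positivity) fun p hp => ?_
  have hp' : p.1 + p.2 = m := Finset.HasAntidiagonal.mem_antidiagonal.mp hp
  rw [norm_mul, mul_pow]
  calc _ ≤ (5 : ℝ) ^ (-(3 * (p.1 : ℤ) + E)) * (5 : ℝ) ^ (-(3 * (p.2 : ℤ) + E')) :=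
        mul_le_mul (hf _) (hg _) (by positivity) (by positivity)
    _ = _ := by
        rw [← zpow_add₀ (by norm_num)]
        congr 1
        have : (p.1 : ℤ) + p.2 = m := by exact_mod_cast hp'
        linarith

theorem C {c : ℚ_[5]} (h : ‖c‖ ^ 4 ≤ (5 : ℝ) ^ (-E)) : HasBound E (PowerSeries.C c) := fun m => by
  rw [PowerSeries.coeff_C]
  split_ifs with hm
  · simpa [hm] using h
  · simp; positivity

theorem one : HasBound 0 1 := by
  have := C (c := 1) (E := 0) (by simp)
  simpa using this

theorem X : HasBound (-3) PowerSeries.X := fun m => by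
  rw [PowerSeries.coeff_X]
  split_ifs with hm
  · simp [hm]
  · simp; positivity

theorem prod {ι : Type*} (s : Finset ι) (F : ι → ℚ_[5]⟦X⟧) (e : ι → ℤ)
    (h : ∀ i ∈ s, HasBound (e i) (F i)) : HasBound (∑ i ∈ s, e i) (∏ i ∈ s, F i) := by
  classical
  induction s using Finset.induction_on with
  | empty => simpa using one
  | insert i s hi ih =>
    rw [Finset.sum_insert hi, Finset.prod_insert hi]
    exact (h i (by simp)).mul (ih fun j hj => h j (by simp [hj]))

theorem exists_of_C (c : ℚ_[5]) : ∃ E, HasBound E (PowerSeries.C c) := by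
  obtain ⟨n, hn⟩ := pow_unbounded_of_one_lt (‖c‖ ^ 4) (by norm_num : (1 : ℝ) < 5)
  exact ⟨-n, C (by simpa using hn.le)⟩

theorem coeff_norm_le_of_dvd (h : HasBound E f) (m : ℕ) : ‖PowerSeries.coeff m f‖ ^ 4 ≤ 5 ^ (-E) :=
  (h m).trans (zpow_le_zpow_right₀ (by norm_num) (by omega))

end HasBound

/-- The algebra of power series with a bound. -/
def boundedSeries : Subalgebra ℚ_[5] ℚ_[5]⟦X⟧ where
  carrier := {f | ∃ E, HasBound E f}
  mul_mem' := by rintro _ _ ⟨E, h⟩ ⟨E', h'⟩; exact ⟨_, h.mul h'⟩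
  add_mem' := by
    rintro _ _ ⟨E, h⟩ ⟨E', h'⟩
    exact ⟨min E E', (h.mono (min_le_left _ _)).add (h'.mono (min_le_right _ _))⟩
  algebraMap_mem' c := HasBound.exists_of_C c

theorem HasBound.summable {E : ℤ} {f : ℚ_[5]⟦X⟧} (h : HasBound E f) {x : ℚ_[5]} (hx : ‖x‖ ≤ 1) :
    Summable fun m => PowerSeries.coeff m f * x ^ m := by
  apply NonarchimedeanAddGroup.summable_of_tendsto_cofinite_zero
  rw [Nat.cofinite_eq_atTop, tendsto_zero_iff_norm_tendsto_zero]
  have h4 : Filter.Tendsto (fun m : ℕ => ‖PowerSeries.coeff m f * x ^ m‖ ^ 4) Filter.atTop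
      (nhds 0) := by
    have hg : Filter.Tendsto (fun m : ℕ => (5 : ℝ) ^ (-E) * (((5 : ℝ)⁻¹) ^ 3) ^ m) Filter.atTop
        (nhds 0) := by
      have := (tendsto_pow_atTop_nhds_zero_of_lt_one (r := ((5 : ℝ)⁻¹) ^ 3) (by norm_num)
        (by norm_num)).const_mul ((5 : ℝ) ^ (-E))
      rwa [mul_zero] at this
    refine squeeze_zero (fun m => by positivity) (fun m => ?_) hg
    have hxm : ‖x ^ m‖ ^ 4 ≤ 1 := by
      rw [norm_pow]; exact pow_le_one₀ (by positivity) (pow_le_one₀ (norm_nonneg _) hx)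
    rw [norm_mul, mul_pow]
    calc _ ≤ (5 : ℝ) ^ (-(3 * (m : ℤ) + E)) * 1 :=
          mul_le_mul (h m) hxm (by positivity) (by positivity)
      _ = _ := by
          rw [mul_one, neg_add, zpow_add₀ (by norm_num), mul_comm, ← pow_mul, inv_pow, zpow_neg,
            zpow_neg]
          norm_cast
  have := (Real.continuous_sqrt.comp Real.continuous_sqrt).tendsto 0 |>.comp h4
  simp only [Function.comp_def, Real.sqrt_zero] at this
  refine this.congr fun m => ?_
  rw [show ‖PowerSeries.coeff m f * x ^ m‖ ^ 4 = (‖PowerSeries.coeff m f * x ^ m‖ ^ 2) ^ 2 by ring,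
    Real.sqrt_sq (by positivity), Real.sqrt_sq (by positivity)]

instance : NonarchimedeanRing ℚ_[5] where
  is_nonarchimedean := NonarchimedeanAddGroup.is_nonarchimedean

/-- Evaluation of a bounded series at a `5`-adic integer. -/
def evalAt (x : ℤ_[5]) : boundedSeries →ₐ[ℚ_[5]] ℚ_[5] where
  toFun f := ∑' m, PowerSeries.coeff m (f : ℚ_[5]⟦X⟧) * (x : ℚ_[5]) ^ m
  map_one' := by
    rw [tsum_eq_single 0 fun m hm => by simp [PowerSeries.coeff_one, hm]]
    simp
  map_zero' := by simp
  map_add' f g := by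
    obtain ⟨E, h⟩ := f.2
    obtain ⟨E', h'⟩ := g.2
    rw [← (h.summable x.2).tsum_add (h'.summable x.2)]
    exact tsum_congr fun m => by simp [add_mul]
  map_mul' f g := by
    obtain ⟨E, h⟩ := f.2
    obtain ⟨E', h'⟩ := g.2
    have hs := (h.summable x.2).mul_of_nonarchimedean (h'.summable x.2)
    rw [(h.summable x.2).tsum_mul_tsum_eq_tsum_sum_antidiagonal (h'.summable x.2) hs]
    refine tsum_congr fun m => ?_
    rw [MulMemClass.coe_mul, PowerSeries.coeff_mul, Finset.sum_mul]
    refine Finset.sum_congr rfl fun p hp => ?_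
    have hp : p.1 + p.2 = m := Finset.HasAntidiagonal.mem_antidiagonal.mp hp
    rw [← hp, pow_add]; ring
  commutes' c := by
    rw [tsum_eq_single 0 fun m hm => by
      simp [PowerSeries.coeff_C, hm]]
    simp

theorem evalAt_apply (x : ℤ_[5]) (f : boundedSeries) :
    evalAt x f = ∑' m, PowerSeries.coeff m (f : ℚ_[5]⟦X⟧) * (x : ℚ_[5]) ^ m := rfl

theorem HasBound.norm_evalAt_le {E : ℤ} {f : boundedSeries} (h : HasBound E (f : ℚ_[5]⟦X⟧))
    (x : ℤ_[5]) : ‖evalAt x f‖ ^ 4 ≤ (5 : ℝ) ^ (-E) := by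
  have hs := (h.summable x.2).hasSum
  refine le_of_tendsto ((hs.norm).pow 4) (Filter.Eventually.of_forall fun s => ?_)
  refine norm_sum_pow_four_le _ _ (by positivity) fun m _ => ?_
  rw [norm_mul, mul_pow]
  calc _ ≤ (5 : ℝ) ^ (-E) * 1 := by
        refine mul_le_mul (h.coeff_norm_le_of_dvd m) ?_ (by positivity) (by positivity)
        rw [norm_pow]; exact pow_le_one₀ (by positivity) (pow_le_one₀ (norm_nonneg _) x.2)
    _ = _ := mul_one _

/-- Synthetic division: the quotient has `m`-th coefficient `∑ₛ c_{m+1+s} x^s`, which involves only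
coefficients of index above `m`. The shift of index by one is worth 3 in the bound. -/
theorem HasBound.exists_eq_X_sub_C_mul {E : ℤ} {f : boundedSeries}
    (h : HasBound E (f : ℚ_[5]⟦X⟧)) {x : ℤ_[5]} (hx : evalAt x f = 0) :
    ∃ g : ℚ_[5]⟦X⟧, HasBound (E + 3) g ∧
      (f : ℚ_[5]⟦X⟧) = (PowerSeries.X - PowerSeries.C (x : ℚ_[5])) * g := by
  set c := fun m => PowerSeries.coeff m (f : ℚ_[5]⟦X⟧) with hc
  have hb (m s : ℕ) : ‖c (m + 1 + s) * (x : ℚ_[5]) ^ s‖ ^ 4 ≤ (5 : ℝ) ^ (-(3 * (m : ℤ) + (E + 3))) := by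
    rw [norm_mul, mul_pow]
    calc _ ≤ (5 : ℝ) ^ (-(3 * ((m + 1 + s : ℕ) : ℤ) + E)) * 1 := by
          refine mul_le_mul (h _) ?_ (by positivity) (by positivity)
          rw [norm_pow]; exact pow_le_one₀ (by positivity) (pow_le_one₀ (norm_nonneg _) x.2)
      _ ≤ _ := by
          rw [mul_one]
          exact zpow_le_zpow_right₀ (by norm_num) (by push_cast; linarith)
  have hs0 := h.summable x.2
  have hs (m : ℕ) : Summable fun s => c (m + 1 + s) * (x : ℚ_[5]) ^ s := by
    -- For `x ≠ 0` this is a tail of the convergent series divided by `x ^ (m + 1)`; for `x = 0`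
    -- only one term survives.
    by_cases h0 : (x : ℚ_[5]) = 0
    · refine summable_of_ne_finset_zero (s := {0}) fun s hs => ?_
      rw [h0, zero_pow (by simpa using hs), mul_zero]
    · have h1 := ((summable_nat_add_iff (m + 1)).mpr hs0).mul_right ((x : ℚ_[5]) ^ (m + 1))⁻¹
      refine h1.congr fun s => ?_
      have : (x : ℚ_[5]) ^ (m + 1) ≠ 0 := pow_ne_zero _ h0
      simp only [hc]
      rw [add_comm s (m + 1), pow_add]
      field_simp
  refine ⟨PowerSeries.mk fun m => ∑' s, c (m + 1 + s) * (x : ℚ_[5]) ^ s, fun m => ?_, ?_⟩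
  · rw [PowerSeries.coeff_mk]
    exact le_of_tendsto (((hs m).hasSum.norm).pow 4) (Filter.Eventually.of_forall fun s =>
      norm_sum_pow_four_le _ _ (by positivity) fun i _ => hb m i)
  · have step (m : ℕ) : ∑' s, c (m + s) * (x : ℚ_[5]) ^ s =
        c m + x * ∑' s, c (m + 1 + s) * (x : ℚ_[5]) ^ s := by
      have hsm : Summable fun s => c (m + s) * (x : ℚ_[5]) ^ s := by
        rcases m with _ | m
        · simpa using hs0
        · exact hs m
      rw [hsm.tsum_eq_zero_add, ← tsum_mul_left]
      congr 1
      · simp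
      · refine tsum_congr fun s => ?_
        rw [show m + (s + 1) = m + 1 + s by ring]; ring
    ext m
    rw [sub_mul, map_sub, PowerSeries.coeff_C_mul, PowerSeries.coeff_mk]
    rcases m with _ | m
    · rw [PowerSeries.coeff_zero_X_mul]
      have := step 0
      rw [evalAt_apply] at hx
      simp only [zero_add] at this ⊢
      rw [hc] at this ⊢
      simp only at this ⊢
      rw [hx] at this
      linear_combination -this
    · rw [PowerSeries.coeff_succ_X_mul, PowerSeries.coeff_mk]
      have := step (m + 1)
      simp only [hc] at this ⊢
      linear_combination -this

/-- The bounded series `X - x`. -/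
def linearFactor (x : ℤ_[5]) : boundedSeries :=
  ⟨PowerSeries.X - PowerSeries.C (x : ℚ_[5]), sub_mem ⟨_, HasBound.X⟩ (HasBound.exists_of_C _)⟩

theorem evalAt_C (x : ℤ_[5]) (c : ℚ_[5]) : evalAt x (algebraMap ℚ_[5] boundedSeries c) = c := by
  simp

theorem evalAt_linearFactor (x y : ℤ_[5]) : evalAt y (linearFactor x) = y - x := by
  rw [evalAt_apply, tsum_eq_sum (s := {0, 1}) fun m hm => ?_]
  · simp [linearFactor, PowerSeries.coeff_X, PowerSeries.coeff_C]; ring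
  · simp only [Finset.mem_insert, Finset.mem_singleton, not_or] at hm
    simp [linearFactor, PowerSeries.coeff_X, PowerSeries.coeff_C, hm.1, hm.2]

theorem linearFactor_dvd_iff {x : ℤ_[5]} {f : boundedSeries} :
    linearFactor x ∣ f ↔ evalAt x f = 0 := by
  constructor
  · rintro ⟨g, rfl⟩
    rw [map_mul, evalAt_linearFactor, sub_self, zero_mul]
  · intro h
    obtain ⟨E, hE⟩ := f.2
    obtain ⟨g, hg, hfg⟩ := HasBound.exists_eq_X_sub_C_mul hE h
    exact ⟨⟨g, _, hg⟩, Subtype.ext hfg⟩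

theorem linearFactor_ne_zero (x : ℤ_[5]) : (linearFactor x : ℚ_[5]⟦X⟧) ≠ 0 := fun h => by
  have := congrArg (PowerSeries.coeff 1) h
  simp [linearFactor, PowerSeries.coeff_X] at this

theorem HasBound.of_linearFactor_pow_mul {E : ℤ} {x : ℤ_[5]} (m : ℕ) {g : boundedSeries}
    (h : HasBound E ((linearFactor x ^ m * g : boundedSeries) : ℚ_[5]⟦X⟧)) :
    HasBound (E + 3 * m) (g : ℚ_[5]⟦X⟧) := by
  induction m generalizing E with
  | zero => simpa using h
  | succ m ih =>
    have h0 : evalAt x (linearFactor x ^ (m + 1) * g) = 0 := by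
      rw [map_mul, map_pow, evalAt_linearFactor, sub_self]; simp
    obtain ⟨g', hg', he⟩ := HasBound.exists_eq_X_sub_C_mul h h0
    have : g' = ((linearFactor x ^ m * g : boundedSeries) : ℚ_[5]⟦X⟧) := by
      apply mul_left_cancel₀ (linearFactor_ne_zero x)
      rw [← MulMemClass.coe_mul, ← mul_assoc, ← pow_succ']
      exact he.symm
    rw [this] at hg'
    have := ih hg'
    refine this.mono (le_of_eq ?_)
    push_cast; ring

/-- The difference of the two factors is a nonzero constant, hence a unit. -/
theorem isCoprime_linearFactor {x y : ℤ_[5]} (h : x ≠ y) :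
    IsCoprime (linearFactor x) (linearFactor y) := by
  have hne : ((y : ℚ_[5]) - x) ≠ 0 := sub_ne_zero.mpr fun e => h (Subtype.ext e.symm)
  refine ⟨algebraMap _ _ ((y : ℚ_[5]) - x)⁻¹, -algebraMap _ _ ((y : ℚ_[5]) - x)⁻¹, ?_⟩
  have : linearFactor x - linearFactor y = algebraMap _ _ ((y : ℚ_[5]) - x) := by
    apply Subtype.ext
    change ((PowerSeries.X - PowerSeries.C (x : ℚ_[5]) : ℚ_[5]⟦X⟧)) - (PowerSeries.X - PowerSeries.C (y : ℚ_[5]))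
      = PowerSeries.C ((y : ℚ_[5]) - x)
    rw [map_sub]; ring
  set u := algebraMap ℚ_[5] boundedSeries ((y : ℚ_[5]) - x)⁻¹ with hu
  have h2 : u * (linearFactor x - linearFactor y) = 1 := by
    rw [this, hu, ← map_mul, inv_mul_cancel₀ hne, map_one]
  linear_combination h2

theorem HasBound.of_prod_linearFactor_mul {E : ℤ} {ι : Type*} (s : Finset ι) (x : ι → ℤ_[5])
    (m : ι → ℕ) {g : boundedSeries}
    (h : HasBound E (((∏ i ∈ s, linearFactor (x i) ^ m i) * g : boundedSeries) : ℚ_[5]⟦X⟧)) :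
    HasBound (E + 3 * ∑ i ∈ s, (m i : ℤ)) (g : ℚ_[5]⟦X⟧) := by
  classical
  induction s using Finset.induction_on generalizing E with
  | empty => simpa using h
  | insert i s hi ih =>
    rw [Finset.prod_insert hi, mul_assoc] at h
    have := ih (HasBound.of_linearFactor_pow_mul _ h)
    rw [Finset.sum_insert hi]
    exact this.mono (le_of_eq (by ring))

/-- A bounded series that vanishes at distinct points to given orders, evaluated at a `5`-adic
integer, is divisible by the corresponding product. -/
theorem HasBound.exists_evalAt_eq {E : ℤ} {F : boundedSeries} (hF : HasBound E (F : ℚ_[5]⟦X⟧))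
    {ι : Type*} (s : Finset ι) (x : ι → ℤ_[5]) (hx : Set.InjOn x s) (m : ι → ℕ)
    (h : ∀ i ∈ s, linearFactor (x i) ^ m i ∣ F) (y : ℤ_[5]) :
    ∃ c : ℚ_[5], ‖c‖ ^ 4 ≤ (5 : ℝ) ^ (-(E + 3 * ∑ i ∈ s, (m i : ℤ))) ∧
      evalAt y F = (∏ i ∈ s, ((y : ℚ_[5]) - x i) ^ m i) * c := by
  obtain ⟨g, rfl⟩ := Finset.prod_dvd_of_coprime (fun i hi j hj hij =>
    (isCoprime_linearFactor fun e => hij (hx hi hj e)).pow) h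
  refine ⟨evalAt y g, (HasBound.of_prod_linearFactor_mul s x m hF).norm_evalAt_le y, ?_⟩
  rw [map_mul, map_prod]
  simp [evalAt_linearFactor]

/-! ### Determinants over the algebra of bounded series -/

-- Row and column operations over `ℚ_5` that diagonalise `A(x)` can be applied to `A` itself as
-- constant matrices of determinant 1. Every column with zero pivot is then divisible by `X - x`,
-- and the number of such columns is the corank of `A(x)`.
open Matrix in
theorem linearFactor_pow_dvd_det {n : Type} [Fintype n] [DecidableEq n]
    (A : Matrix n n boundedSeries) (x : ℤ_[5]) (m : ℕ)
    (h : (A.map (evalAt x)).rank + m ≤ Fintype.card n) : linearFactor x ^ m ∣ A.det := by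
  classical
  obtain ⟨L, L', D, hD⟩ :=
    Pivot.exists_list_transvec_mul_mul_list_transvec_eq_diagonal (A.map (evalAt x))
  set P := (L.map TransvectionStruct.toMatrix).prod with hP
  set Q := (L'.map TransvectionStruct.toMatrix).prod with hQ
  have dP : P.det = 1 := TransvectionStruct.det_toMatrix_prod L
  have dQ : Q.det = 1 := TransvectionStruct.det_toMatrix_prod L'
  set ι := algebraMap ℚ_[5] boundedSeries
  set B := P.map ι * A * Q.map ι with hB
  have hdet : B.det = A.det := by
    rw [hB, det_mul, det_mul, ← RingHom.mapMatrix_apply, ← RingHom.mapMatrix_apply,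
      ← RingHom.map_det, ← RingHom.map_det, dP, dQ]
    simp
  have hcomp (M : Matrix n n ℚ_[5]) : (M.map ι).map (evalAt x) = M := by
    ext i j; simp [ι]
  have hBe : B.map (evalAt x) = diagonal D := by
    rw [← hD, hB]
    change (evalAt x).toRingHom.mapMatrix _ = _
    rw [map_mul, map_mul]
    change (P.map ι).map (evalAt x) * _ * (Q.map ι).map (evalAt x) = _
    rw [hcomp, hcomp]
    rfl
  have hrank : (diagonal D).rank ≤ (A.map (evalAt x)).rank := by
    rw [← hD]
    exact (rank_mul_le_left _ _).trans (rank_mul_le_right _ _)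
  rw [rank_diagonal] at hrank
  set Z := Finset.univ.filter fun i => D i = 0 with hZ
  have hZc : m ≤ Z.card := by
    have h1 : Z.card + Fintype.card {i // D i ≠ 0} = Fintype.card n := by
      rw [Fintype.card_subtype, hZ]
      exact Finset.card_filter_add_card_filter_not (s := Finset.univ) (fun i => D i = 0)
    omega
  have hdvd (i j) (hj : D j = 0) : linearFactor x ∣ B i j := by
    rw [linearFactor_dvd_iff]
    have := congrFun (congrFun hBe i) j
    rw [map_apply] at this
    rw [this, diagonal_apply]
    split_ifs with hij
    · rw [hij, hj]
    · rfl
  have hex (i j) : ∃ c, B i j = (if D j = 0 then linearFactor x else 1) * c := by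
    split_ifs with hj
    · exact hdvd i j hj
    · exact ⟨_, (one_mul _).symm⟩
  choose c hc using hex
  have hBc : B = of fun i j => (if D j = 0 then linearFactor x else 1) * (of c) i j := by
    ext1 i j; exact hc i j
  rw [← hdet, hBc, det_mul_row]
  refine Dvd.dvd.mul_right ?_ _
  rw [Finset.prod_ite]
  simp only [Finset.prod_const_one, mul_one, Finset.prod_const]
  exact pow_dvd_pow _ hZc

/-- The bound on a determinant that comes from separate bounds for rows and columns. -/
theorem HasBound.det {n : Type} [Fintype n] [DecidableEq n] (A : Matrix n n boundedSeries)
    (r c : n → ℤ) (h : ∀ i j, HasBound (r i + c j) (A i j : ℚ_[5]⟦X⟧)) :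
    HasBound (∑ i, r i + ∑ j, c j) (A.det : ℚ_[5]⟦X⟧) := by
  rw [Matrix.det_apply, AddSubmonoidClass.coe_finsetSum]
  refine HasBound.sum _ _ fun σ _ => ?_
  have h1 : HasBound (∑ i, (r (σ i) + c i))
      ((∏ i, A (σ i) i : boundedSeries) : ℚ_[5]⟦X⟧) := by
    rw [SubmonoidClass.coe_finsetProd]
    exact HasBound.prod _ _ _ fun i _ => h (σ i) i
  rw [Finset.sum_add_distrib, Equiv.sum_comp σ] at h1
  rcases Int.units_eq_one_or (Equiv.Perm.sign σ) with hσ | hσ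
  · rw [hσ, one_smul]; exact h1
  · have := h1.neg
    rw [hσ, Units.neg_smul, one_smul]; exact this

/-! ### The exponential function on `5 ℤ_5` -/

theorem norm_five : ‖(5 : ℚ_[5])‖ = 5⁻¹ := by simpa using Padic.norm_p (p := 5)

theorem norm_inv_factorial (m : ℕ) :
    ‖((m.factorial : ℚ_[5]))⁻¹‖ = (5 : ℝ) ^ padicValNat 5 m.factorial := by
  have hn : (m.factorial : ℚ_[5]) ≠ 0 := by exact_mod_cast m.factorial_ne_zero
  rw [norm_inv, Padic.norm_eq_zpow_neg_valuation hn, Padic.valuation_natCast]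
  simp

/-- Legendre's formula: the difference of the two sides is the digit sum of `m` in base 5. -/
theorem four_mul_padicValNat_factorial_le (m : ℕ) : 4 * padicValNat 5 m.factorial ≤ m := by
  have := sub_one_mul_padicValNat_factorial (p := 5) m
  omega

theorem four_mul_padicValNat_factorial_lt {m : ℕ} (hm : m ≠ 0) :
    4 * padicValNat 5 m.factorial < m := by
  have := sub_one_mul_padicValNat_factorial_lt_of_ne_zero (p := 5) hm
  omega

/-- The series `∑ L^m X^m / m!`. -/
def expSeries (L : ℚ_[5]) : ℚ_[5]⟦X⟧ := PowerSeries.mk fun m => L ^ m / m.factorial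

/-- The valuation of `L^m / m!` is at least `m - m/4`; this is the origin of the slope `3/4`. -/
theorem hasBound_expSeries {L : ℚ_[5]} (hL : ‖L‖ ≤ 5⁻¹) : HasBound 0 (expSeries L) := fun m => by
  rw [expSeries, PowerSeries.coeff_mk, div_eq_mul_inv, norm_mul, norm_inv_factorial, norm_pow,
    mul_pow, ← pow_mul, ← pow_mul]
  calc _ ≤ ((5 : ℝ)⁻¹) ^ (m * 4) * (5 : ℝ) ^ (padicValNat 5 m.factorial * 4) := by gcongr
    _ ≤ ((5 : ℝ)⁻¹) ^ (m * 4) * (5 : ℝ) ^ m := by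
        have := four_mul_padicValNat_factorial_le m
        gcongr
        · norm_num
        · omega
    _ = _ := by
        rw [inv_pow, ← zpow_natCast, ← zpow_natCast, ← zpow_neg, ← zpow_add₀ (by norm_num)]
        congr 1
        push_cast; ring

theorem expSeries_eq_rescale (L : ℚ_[5]) :
    expSeries L = PowerSeries.rescale L (PowerSeries.exp ℚ_[5]) := by
  ext m
  simp [expSeries, PowerSeries.coeff_rescale, PowerSeries.coeff_exp, div_eq_mul_inv]

theorem expSeries_add (L L' : ℚ_[5]) : expSeries (L + L') = expSeries L * expSeries L' := by
  simp only [expSeries_eq_rescale]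
  exact (PowerSeries.exp_mul_exp_eq_exp_add L L').symm

theorem norm_add_le_inv_five {L L' : ℚ_[5]} (hL : ‖L‖ ≤ 5⁻¹) (hL' : ‖L'‖ ≤ 5⁻¹) :
    ‖L + L'‖ ≤ 5⁻¹ := (Padic.nonarchimedean L L').trans (max_le hL hL')

/-- The exponential function. -/
def expFun (x : ℚ_[5]) : ℚ_[5] := ∑' m : ℕ, x ^ m / m.factorial

theorem expFun_eq_evalAt {L : ℚ_[5]} (hL : ‖L‖ ≤ 5⁻¹) (x : ℤ_[5]) :
    evalAt x ⟨expSeries L, _, hasBound_expSeries hL⟩ = expFun (L * x) := by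
  rw [evalAt_apply, expFun]
  refine tsum_congr fun m => ?_
  simp only [expSeries, PowerSeries.coeff_mk]
  ring

/-- The identity is formal for the series in `X`, and evaluation at 1 is a ring homomorphism on
bounded series. -/
theorem expFun_add {L L' : ℚ_[5]} (hL : ‖L‖ ≤ 5⁻¹) (hL' : ‖L'‖ ≤ 5⁻¹) :
    expFun (L + L') = expFun L * expFun L' := by
  have h := expFun_eq_evalAt hL 1
  have h' := expFun_eq_evalAt hL' 1
  have h'' := expFun_eq_evalAt (norm_add_le_inv_five hL hL') 1
  simp only [PadicInt.coe_one, mul_one] at h h' h''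
  rw [← h, ← h', ← h'', ← map_mul]
  congr 1
  exact Subtype.ext (expSeries_add L L')

theorem expFun_zero : expFun 0 = 1 := by
  rw [expFun, tsum_eq_single 0 fun m hm => by simp [hm]]
  simp

theorem summable_exp {L : ℚ_[5]} (hL : ‖L‖ ≤ 5⁻¹) :
    Summable fun m : ℕ => L ^ m / (m.factorial : ℚ_[5]) := by
  have := (hasBound_expSeries hL).summable (x := 1) (by simp)
  simpa [expSeries] using this

theorem norm_intCast_mul_le {L : ℚ_[5]} (hL : ‖L‖ ≤ 5⁻¹) (k : ℤ) : ‖L * k‖ ≤ 5⁻¹ := by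
  rw [norm_mul]
  calc _ ≤ (5 : ℝ)⁻¹ * 1 := by gcongr; exact Padic.norm_int_le_one k
    _ = _ := mul_one _

theorem expFun_mul_natCast {L : ℚ_[5]} (hL : ‖L‖ ≤ 5⁻¹) (k : ℕ) : expFun (L * k) = expFun L ^ k := by
  induction k with
  | zero => simp [expFun_zero]
  | succ k ih =>
    have : ‖L * k‖ ≤ 5⁻¹ := by simpa using norm_intCast_mul_le hL k
    rw [Nat.cast_succ, mul_add, mul_one, expFun_add this hL, ih, pow_succ]

theorem expFun_mul_intCast {L : ℚ_[5]} (hL : ‖L‖ ≤ 5⁻¹) (k : ℤ) : expFun (L * k) = expFun L ^ k := by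
  obtain ⟨n, rfl | rfl⟩ := k.eq_nat_or_neg
  · simpa using expFun_mul_natCast hL n
  · have h1 : ‖L * n‖ ≤ 5⁻¹ := by simpa using norm_intCast_mul_le hL n
    have := expFun_add h1 (L' := -(L * n)) (by simpa using h1)
    rw [add_neg_cancel, expFun_zero, expFun_mul_natCast hL] at this
    rw [zpow_neg, zpow_natCast]
    simp only [Int.cast_neg, Int.cast_natCast, mul_neg]
    exact eq_inv_of_mul_eq_one_right this.symm

/-! ### The exponential as an isometry, and its inverse -/

theorem norm_pow_sub_pow_le {u v : ℚ_[5]} (hu : ‖u‖ ≤ 5⁻¹) (hv : ‖v‖ ≤ 5⁻¹) (m : ℕ) :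
    ‖u ^ (m + 1) - v ^ (m + 1)‖ ≤ ‖u - v‖ * (5 : ℝ)⁻¹ ^ m := by
  rw [← (Commute.all u v).mul_geom_sum₂, norm_mul]
  · gcongr
    refine IsUltrametricDist.norm_sum_le_of_forall_le_of_nonneg (by positivity) fun i hi => ?_
    have hi' : i + (m - i) = m := by simp at hi; omega
    rw [norm_mul, norm_pow, norm_pow, show m + 1 - 1 - i = m - i by omega]
    calc _ ≤ (5 : ℝ)⁻¹ ^ i * (5 : ℝ)⁻¹ ^ (m - i) := by gcongr
      _ = _ := by rw [← pow_add, hi']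

/-- The term of degree `m + 2` is smaller than `u - v` by a factor `5^(m+1)`, of which `(m+2)!`
takes back at most `5^m`. -/
theorem norm_expFun_sub_sub_le {u v : ℚ_[5]} (hu : ‖u‖ ≤ 5⁻¹) (hv : ‖v‖ ≤ 5⁻¹) :
    ‖expFun u - expFun v - (u - v)‖ ≤ 5⁻¹ * ‖u - v‖ := by
  have hs := (summable_exp hu).sub (summable_exp hv)
  have hd : expFun u - expFun v - (u - v) =
      ∑' m : ℕ, (u ^ (m + 2) / ((m + 2).factorial : ℚ_[5]) -
        v ^ (m + 2) / ((m + 2).factorial : ℚ_[5])) := by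
    rw [expFun, expFun, ← (summable_exp hu).tsum_sub (summable_exp hv), hs.tsum_eq_zero_add,
      ((summable_nat_add_iff 1).mpr hs).tsum_eq_zero_add]
    simp
  have hs2 := (summable_nat_add_iff 2).mpr hs
  rw [hd]
  refine le_of_tendsto hs2.hasSum.norm (Filter.Eventually.of_forall fun s => ?_)
  refine IsUltrametricDist.norm_sum_le_of_forall_le_of_nonneg (by positivity) fun m _ => ?_
  rw [← sub_div, div_eq_mul_inv, norm_mul, norm_inv_factorial]
  have hv' := four_mul_padicValNat_factorial_lt (m := m + 2) (by omega)
  calc _ ≤ (‖u - v‖ * (5 : ℝ)⁻¹ ^ (m + 1)) * 5 ^ padicValNat 5 (m + 2).factorial := by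
        gcongr; exact norm_pow_sub_pow_le hu hv (m + 1)
    _ ≤ (‖u - v‖ * (5 : ℝ)⁻¹ ^ (m + 1)) * 5 ^ m := by
        gcongr
        · norm_num
        · omega
    _ = _ := by
        rw [pow_succ, inv_pow]; field_simp

theorem norm_expFun_sub {u v : ℚ_[5]} (hu : ‖u‖ ≤ 5⁻¹) (hv : ‖v‖ ≤ 5⁻¹) :
    ‖expFun u - expFun v‖ = ‖u - v‖ := by
  rcases eq_or_ne u v with rfl | h
  · simp
  have h0 : 0 < ‖u - v‖ := norm_pos_iff.mpr (sub_ne_zero.mpr h)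
  have hlt : ‖expFun u - expFun v - (u - v)‖ < ‖u - v‖ :=
    (norm_expFun_sub_sub_le hu hv).trans_lt (by nlinarith)
  have := IsUltrametricDist.norm_add_eq_max_of_norm_ne_norm hlt.ne
  rw [sub_add_cancel, max_eq_right hlt.le] at this
  exact this

theorem norm_five_mul_le (x : ℤ_[5]) : ‖5 * (x : ℚ_[5])‖ ≤ 5⁻¹ := by
  rw [norm_mul, norm_five]
  calc _ ≤ (5 : ℝ)⁻¹ * 1 := by gcongr; exact x.2
    _ = _ := mul_one _

/-- The logarithm as a fixed point: `x ↦ x - (exp(5x) - d)/5` is a contraction of `ℤ_5`, because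
`exp(5x)` differs from its linear part by a contraction. -/
theorem exists_expFun_eq {d : ℚ_[5]} (hd : ‖d - 1‖ ≤ 5⁻¹) : ∃ L : ℚ_[5], ‖L‖ ≤ 5⁻¹ ∧ expFun L = d := by
  have h5 : (5 : ℚ_[5]) ≠ 0 := by norm_num
  have hn5 (z : ℚ_[5]) : ‖z / 5‖ = 5 * ‖z‖ := by rw [norm_div, norm_five]; field_simp
  have key (x y : ℤ_[5]) : ‖((x : ℚ_[5]) - (expFun (5 * x) - d) / 5) -
      ((y : ℚ_[5]) - (expFun (5 * y) - d) / 5)‖ ≤ 5⁻¹ * ‖(x : ℚ_[5]) - y‖ := by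
    have := norm_expFun_sub_sub_le (norm_five_mul_le x) (norm_five_mul_le y)
    rw [← mul_sub, norm_mul, norm_five] at this
    have e : ((x : ℚ_[5]) - (expFun (5 * x) - d) / 5) - ((y : ℚ_[5]) - (expFun (5 * y) - d) / 5) =
        -((expFun (5 * x) - expFun (5 * y) - 5 * ((x : ℚ_[5]) - y)) / 5) := by
      field_simp; ring
    rw [e, norm_neg, hn5]
    linarith
  have hbd (x : ℤ_[5]) : ‖(x : ℚ_[5]) - (expFun (5 * x) - d) / 5‖ ≤ 1 := by
    have h1 := key x 0
    simp only [PadicInt.coe_zero, mul_zero, expFun_zero, zero_sub, sub_zero] at h1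
    have h2 : ‖-((1 - d) / 5)‖ ≤ 1 := by
      rw [norm_neg, hn5, norm_sub_rev]; linarith
    have h3 : (5 : ℝ)⁻¹ * ‖(x : ℚ_[5])‖ ≤ 1 := by have := x.2; nlinarith [norm_nonneg (x : ℚ_[5])]
    have := (Padic.nonarchimedean _ _).trans (max_le (h1.trans h3) h2)
    rwa [sub_add_cancel] at this
  let T : ℤ_[5] → ℤ_[5] := fun x => ⟨_, hbd x⟩
  have hT : ContractingWith (5⁻¹ : NNReal) T := by
    refine ⟨by rw [← NNReal.coe_lt_coe]; norm_num, LipschitzWith.of_dist_le_mul fun x y => ?_⟩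
    rw [dist_eq_norm, dist_eq_norm, PadicInt.norm_def, PadicInt.norm_def]
    rw [PadicInt.coe_sub, PadicInt.coe_sub]
    simpa only [NNReal.coe_inv, NNReal.coe_ofNat] using key x y
  obtain ⟨x, hx⟩ : ∃ x, T x = x := ⟨_, hT.fixedPoint_isFixedPt⟩
  refine ⟨5 * x, norm_five_mul_le x, ?_⟩
  have := congrArg (fun z : ℤ_[5] => (z : ℚ_[5])) hx
  simp only [T] at this
  have h : (expFun (5 * x) - d) / 5 = 0 := by linear_combination -this
  rw [div_eq_zero_iff, sub_eq_zero] at h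
  exact h.resolve_right h5

/-- Powers of a one-unit are interpolated by a bounded series. -/
theorem exists_boundedSeries_zpow {d : ℚ_[5]} (hd : ‖d - 1‖ ≤ 5⁻¹) :
    ∃ f : boundedSeries, HasBound 0 (f : ℚ_[5]⟦X⟧) ∧ ∀ k : ℤ, evalAt k f = d ^ k := by
  obtain ⟨L, hL, rfl⟩ := exists_expFun_eq hd
  refine ⟨⟨expSeries L, _, hasBound_expSeries hL⟩, hasBound_expSeries hL, fun k => ?_⟩
  rw [expFun_eq_evalAt hL, PadicInt.coe_intCast, expFun_mul_intCast hL]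

theorem coe_weightPoint (k : ℤ) :
    (weightPoint k : ℚ_[5]) = expFun (5 * ((k - 2 : ℤ) : ℚ_[5])) - 1 := by
  change NormedSpace.exp (5 * ((k - 2 : ℤ) : ℚ_[5])) - 1 = _
  rw [NormedSpace.exp_eq_tsum_div]
  rfl

theorem norm_weightPoint_sub (k l : ℤ) :
    ‖(weightPoint k : ℚ_[5]) - weightPoint l‖ = ‖5 * ((k : ℚ_[5]) - l)‖ := by
  rw [coe_weightPoint, coe_weightPoint, sub_sub_sub_cancel_right]
  have h (m : ℤ) : ‖5 * (m : ℚ_[5])‖ ≤ 5⁻¹ := by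
    simpa using norm_five_mul_le (m : ℤ_[5])
  rw [norm_expFun_sub (h _) (h _)]
  congr 1
  push_cast; ring

/-! ### Binomial series -/

/-- The binomial coefficient `X choose r` as a power series in `X`. -/
def binomSeries (r : ℕ) : ℚ_[5]⟦X⟧ :=
  PowerSeries.C ((r.factorial : ℚ_[5])⁻¹) * ∏ i ∈ Finset.range r, (PowerSeries.X - PowerSeries.C (i : ℚ_[5]))

/-- The constant `c^r / r!` contributes `4r - 4 v(r!)`, and each of the `r` linear factors costs 3.
What remains is the base 5 digit sum of `r`. -/
theorem hasBound_binomSeries (r : ℕ) {c : ℚ_[5]} (hc : ‖c‖ ≤ 5⁻¹) :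
    HasBound ((r : ℤ) - 4 * padicValNat 5 r.factorial) (PowerSeries.C (c ^ r) * binomSeries r) := by
  have h1 : HasBound (4 * (r : ℤ) - 4 * padicValNat 5 r.factorial)
      (PowerSeries.C (c ^ r * (r.factorial : ℚ_[5])⁻¹)) := by
    refine HasBound.C ?_
    rw [norm_mul, norm_inv_factorial, norm_pow, mul_pow]
    calc _ ≤ (((5 : ℝ)⁻¹) ^ r) ^ 4 * ((5 : ℝ) ^ padicValNat 5 r.factorial) ^ 4 := by gcongr
      _ = _ := by
        rw [inv_pow, inv_pow, ← pow_mul, ← pow_mul, ← zpow_natCast, ← zpow_natCast, ← zpow_neg,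
          ← zpow_add₀ (by norm_num)]
        congr 1
        push_cast; ring
  have h2 : HasBound (-3 * r)
      (∏ i ∈ Finset.range r, ((PowerSeries.X - PowerSeries.C (i : ℚ_[5])) : ℚ_[5]⟦X⟧)) := by
    have := HasBound.prod (Finset.range r)
      (fun i => (PowerSeries.X - PowerSeries.C (i : ℚ_[5]) : ℚ_[5]⟦X⟧)) (fun _ => -3) fun i _ => by
        rw [sub_eq_add_neg]
        refine HasBound.X.add (HasBound.neg (HasBound.C ?_))
        have : ‖(i : ℚ_[5])‖ ≤ 1 := by simpa using Padic.norm_int_le_one (p := 5) i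
        calc _ ≤ (1 : ℝ) ^ 4 := by gcongr
          _ ≤ _ := by norm_num
    refine this.mono (le_of_eq ?_)
    simp; ring
  have := h1.mul h2
  rw [map_mul, mul_assoc] at this
  exact this.mono (by linarith)

theorem binomSeries_mem (r : ℕ) : binomSeries r ∈ boundedSeries := by
  refine mul_mem (HasBound.exists_of_C _) (prod_mem fun i _ => ?_)
  exact sub_mem ⟨_, HasBound.X⟩ (HasBound.exists_of_C _)

theorem evalAt_binomSeries (r : ℕ) (k : ℤ) :
    evalAt k ⟨binomSeries r, binomSeries_mem r⟩ = (Ring.choose k r : ℤ) := by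
  have : (⟨binomSeries r, binomSeries_mem r⟩ : boundedSeries) =
      algebraMap _ _ ((r.factorial : ℚ_[5])⁻¹) * ∏ i ∈ Finset.range r, linearFactor (i : ℤ_[5]) := by
    apply Subtype.ext
    rw [MulMemClass.coe_mul, SubmonoidClass.coe_finsetProd]
    simp only [linearFactor, PadicInt.coe_natCast]
    rfl
  rw [this, map_mul, map_prod, evalAt_C]
  simp only [evalAt_linearFactor, PadicInt.coe_natCast, PadicInt.coe_intCast]
  have h := Ring.descPochhammer_eq_factorial_smul_choose k r
  have h2 : ((descPochhammer ℤ r).smeval k : ℤ) = ∏ i ∈ Finset.range r, (k - i) := by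
    rw [← Polynomial.eval_eq_smeval, descPochhammer_eval_eq_prod_range]
  rw [h2] at h
  have h3 : (∏ i ∈ Finset.range r, ((k : ℚ_[5]) - i)) = r.factorial * (Ring.choose k r : ℤ) := by
    have := congrArg (fun z : ℤ => (z : ℚ_[5])) h
    simpa using this
  rw [h3, ← mul_assoc, inv_mul_cancel₀ (by exact_mod_cast r.factorial_ne_zero), one_mul]

/-! ### Powers of linear series -/

/-- The series `d + c X`. -/
def linSeries (c d : ℚ_[5]) : ℚ_[5]⟦X⟧ := PowerSeries.C d + PowerSeries.C c * PowerSeries.X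

@[simp] theorem constantCoeff_linSeries (c d : ℚ_[5]) :
    PowerSeries.constantCoeff (linSeries c d) = d := by simp [linSeries]

/-- The series `d + c X` as a unit. -/
def linUnit (c d : ℚ_[5]) (hd : d ≠ 0) : ℚ_[5]⟦X⟧ˣ where
  val := linSeries c d
  inv := (linSeries c d)⁻¹
  val_inv := PowerSeries.mul_inv_cancel _ (by simpa using hd)
  inv_val := PowerSeries.inv_mul_cancel _ (by simpa using hd)

theorem linPow_natCast (c d : ℚ_[5]) (m : ℕ) : linPow c d m = linSeries c d ^ m := rfl

theorem linPow_eq (c d : ℚ_[5]) (hd : d ≠ 0) (m : ℤ) :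
    linPow c d m = ((linUnit c d hd ^ m : ℚ_[5]⟦X⟧ˣ) : ℚ_[5]⟦X⟧) := by
  rcases m with m | m
  · rfl
  · rw [zpow_negSucc, ← inv_pow, Units.val_pow_eq_pow_val]
    rfl

theorem slash_X_pow (k : ℤ) (γ : Matrix (Fin 2) (Fin 2) ℚ_[5]) (j : ℕ) :
    slash k γ (PowerSeries.X ^ j) =
      linSeries (γ 0 0) (γ 0 1) ^ j * linPow (γ 1 0) (γ 1 1) (k - 2 - j) := by
  ext i
  rw [slash, PowerSeries.coeff_mk, tsum_eq_single j fun n hn => by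
    rw [PowerSeries.coeff_X_pow, if_neg hn, zero_mul]]
  rw [PowerSeries.coeff_X_pow_self, one_mul]
  rfl

/-- With upper right entry zero, `a z / (c z + d)` has no constant term, so the infinite sum
defining `slash` is a formal substitution: only the terms `n ≤ i` reach the coefficient of `z^i`. -/
theorem slash_eq_subst (k : ℤ) (a c d : ℚ_[5]) (hd : d ≠ 0) (f : ℚ_[5]⟦X⟧) :
    slash k !![a, 0; c, d] f = ((linUnit c d hd ^ (k - 2) : ℚ_[5]⟦X⟧ˣ) : ℚ_[5]⟦X⟧) *
      (f.subst (PowerSeries.C a * PowerSeries.X * (((linUnit c d hd)⁻¹ : ℚ_[5]⟦X⟧ˣ) : ℚ_[5]⟦X⟧)) :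
        ℚ_[5]⟦X⟧) := by
  set Y : ℚ_[5]⟦X⟧ := PowerSeries.C a * PowerSeries.X *
    (((linUnit c d hd)⁻¹ : ℚ_[5]⟦X⟧ˣ) : ℚ_[5]⟦X⟧) with hY
  have hs : PowerSeries.HasSubst Y := PowerSeries.HasSubst.of_constantCoeff_zero' (by simp [hY])
  have hdvd (n : ℕ) : PowerSeries.X ^ n ∣ Y ^ n :=
    pow_dvd_pow_of_dvd ⟨PowerSeries.C a * (((linUnit c d hd)⁻¹ : ℚ_[5]⟦X⟧ˣ) : ℚ_[5]⟦X⟧), by rw [hY]; ring⟩ n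
  have hterm (n : ℕ) : ((linUnit c d hd ^ (k - 2) : ℚ_[5]⟦X⟧ˣ) : ℚ_[5]⟦X⟧) * Y ^ n =
      (PowerSeries.C 0 + PowerSeries.C a * PowerSeries.X) ^ n * linPow c d (k - 2 - n) := by
    rw [linPow_eq c d hd, hY, mul_pow, zpow_sub _ (k - 2), Units.val_mul, ← Units.val_pow_eq_pow_val,
      zpow_natCast, inv_pow, map_zero, zero_add]
    ring
  ext i
  obtain ⟨g, hg⟩ : ∃ g, f = ∑ n ∈ Finset.range (i + 1), PowerSeries.C (PowerSeries.coeff n f) *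
      PowerSeries.X ^ n + PowerSeries.X ^ (i + 1) * g := by
    have hg : PowerSeries.X ^ (i + 1) ∣ f - ∑ n ∈ Finset.range (i + 1),
        PowerSeries.C (PowerSeries.coeff n f) * PowerSeries.X ^ n := by
      rw [PowerSeries.X_pow_dvd_iff]
      intro m hm
      rw [map_sub, map_sum, Finset.sum_eq_single m, PowerSeries.coeff_C_mul,
        PowerSeries.coeff_X_pow_self, mul_one, sub_self]
      · intro b _ hb
        rw [PowerSeries.coeff_C_mul, PowerSeries.coeff_X_pow, if_neg hb.symm, mul_zero]
      · intro h; simp at h; omega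
    obtain ⟨g, hg⟩ := hg
    exact ⟨g, by rw [← hg]; ring⟩
  have hsub : f.subst Y = ∑ n ∈ Finset.range (i + 1), PowerSeries.C (PowerSeries.coeff n f) *
      Y ^ n + Y ^ (i + 1) * g.subst Y := by
    conv_lhs => rw [hg]
    rw [← PowerSeries.coe_substAlgHom hs, map_add, map_sum, map_mul, map_pow,
      PowerSeries.substAlgHom_X hs]
    congr 1
    refine Finset.sum_congr rfl fun n _ => ?_
    rw [map_mul, map_pow, PowerSeries.substAlgHom_X hs]
    congr 1
    exact (PowerSeries.substAlgHom hs).commutes _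
  have hzero {n : ℕ} (hn : i < n) (h : ℚ_[5]⟦X⟧) : PowerSeries.coeff i (Y ^ n * h) = 0 :=
    PowerSeries.X_pow_dvd_iff.mp ((hdvd n).mul_right h) i hn
  rw [slash, PowerSeries.coeff_mk, hsub, mul_add, map_add,
    show ((linUnit c d hd ^ (k - 2) : ℚ_[5]⟦X⟧ˣ) : ℚ_[5]⟦X⟧) * (Y ^ (i + 1) * g.subst Y) =
      Y ^ (i + 1) * (((linUnit c d hd ^ (k - 2) : ℚ_[5]⟦X⟧ˣ) : ℚ_[5]⟦X⟧) * g.subst Y) by ring,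
    hzero (Nat.lt_succ_self i), add_zero, Finset.mul_sum, map_sum,
    tsum_eq_sum (s := Finset.range (i + 1))]
  · refine Finset.sum_congr rfl fun n _ => ?_
    rw [mul_left_comm, PowerSeries.coeff_C_mul, hterm]
    simp
  · intro n hn
    have hn' : i < n := by simpa using hn
    have := hzero hn' ((linUnit c d hd ^ (k - 2) : ℚ_[5]⟦X⟧ˣ) : ℚ_[5]⟦X⟧)
    rw [mul_comm, hterm] at this
    simp only [Matrix.of_apply, Matrix.cons_val', Matrix.cons_val_zero, Matrix.cons_val_one,
      Matrix.cons_val_fin_one]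
    rw [this, mul_zero]

/-- The cocycle relation in arbitrary integral weight. Having the second matrix lower triangular, as
the matrices `v_i` are, avoids questions of convergence. -/
theorem slash_slash_X_pow (k : ℤ) (u : Matrix (Fin 2) (Fin 2) ℚ_[5]) (hu : u 1 1 ≠ 0)
    (a c d : ℚ_[5]) (hd : d ≠ 0) (j : ℕ) :
    slash k !![a, 0; c, d] (slash k u (PowerSeries.X ^ j)) =
      slash k (u * !![a, 0; c, d]) (PowerSeries.X ^ j) := by
  rw [slash_eq_subst k a c d hd, slash_X_pow, slash_X_pow]
  set ℓ := linUnit c d hd with hℓ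
  set Y : ℚ_[5]⟦X⟧ := PowerSeries.C a * PowerSeries.X *
    ((ℓ⁻¹ : ℚ_[5]⟦X⟧ˣ) : ℚ_[5]⟦X⟧) with hY
  have hs : PowerSeries.HasSubst Y := PowerSeries.HasSubst.of_constantCoeff_zero' (by simp [hY])
  have hlin (p q : ℚ_[5]) : (ℓ : ℚ_[5]⟦X⟧) * ((linSeries p q).subst Y : ℚ_[5]⟦X⟧) =
      linSeries (p * a + q * c) (q * d) := by
    rw [← PowerSeries.coe_substAlgHom hs, linSeries, map_add, map_mul, PowerSeries.substAlgHom_X hs]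
    have hC (r : ℚ_[5]) : PowerSeries.substAlgHom hs (PowerSeries.C r) = PowerSeries.C r :=
      (PowerSeries.substAlgHom hs).commutes _
    rw [hC, hC, mul_add, hY, show (ℓ : ℚ_[5]⟦X⟧) * (PowerSeries.C p * (PowerSeries.C a *
      PowerSeries.X * ((ℓ⁻¹ : ℚ_[5]⟦X⟧ˣ) : ℚ_[5]⟦X⟧))) = PowerSeries.C p * (PowerSeries.C a * PowerSeries.X) *
      ((ℓ : ℚ_[5]⟦X⟧) * ((ℓ⁻¹ : ℚ_[5]⟦X⟧ˣ) : ℚ_[5]⟦X⟧)) by ring, Units.mul_inv, mul_one]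
    change linSeries c d * _ + _ = _
    simp only [linSeries, map_add, map_mul]
    ring
  set w := linUnit (u 1 0 * a + u 1 1 * c) (u 1 1 * d) (mul_ne_zero hu hd) with hw
  let S : ℚ_[5]⟦X⟧ˣ →* ℚ_[5]⟦X⟧ˣ := Units.map
    ((PowerSeries.substAlgHom hs : ℚ_[5]⟦X⟧ →ₐ[ℚ_[5]] ℚ_[5]⟦X⟧) : ℚ_[5]⟦X⟧ →* ℚ_[5]⟦X⟧)
  have hSw : ℓ * S (linUnit (u 1 0) (u 1 1) hu) = w := by
    apply Units.ext
    rw [Units.val_mul]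
    change (ℓ : ℚ_[5]⟦X⟧) * PowerSeries.substAlgHom hs (linSeries _ _) = linSeries _ _
    rw [PowerSeries.coe_substAlgHom hs, hlin]
  have e00 : (u * !![a, 0; c, d]) 0 0 = u 0 0 * a + u 0 1 * c := by
    simp [Matrix.mul_apply, Fin.sum_univ_two]
  have e01 : (u * !![a, 0; c, d]) 0 1 = u 0 1 * d := by
    simp [Matrix.mul_apply, Fin.sum_univ_two]
  have e10 : (u * !![a, 0; c, d]) 1 0 = u 1 0 * a + u 1 1 * c := by
    simp [Matrix.mul_apply, Fin.sum_univ_two]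
  have e11 : (u * !![a, 0; c, d]) 1 1 = u 1 1 * d := by
    simp [Matrix.mul_apply, Fin.sum_univ_two]
  rw [e00, e01, e10, e11, linPow_eq _ _ (mul_ne_zero hu hd), ← hw, linPow_eq _ _ hu, ← hlin,
    ← PowerSeries.coe_substAlgHom hs, map_mul, map_pow]
  have h1 : PowerSeries.substAlgHom hs
      ((linUnit (u 1 0) (u 1 1) hu ^ (k - 2 - j) : ℚ_[5]⟦X⟧ˣ) : ℚ_[5]⟦X⟧) =
      ((S (linUnit (u 1 0) (u 1 1) hu) ^ (k - 2 - j) : ℚ_[5]⟦X⟧ˣ) : ℚ_[5]⟦X⟧) := by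
    rw [← map_zpow]; rfl
  rw [h1, ← hSw, mul_zpow, mul_pow, Units.val_mul]
  have h2 : ((ℓ ^ (k - 2) : ℚ_[5]⟦X⟧ˣ) : ℚ_[5]⟦X⟧) = (ℓ : ℚ_[5]⟦X⟧) ^ j *
      ((ℓ ^ (k - 2 - j) : ℚ_[5]⟦X⟧ˣ) : ℚ_[5]⟦X⟧) := by
    rw [← Units.val_pow_eq_pow_val, ← Units.val_mul, ← zpow_natCast, ← zpow_add]
    congr 2; ring
  rw [h2]; ring

/-- Newton's binomial theorem. It separates the weight into `d ^ κ`, an exponential function of `κ`,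
and `Ring.choose κ r`, a polynomial in `κ`. -/
theorem coeff_linUnit_zpow (c d : ℚ_[5]) (hd : d ≠ 0) (κ : ℤ) (r : ℕ) :
    PowerSeries.coeff r ((linUnit c d hd ^ κ : ℚ_[5]⟦X⟧ˣ) : ℚ_[5]⟦X⟧) =
      d ^ κ * ((c / d) ^ r * (Ring.choose κ r : ℤ)) := by
  let b : ℤ → ℚ_[5]⟦X⟧ := fun κ => PowerSeries.rescale (c / d) (PowerSeries.binomialSeries ℚ_[5] κ)
  have hb (κ κ' : ℤ) : b (κ + κ') = b κ * b κ' := by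
    simp only [b, PowerSeries.binomialSeries_add, map_mul]
  have hb0 : b 0 = 1 := by simp [b]
  have hb1 : PowerSeries.C d * b 1 = linSeries c d := by
    have := PowerSeries.binomialSeries_nat (R := ℤ) (A := ℚ_[5]) 1
    simp only [b]
    rw [Nat.cast_one, pow_one] at this
    rw [this, linSeries, map_add, map_one, PowerSeries.rescale_X, mul_add, mul_one, ← mul_assoc,
      ← map_mul, mul_div_cancel₀ _ hd]
  let B : ℚ_[5]⟦X⟧ˣ := ⟨b 1, b (-1), by rw [← hb, add_neg_cancel, hb0],
    by rw [← hb, neg_add_cancel, hb0]⟩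
  have hB (κ : ℤ) : ((B ^ κ : ℚ_[5]⟦X⟧ˣ) : ℚ_[5]⟦X⟧) = b κ := by
    induction κ using Int.induction_on with
    | zero => simp [hb0]
    | succ n ih => rw [zpow_add, Units.val_mul, ih, hb, zpow_one]
    | pred n ih => rw [zpow_sub, Units.val_mul, ih, sub_eq_add_neg, hb, zpow_one]; rfl
  let D : ℚ_[5]⟦X⟧ˣ := Units.map (PowerSeries.C : ℚ_[5] →+* ℚ_[5]⟦X⟧).toMonoidHom (Units.mk0 d hd)
  have hD : linUnit c d hd = D * B := Units.ext hb1.symm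
  have hDκ : ((D ^ κ : ℚ_[5]⟦X⟧ˣ) : ℚ_[5]⟦X⟧) = PowerSeries.C (d ^ κ) := by
    have := map_zpow (Units.map (PowerSeries.C : ℚ_[5] →+* ℚ_[5]⟦X⟧).toMonoidHom)
      (Units.mk0 d hd) κ
    rw [← this]
    change PowerSeries.C (((Units.mk0 d hd ^ κ : ℚ_[5]ˣ)) : ℚ_[5]) = _
    rw [Units.val_zpow_eq_zpow_val]
    rfl
  rw [hD, mul_zpow, Units.val_mul, hDκ, hB, PowerSeries.coeff_C_mul, PowerSeries.coeff_rescale,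
    PowerSeries.binomialSeries_coeff]
  simp

/-! ### Power series in `5 X` -/

/-- Power series in `5 X` with integral coefficients. -/
def fiveSeries : Subring ℚ_[5]⟦X⟧ where
  carrier := {f | ∀ m, ‖PowerSeries.coeff m f‖ ≤ (5 : ℝ)⁻¹ ^ m}
  zero_mem' := fun m => by simp
  one_mem' := fun m => by
    rw [PowerSeries.coeff_one]
    split_ifs with h
    · simp [h]
    · simp
  add_mem' := fun {f g} hf hg m => by
    rw [map_add]; exact (Padic.nonarchimedean _ _).trans (max_le (hf m) (hg m))
  neg_mem' := fun {f} hf m => by rw [map_neg, norm_neg]; exact hf m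
  mul_mem' := fun {f g} hf hg m => by
    rw [PowerSeries.coeff_mul]
    refine IsUltrametricDist.norm_sum_le_of_forall_le_of_nonneg (by positivity) fun p hp => ?_
    have hp' : p.1 + p.2 = m := Finset.HasAntidiagonal.mem_antidiagonal.mp hp
    rw [norm_mul, ← hp', pow_add]
    exact mul_le_mul (hf _) (hg _) (norm_nonneg _) (by positivity)

theorem C_mem_fiveSeries {c : ℚ_[5]} (hc : ‖c‖ ≤ 1) : PowerSeries.C c ∈ fiveSeries := fun m => by
  rw [PowerSeries.coeff_C]
  split_ifs with h
  · simpa [h] using hc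
  · simp

theorem linSeries_mem_fiveSeries {c d : ℚ_[5]} (hc : ‖c‖ ≤ 5⁻¹) (hd : ‖d‖ ≤ 1) :
    linSeries c d ∈ fiveSeries := by
  refine add_mem (C_mem_fiveSeries hd) fun m => ?_
  rw [PowerSeries.coeff_C_mul, PowerSeries.coeff_X]
  split_ifs with h
  · simpa [h] using hc
  · simp

theorem linUnit_zpow_mem_fiveSeries {c d : ℚ_[5]} (hc : ‖c‖ ≤ 5⁻¹) (hd : d ≠ 0) (hd1 : ‖d‖ = 1)
    (κ : ℤ) : ((linUnit c d hd ^ κ : ℚ_[5]⟦X⟧ˣ) : ℚ_[5]⟦X⟧) ∈ fiveSeries := fun m => by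
  rw [coeff_linUnit_zpow, norm_mul, norm_mul, norm_zpow, hd1, one_zpow, one_mul, norm_pow, norm_div,
    hd1, div_one]
  calc _ ≤ (5 : ℝ)⁻¹ ^ m * 1 := by gcongr; exact Padic.norm_int_le_one _
    _ = _ := mul_one _

/-! ### Matrices that occur in `U_5` -/

/-- Matrices `(α, ζ δ; γ, δ)` with `α`, `γ` divisible by `5`, `δ` a one-unit and `ζ ^ 5 = ζ`. -/
def IsHeckeMatrix (g : Matrix (Fin 2) (Fin 2) ℚ_[5]) : Prop :=
  ‖g 0 0‖ ≤ 5⁻¹ ∧ ‖g 1 0‖ ≤ 5⁻¹ ∧ ‖g 1 1 - 1‖ ≤ 5⁻¹ ∧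
    ∃ ζ : ℚ_[5], ‖ζ‖ ≤ 1 ∧ ζ ^ 5 = ζ ∧ g 0 1 = ζ * g 1 1

theorem norm_eq_one_of_norm_sub_one_lt {d : ℚ_[5]} (h : ‖d - 1‖ < 1) : ‖d‖ = 1 := by
  have := IsUltrametricDist.norm_add_eq_max_of_norm_ne_norm (x := d - 1) (y := 1)
    (by rw [norm_one]; exact h.ne)
  rw [sub_add_cancel, norm_one, max_eq_right h.le] at this
  exact this

/-- The polynomial `(X^5 - X)^q X^r`, for `j = 5 q + r` with `0 ≤ r < 5`. -/
def gradedPoly (j : ℕ) : ℚ_[5][X] :=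
  Polynomial.X ^ (j / 5 + j % 5) * Polynomial.expand ℚ_[5] 4 ((Polynomial.X - 1) ^ (j / 5))

theorem gradedPoly_monic (j : ℕ) : (gradedPoly j).Monic := by
  refine (Polynomial.monic_X_pow _).mul (Polynomial.Monic.expand (by norm_num) ?_)
  simpa using (Polynomial.monic_X_sub_C (1 : ℚ_[5])).pow (j / 5)

theorem gradedPoly_natDegree (j : ℕ) : (gradedPoly j).natDegree = j := by
  have h1 : ((Polynomial.X - 1 : ℚ_[5][X]) ^ (j / 5)).natDegree = j / 5 := by
    rw [Polynomial.natDegree_pow, ← Polynomial.C_1, Polynomial.natDegree_X_sub_C, mul_one]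
  have h2 : (Polynomial.expand ℚ_[5] 4 ((Polynomial.X - 1) ^ (j / 5))).Monic := by
    refine Polynomial.Monic.expand (by norm_num) ?_
    simpa using (Polynomial.monic_X_sub_C (1 : ℚ_[5])).pow (j / 5)
  rw [gradedPoly, (Polynomial.monic_X_pow _).natDegree_mul h2, Polynomial.natDegree_X_pow,
    Polynomial.natDegree_expand, h1]
  omega

theorem gradedPoly_coeff_eq_zero {j m : ℕ} (h : m % 4 ≠ j % 4) : (gradedPoly j).coeff m = 0 := by
  rw [gradedPoly, Polynomial.coeff_X_pow_mul']
  split_ifs with h1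
  · rw [Polynomial.coeff_expand (by norm_num), if_neg]
    omega
  · rfl

theorem aeval_gradedPoly {A : Type*} [CommRing A] [Algebra ℚ_[5] A] (x : A) (j : ℕ) :
    Polynomial.aeval x (gradedPoly j) = (x ^ 5 - x) ^ (j / 5) * x ^ (j % 5) := by
  rw [gradedPoly, map_mul, map_pow, Polynomial.aeval_X, Polynomial.expand_aeval, map_pow, map_sub,
    Polynomial.aeval_X, map_one, pow_add, mul_right_comm, ← mul_pow]
  congr 2
  ring

/-- If `u > 0`, then `4u` alone suffices. If `u = 0`, the right side is the digit sum of `m`, which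
is positive and congruent to `m` modulo 4, hence at least any `b ≤ 4` in this class. -/
theorem le_of_mod_four {m u r b : ℕ} (hm : m ≠ 0) (hur : u + r = m) (hb : b ≤ 4)
    (hbm : b % 4 = m % 4) : (b : ℤ) ≤ 4 * u + (r - 4 * padicValNat 5 r.factorial) := by
  rcases Nat.eq_zero_or_pos u with hu | hu
  · have := four_mul_padicValNat_factorial_lt (m := r) (by omega)
    omega
  · have := four_mul_padicValNat_factorial_le r
    omega

theorem pow_five_sub_self_eq {R : Type*} [CommRing R] {x z : R} (hz : z ^ 5 = z) :
    x ^ 5 - x = (x - z) * (x ^ 4 + x ^ 3 * z + x ^ 2 * z ^ 2 + x * z ^ 3 + z ^ 4 - 1) := by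
  linear_combination hz

/-- Since `ζ^5 = ζ`, the series `x - ζ` divides `x^5 - x` within `fiveSeries`, so the factor `5X` is
inherited. -/
theorem exists_pow_five_sub_self_eq {x : ℚ_[5]⟦X⟧} (hx : x ∈ fiveSeries) {ζ : ℚ_[5]} (hζ : ‖ζ‖ ≤ 1)
    (hζ5 : ζ ^ 5 = ζ) {G : ℚ_[5]⟦X⟧} (hG : G ∈ fiveSeries)
    (h : x - PowerSeries.C ζ = PowerSeries.C 5 * PowerSeries.X * G) :
    ∃ G' ∈ fiveSeries, x ^ 5 - x = PowerSeries.C 5 * PowerSeries.X * G' := by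
  have hz := C_mem_fiveSeries hζ
  have h5 : PowerSeries.C ζ ^ 5 = PowerSeries.C ζ := by rw [← map_pow, hζ5]
  generalize PowerSeries.C ζ = z at h hz h5
  refine ⟨G * (x ^ 4 + x ^ 3 * z + x ^ 2 * z ^ 2 + x * z ^ 3 + z ^ 4 - 1), mul_mem hG ?_, ?_⟩
  · exact sub_mem (add_mem (add_mem (add_mem (add_mem (pow_mem hx _) (mul_mem (pow_mem hx _) hz))
      (mul_mem (pow_mem hx _) (pow_mem hz _))) (mul_mem hx (pow_mem hz _))) (pow_mem hz _))
      (one_mem _)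
  · rw [pow_five_sub_self_eq h5, h, mul_assoc]

theorem IsHeckeMatrix.norm_eq_one {g : Matrix (Fin 2) (Fin 2) ℚ_[5]} (hg : IsHeckeMatrix g) :
    ‖g 1 1‖ = 1 := norm_eq_one_of_norm_sub_one_lt (hg.2.2.1.trans_lt (by norm_num))

theorem IsHeckeMatrix.ne_zero {g : Matrix (Fin 2) (Fin 2) ℚ_[5]} (hg : IsHeckeMatrix g) :
    g 1 1 ≠ 0 := fun h => by have := hg.norm_eq_one; rw [h] at this; simp at this

theorem slash_X_pow_eq_zpow_mul (k : ℤ) (g : Matrix (Fin 2) (Fin 2) ℚ_[5]) (h0 : g 1 1 ≠ 0) (m : ℕ) :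
    slash k g (PowerSeries.X ^ m) =
      ((linUnit (g 1 0) (g 1 1) h0 ^ (k - 2) : ℚ_[5]⟦X⟧ˣ) : ℚ_[5]⟦X⟧) *
        (linSeries (g 0 0) (g 0 1) *
          (((linUnit (g 1 0) (g 1 1) h0)⁻¹ : ℚ_[5]⟦X⟧ˣ) : ℚ_[5]⟦X⟧)) ^ m := by
  rw [slash_X_pow, linPow_eq _ _ h0, zpow_sub _ (k - 2), Units.val_mul, mul_pow,
    ← Units.val_pow_eq_pow_val, zpow_natCast, inv_pow]
  ring

/-- The image of the graded basis under a matrix, as a power series. -/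
theorem IsHeckeMatrix.exists_series {g : Matrix (Fin 2) (Fin 2) ℚ_[5]} (hg : IsHeckeMatrix g)
    (j : ℕ) : ∃ G ∈ fiveSeries, ∀ (k : ℤ) (i : ℕ), ∑ m ∈ Finset.range (j + 1),
      (gradedPoly j).coeff m * PowerSeries.coeff i (slash k g (PowerSeries.X ^ m)) =
      PowerSeries.coeff i (PowerSeries.X ^ (j / 5) *
        (((linUnit (g 1 0) (g 1 1) hg.ne_zero ^ (k - 2) : ℚ_[5]⟦X⟧ˣ) : ℚ_[5]⟦X⟧) *
          (PowerSeries.C ((5 : ℚ_[5]) ^ (j / 5)) * G))) := by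
  have hδ0 := hg.ne_zero
  have hδ1 := hg.norm_eq_one
  obtain ⟨hα, hγ, hδ, ζ, hζ, hζ5, hβ⟩ := hg
  have hℓinv := linUnit_zpow_mem_fiveSeries hγ hδ0 hδ1 (-1)
  rw [zpow_neg_one] at hℓinv
  have hℓmul : linSeries (g 1 0) (g 1 1) *
      (((linUnit (g 1 0) (g 1 1) hδ0)⁻¹ : ℚ_[5]⟦X⟧ˣ) : ℚ_[5]⟦X⟧) = 1 := Units.mul_inv _
  have hslash := fun k m => slash_X_pow_eq_zpow_mul k g hδ0 m
  generalize (((linUnit (g 1 0) (g 1 1) hδ0)⁻¹ : ℚ_[5]⟦X⟧ˣ) : ℚ_[5]⟦X⟧) = I at *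
  have hβ1 : ‖g 0 1‖ ≤ 1 := by rw [hβ, norm_mul, hδ1, mul_one]; exact hζ
  have hΓmem : linSeries (g 0 0) (g 0 1) * I ∈ fiveSeries :=
    mul_mem (linSeries_mem_fiveSeries hα hβ1) hℓinv
  have hG₁ : PowerSeries.C ((g 0 0 - ζ * g 1 0) / 5) * I ∈ fiveSeries := by
    refine mul_mem (C_mem_fiveSeries ?_) hℓinv
    rw [norm_div, norm_five, div_le_iff₀ (by norm_num), one_mul, sub_eq_add_neg]
    refine norm_add_le_inv_five hα ?_
    rw [norm_neg, norm_mul]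
    calc _ ≤ (1 : ℝ) * 5⁻¹ := by gcongr
      _ = _ := one_mul _
  have hG₁e : linSeries (g 0 0) (g 0 1) * I - PowerSeries.C ζ =
      PowerSeries.C 5 * PowerSeries.X * (PowerSeries.C ((g 0 0 - ζ * g 1 0) / 5) * I) := by
    have h2 : linSeries (g 0 0) (g 0 1) - PowerSeries.C ζ * linSeries (g 1 0) (g 1 1) =
        PowerSeries.C 5 * PowerSeries.X * PowerSeries.C ((g 0 0 - ζ * g 1 0) / 5) := by
      rw [mul_right_comm, ← map_mul, mul_div_cancel₀ _ (by norm_num), hβ, linSeries, linSeries]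
      simp only [map_sub, map_mul]
      ring
    rw [← mul_assoc, ← h2, sub_mul, mul_assoc (PowerSeries.C ζ), hℓmul, mul_one]
  obtain ⟨G₂, hG₂, hG₂e⟩ := exists_pow_five_sub_self_eq hΓmem hζ hζ5 hG₁ hG₁e
  generalize linSeries (g 0 0) (g 0 1) * I = Γ at *
  refine ⟨G₂ ^ (j / 5) * Γ ^ (j % 5), mul_mem (pow_mem hG₂ _) (pow_mem hΓmem _), fun k i => ?_⟩
  -- `Γ` is the image of `z`. It is `ζ` modulo `5X`, so `Γ^5 - Γ = 5X·G₂`, and its `q`-th power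
  -- produces both `5^q` and `X^q`.
  have haeval : Polynomial.aeval Γ (gradedPoly j) = PowerSeries.X ^ (j / 5) *
      (PowerSeries.C ((5 : ℚ_[5]) ^ (j / 5)) * (G₂ ^ (j / 5) * Γ ^ (j % 5))) := by
    rw [aeval_gradedPoly, hG₂e, map_pow, mul_pow, mul_pow]
    ring
  rw [mul_left_comm, ← haeval, Polynomial.aeval_eq_sum_range, gradedPoly_natDegree,
    Finset.mul_sum, map_sum]
  refine Finset.sum_congr rfl fun m _ => ?_
  rw [hslash, mul_smul_comm, PowerSeries.coeff_smul]
  rfl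

theorem hasBound_C_five_pow_mul {G : ℚ_[5]⟦X⟧} (hG : G ∈ fiveSeries) (q u : ℕ) :
    HasBound (4 * (q : ℤ) + 4 * u) (PowerSeries.C (5 ^ q * PowerSeries.coeff u G)) := by
  refine HasBound.C ?_
  rw [norm_mul, norm_pow, norm_five, mul_pow]
  calc _ ≤ ((5 : ℝ)⁻¹ ^ q) ^ 4 * ((5 : ℝ)⁻¹ ^ u) ^ 4 := by gcongr; exact hG u
    _ = _ := by
      rw [inv_pow, inv_pow, inv_pow, inv_pow, ← pow_mul, ← pow_mul, ← zpow_natCast,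
        ← zpow_natCast, ← zpow_neg, ← zpow_neg, ← zpow_add₀ (by norm_num)]
      congr 1
      push_cast; ring

/-- The image of the graded basis under a matrix: interpolation in the weight, and bounds. -/
theorem IsHeckeMatrix.exists_entry {g : Matrix (Fin 2) (Fin 2) ℚ_[5]} (hg : IsHeckeMatrix g)
    (i j : ℕ) : ∃ f : boundedSeries, HasBound (4 * (j / 5 : ℕ)) (f : ℚ_[5]⟦X⟧) ∧
      (∀ b : ℕ, j / 5 < i → b ≤ 4 → b % 4 = (i - j / 5) % 4 →
        HasBound (4 * (j / 5 : ℕ) + b) (f : ℚ_[5]⟦X⟧)) ∧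
      ∀ k : ℤ, evalAt ((k - 2 : ℤ) : ℤ_[5]) f = ∑ m ∈ Finset.range (j + 1),
        (gradedPoly j).coeff m * PowerSeries.coeff i (slash k g (PowerSeries.X ^ m)) := by
  obtain ⟨G, hGmem, hsum⟩ := hg.exists_series j
  have hδ1 := hg.norm_eq_one
  have hδ := hg.2.2.1
  have hγ := hg.2.1
  have hδ0 := hg.ne_zero
  generalize j / 5 = q at *
  simp only [hsum, PowerSeries.coeff_X_pow_mul']
  -- For `i < q` the factor `X^q` makes the entry vanish.
  by_cases hqi : q ≤ i
  swap
  · exact ⟨0, HasBound.zero, fun _ _ _ _ => HasBound.zero, fun k => by rw [if_neg hqi, map_zero]⟩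
  simp only [if_pos hqi]
  obtain ⟨D, hD, hDe⟩ := exists_boundedSeries_zpow hδ
  have hc : ‖g 1 0 / g 1 1‖ ≤ 5⁻¹ := by rw [norm_div, hδ1, div_one]; exact hγ
  have hterm (r u : ℕ) : HasBound (4 * (q : ℤ) + (4 * u + (r - 4 * padicValNat 5 r.factorial)))
      (PowerSeries.C (5 ^ q * PowerSeries.coeff u G) * (D : ℚ_[5]⟦X⟧) *
        (PowerSeries.C ((g 1 0 / g 1 1) ^ r) * binomSeries r)) := by
    exact (((hasBound_C_five_pow_mul hGmem q u).mul hD).mul (hasBound_binomSeries r hc)).mono (by linarith)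
  -- Terms of the Cauchy product: index `p.1` belongs to the binomial expansion of the automorphy
  -- factor, `p.2` to the weight-independent series `G`.
  let F : ℕ × ℕ → boundedSeries := fun p =>
    algebraMap _ _ (5 ^ q * PowerSeries.coeff p.2 G) * D *
      (algebraMap _ _ ((g 1 0 / g 1 1) ^ p.1) * ⟨binomSeries p.1, binomSeries_mem p.1⟩)
  have hF (p : ℕ × ℕ) : ((F p : boundedSeries) : ℚ_[5]⟦X⟧) =
      PowerSeries.C (5 ^ q * PowerSeries.coeff p.2 G) * (D : ℚ_[5]⟦X⟧) *
        (PowerSeries.C ((g 1 0 / g 1 1) ^ p.1) * binomSeries p.1) := rfl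
  refine ⟨∑ p ∈ Finset.HasAntidiagonal.antidiagonal (i - q), F p, ?_, ?_, ?_⟩
  · rw [AddSubmonoidClass.coe_finsetSum]
    refine HasBound.sum _ _ fun p _ => ?_
    rw [hF]
    have := four_mul_padicValNat_factorial_le p.1
    exact (hterm p.1 p.2).mono (by omega)
  · intro b hqi' hb hbm
    rw [AddSubmonoidClass.coe_finsetSum]
    refine HasBound.sum _ _ fun p hp => ?_
    rw [hF]
    have hp' : p.1 + p.2 = i - q := Finset.HasAntidiagonal.mem_antidiagonal.mp hp
    have := le_of_mod_four (m := i - q) (u := p.2) (r := p.1) (b := b) (by omega) (by omega) hb hbm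
    exact (hterm p.1 p.2).mono (by linarith)
  · intro k
    rw [map_sum, PowerSeries.coeff_mul]
    refine Finset.sum_congr rfl fun p _ => ?_
    simp only [F, map_mul, evalAt_C, hDe, evalAt_binomSeries]
    rw [coeff_linUnit_zpow, PowerSeries.coeff_C_mul]
    ring

/-! ### The characteristic matrix -/

/-- The truncated matrix of `f ↦ ∑ₛ f ‖_k Γₛ` on the powers `X ^ (4 j + a)`. -/
def slashMinor (Γ : Fin 5 → Matrix (Fin 2) (Fin 2) ℚ_[5]) (n : ℕ) (k : ℤ) (a : ℕ) :
    Matrix (Fin n) (Fin n) ℚ_[5] :=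
  Matrix.of fun i j => ∑ s, PowerSeries.coeff (4 * (i : ℕ) + a)
    (slash k (Γ s) (PowerSeries.X ^ (4 * (j : ℕ) + a)))

/-- The coefficients of the graded basis. -/
def gradedBasisMatrix (n a : ℕ) : Matrix (Fin n) (Fin n) ℚ_[5] :=
  Matrix.of fun i j => (gradedPoly (4 * (j : ℕ) + a)).coeff (4 * (i : ℕ) + a)

theorem det_gradedBasisMatrix (n a : ℕ) : (gradedBasisMatrix n a).det = 1 := by
  rw [Matrix.det_of_isUpperTriangular]
  · refine Finset.prod_eq_one fun i _ => ?_
    have := (gradedPoly_monic (4 * (i : ℕ) + a)).coeff_natDegree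
    rwa [gradedPoly_natDegree] at this
  · intro i j hij
    have hij' : (j : ℕ) < i := hij
    have : (gradedPoly (4 * (j : ℕ) + a)).coeff (4 * (i : ℕ) + a) = 0 :=
      Polynomial.coeff_eq_zero_of_natDegree_lt (by rw [gradedPoly_natDegree]; omega)
    exact this

/-- The exponents of `gradedPoly (4j + a)` are all congruent to `a` modulo 4, so the change of basis
stays within the index class of the minor. -/
theorem sum_gradedPoly_coeff (j n a : ℕ) (hj : j < n) (ha : a < 4) (F : ℕ → ℚ_[5]) :
    ∑ m ∈ Finset.range (4 * j + a + 1), (gradedPoly (4 * j + a)).coeff m * F m =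
      ∑ t : Fin n, (gradedPoly (4 * j + a)).coeff (4 * (t : ℕ) + a) * F (4 * (t : ℕ) + a) := by
  rw [Fin.sum_univ_eq_sum_range
    (fun t => (gradedPoly (4 * j + a)).coeff (4 * t + a) * F (4 * t + a)) n]
  have hinj : Set.InjOn (fun t : ℕ => 4 * t + a) (Finset.range n : Set ℕ) := by
    intro x _ y _ h; simp only at h; omega
  rw [← Finset.sum_image (f := fun m => (gradedPoly (4 * j + a)).coeff m * F m) hinj]
  have hz : ∀ m, m ∉ Finset.range (4 * j + a + 1) → (gradedPoly (4 * j + a)).coeff m * F m = 0 := by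
    intro m hm
    rw [Polynomial.coeff_eq_zero_of_natDegree_lt, zero_mul]
    rw [gradedPoly_natDegree]
    simp at hm; omega
  have hz' : ∀ m, m ∈ Finset.range (4 * j + a + 1) → m ∉ (Finset.range n).image (fun t => 4 * t + a) →
      (gradedPoly (4 * j + a)).coeff m * F m = 0 := by
    intro m hm hm'
    rw [gradedPoly_coeff_eq_zero, zero_mul]
    intro h
    apply hm'
    simp only [Finset.mem_image, Finset.mem_range] at hm ⊢
    exact ⟨m / 4, by omega, by omega⟩
  rw [Finset.sum_subset (Finset.subset_union_left
      (s₂ := (Finset.range n).image (fun t => 4 * t + a))) fun m _ h => hz m h]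
  refine (Finset.sum_subset Finset.subset_union_right fun m h h' => ?_).symm
  rcases Finset.mem_union.mp h with h | h
  · exact hz' m h h'
  · exact absurd h h'

/-- The residue of `j` modulo `5` in `{1, 2, 3, 4}`, with `4` for `0`. -/
def colShift (j : ℕ) : ℕ := if j % 5 = 0 then 4 else j % 5

/-- Row `I = 4i + a` and column `J = 4j + a = 5q + r` satisfy `I - q ≡ r` modulo 4. So beyond the
`4q` from `5^q` there is a gain of `r`, or of 4 if `r = 0`, as soon as `I > q`. The correction `-4`
is charged to those rows for which `I ≤ q` can occur for some column. -/
theorem exists_characteristic_matrix {Γ : Fin 5 → Matrix (Fin 2) (Fin 2) ℚ_[5]}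
    (hΓ : ∀ s, IsHeckeMatrix (Γ s)) (n a : ℕ) (ha : a < 4) :
    ∃ M : Matrix (Fin n) (Fin n) boundedSeries,
      (∀ k : ℤ, M.map (evalAt ((k - 2 : ℤ) : ℤ_[5])) = slashMinor Γ n k a * gradedBasisMatrix n a) ∧
      ∀ i j : Fin n, HasBound ((if 5 * (4 * (i : ℕ) + a) ≤ 4 * (n - 1) + a then -4 else 0) +
        (4 * ((4 * (j : ℕ) + a) / 5 : ℕ) + colShift (4 * (j : ℕ) + a) : ℤ))
          (M i j : ℚ_[5]⟦X⟧) := by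
  choose f hf1 hf2 hf3 using fun s (i j : ℕ) => (hΓ s).exists_entry (4 * i + a) (4 * j + a)
  refine ⟨Matrix.of fun i j => ∑ s, f s i j, fun k => ?_, fun i j => ?_⟩
  · ext i j
    rw [Matrix.map_apply, Matrix.of_apply, map_sum, Matrix.mul_apply]
    simp only [hf3]
    rw [Finset.sum_congr rfl fun s _ => sum_gradedPoly_coeff j n a j.2 ha fun m =>
      PowerSeries.coeff (4 * (i : ℕ) + a) (slash k (Γ s) (PowerSeries.X ^ m)), Finset.sum_comm]
    refine Finset.sum_congr rfl fun t _ => ?_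
    rw [← Finset.mul_sum, mul_comm]
    rfl
  · rw [Matrix.of_apply, AddSubmonoidClass.coe_finsetSum]
    refine HasBound.sum _ _ fun s _ => ?_
    have hj := j.2
    have hc : colShift (4 * (j : ℕ) + a) ≤ 4 := by unfold colShift; split_ifs <;> omega
    split_ifs with h
    · exact (hf1 s i j).mono (by omega)
    · have hlt : (4 * (j : ℕ) + a) / 5 < 4 * (i : ℕ) + a := by omega
      refine (hf2 s i j (colShift (4 * (j : ℕ) + a)) hlt hc ?_).mono (by omega)
      unfold colShift
      split_ifs <;> omega

/-! ### The action on polynomials of bounded degree -/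

/-- Power series that are polynomials of degree at most `N`. -/
def polyDeg (N : ℕ) : Submodule ℚ_[5] ℚ_[5]⟦X⟧ where
  carrier := {f | ∀ n, N < n → PowerSeries.coeff n f = 0}
  zero_mem' := fun _ _ => by simp
  add_mem' := fun {f g} hf hg n hn => by rw [map_add, hf n hn, hg n hn, add_zero]
  smul_mem' := fun c f hf n hn => by rw [PowerSeries.coeff_smul, hf n hn, smul_zero]

theorem isPolyOfWeight_iff {N : ℕ} {f : ℚ_[5]⟦X⟧} : IsPolyOfWeight (N + 2) f ↔ f ∈ polyDeg N :=
  ⟨fun h n hn => h n (by omega), fun h n hn => h n (by omega)⟩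

theorem mul_mem_polyDeg {N N' : ℕ} {f g : ℚ_[5]⟦X⟧} (hf : f ∈ polyDeg N) (hg : g ∈ polyDeg N') :
    f * g ∈ polyDeg (N + N') := fun n hn => by
  rw [PowerSeries.coeff_mul]
  refine Finset.sum_eq_zero fun p hp => ?_
  have hp' : p.1 + p.2 = n := Finset.HasAntidiagonal.mem_antidiagonal.mp hp
  rcases lt_or_ge N p.1 with h | h
  · rw [hf _ h, zero_mul]
  · rw [hg _ (by omega), mul_zero]

theorem pow_mem_polyDeg {N : ℕ} {f : ℚ_[5]⟦X⟧} (hf : f ∈ polyDeg N) (m : ℕ) :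
    f ^ m ∈ polyDeg (N * m) := by
  induction m with
  | zero => intro n hn; rw [pow_zero, PowerSeries.coeff_one, if_neg (by omega)]
  | succ m ih => rw [pow_succ, mul_add, mul_one]; exact mul_mem_polyDeg ih hf

theorem linSeries_mem_polyDeg (c d : ℚ_[5]) : linSeries c d ∈ polyDeg 1 := fun n hn => by
  rw [linSeries, map_add, PowerSeries.coeff_C, if_neg (by omega), PowerSeries.coeff_C_mul,
    PowerSeries.coeff_X, if_neg (by omega), mul_zero, add_zero]

theorem X_pow_mem_polyDeg {n N : ℕ} (h : n ≤ N) : PowerSeries.X ^ n ∈ polyDeg N := fun m hm => by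
  rw [PowerSeries.coeff_X_pow, if_neg (by omega)]

theorem eq_sum_of_mem_polyDeg {N : ℕ} {f : ℚ_[5]⟦X⟧} (hf : f ∈ polyDeg N) :
    f = ∑ n ∈ Finset.range (N + 1), PowerSeries.coeff n f • PowerSeries.X ^ n := by
  ext m
  rw [map_sum]
  simp only [PowerSeries.coeff_smul, PowerSeries.coeff_X_pow]
  by_cases hm : m ≤ N
  · rw [Finset.sum_eq_single m (fun b _ hb => by rw [if_neg hb.symm, smul_zero])
      (fun h => by simp at h; omega)]
    simp
  · rw [hf m (by omega), Finset.sum_eq_zero]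
    intro b hb
    rw [if_neg, smul_zero]
    simp at hb; omega

/-- The action of a matrix on polynomials of degree at most `N`. -/
def polySlash (N : ℕ) (γ : Matrix (Fin 2) (Fin 2) ℚ_[5]) : ℚ_[5]⟦X⟧ →ₗ[ℚ_[5]] ℚ_[5]⟦X⟧ :=
  ∑ n ∈ Finset.range (N + 1), (PowerSeries.coeff n).smulRight
    (linSeries (γ 0 0) (γ 0 1) ^ n * linSeries (γ 1 0) (γ 1 1) ^ (N - n))

theorem polySlash_apply (N : ℕ) (γ : Matrix (Fin 2) (Fin 2) ℚ_[5]) (f : ℚ_[5]⟦X⟧) :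
    polySlash N γ f = ∑ n ∈ Finset.range (N + 1), PowerSeries.coeff n f •
      (linSeries (γ 0 0) (γ 0 1) ^ n * linSeries (γ 1 0) (γ 1 1) ^ (N - n)) := by
  simp [polySlash]

theorem polySlash_X_pow {N n : ℕ} (hn : n ≤ N) (γ : Matrix (Fin 2) (Fin 2) ℚ_[5]) :
    polySlash N γ (PowerSeries.X ^ n) =
      linSeries (γ 0 0) (γ 0 1) ^ n * linSeries (γ 1 0) (γ 1 1) ^ (N - n) := by
  rw [polySlash_apply, Finset.sum_eq_single n]
  · rw [PowerSeries.coeff_X_pow_self, one_smul]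
  · intro b _ hb
    rw [PowerSeries.coeff_X_pow, if_neg hb, zero_smul]
  · intro h; simp at h; omega

theorem slash_eq_polySlash {N : ℕ} (γ : Matrix (Fin 2) (Fin 2) ℚ_[5]) {f : ℚ_[5]⟦X⟧}
    (hf : f ∈ polyDeg N) : slash ((N + 2 : ℕ) : ℤ) γ f = polySlash N γ f := by
  ext i
  rw [slash, PowerSeries.coeff_mk, polySlash_apply, map_sum, tsum_eq_sum (s := Finset.range (N + 1))]
  · refine Finset.sum_congr rfl fun n hn => ?_
    have h : ((N + 2 : ℕ) : ℤ) - 2 - n = ((N - n : ℕ) : ℤ) := by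
      simp at hn; omega
    rw [h, linPow_natCast, PowerSeries.coeff_smul]
    rfl
  · intro n hn
    rw [hf n (by simpa using hn), zero_mul]

theorem polySlash_mem (N : ℕ) (γ : Matrix (Fin 2) (Fin 2) ℚ_[5]) (f : ℚ_[5]⟦X⟧) :
    polySlash N γ f ∈ polyDeg N := by
  rw [polySlash_apply]
  refine Submodule.sum_mem _ fun n hn => Submodule.smul_mem _ _ ?_
  have h := mul_mem_polyDeg (pow_mem_polyDeg (linSeries_mem_polyDeg (γ 0 0) (γ 0 1)) n)
    (pow_mem_polyDeg (linSeries_mem_polyDeg (γ 1 0) (γ 1 1)) (N - n))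
  have e : 1 * n + 1 * (N - n) = N := by simp at hn; omega
  rwa [e] at h

/-- On monomials this is the multiplicativity of powers of linear forms, the degrees being added. It
reduces composition to linear forms and makes products of invariants invariant. -/
theorem polySlash_mul {N N' : ℕ} (γ : Matrix (Fin 2) (Fin 2) ℚ_[5]) {f g : ℚ_[5]⟦X⟧}
    (hf : f ∈ polyDeg N) (hg : g ∈ polyDeg N') :
    polySlash (N + N') γ (f * g) = polySlash N γ f * polySlash N' γ g := by
  rw [eq_sum_of_mem_polyDeg hf, eq_sum_of_mem_polyDeg hg, Finset.sum_mul_sum, map_sum, map_sum,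
    map_sum, Finset.sum_mul_sum]
  refine Finset.sum_congr rfl fun n hn => ?_
  rw [map_sum]
  refine Finset.sum_congr rfl fun m hm => ?_
  simp only [Finset.mem_range] at hn hm
  rw [smul_mul_smul_comm, ← pow_add, map_smul, map_smul, map_smul, smul_mul_smul_comm,
    polySlash_X_pow (by omega), polySlash_X_pow (by omega), polySlash_X_pow (by omega),
    show N + N' - (n + m) = (N - n) + (N' - m) by omega, pow_add, pow_add]
  congr 1; ring

theorem polySlash_linSeries (γ : Matrix (Fin 2) (Fin 2) ℚ_[5]) (p q : ℚ_[5]) :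
    polySlash 1 γ (linSeries p q) = linSeries (p * γ 0 0 + q * γ 1 0) (p * γ 0 1 + q * γ 1 1) := by
  have : linSeries p q = q • PowerSeries.X ^ 0 + p • PowerSeries.X ^ 1 := by
    simp [linSeries, PowerSeries.smul_eq_C_mul]
  rw [this, map_add, map_smul, map_smul, polySlash_X_pow (by omega), polySlash_X_pow (by omega)]
  simp only [PowerSeries.smul_eq_C_mul, linSeries, map_add, map_mul]
  simp
  ring

theorem polySlash_pow {N : ℕ} (γ : Matrix (Fin 2) (Fin 2) ℚ_[5]) {f : ℚ_[5]⟦X⟧}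
    (hf : f ∈ polyDeg N) (m : ℕ) : polySlash (N * m) γ (f ^ m) = polySlash N γ f ^ m := by
  induction m with
  | zero =>
    have := polySlash_X_pow (N := 0) (n := 0) le_rfl γ
    simpa using this
  | succ m ih => rw [pow_succ, pow_succ, mul_add, mul_one, polySlash_mul γ (pow_mem_polyDeg hf m) hf, ih]

theorem polySlash_comp (N : ℕ) (γ γ' : Matrix (Fin 2) (Fin 2) ℚ_[5]) (f : ℚ_[5]⟦X⟧) :
    polySlash N γ' (polySlash N γ f) = polySlash N (γ * γ') f := by
  rw [polySlash_apply N γ, polySlash_apply N (γ * γ'), map_sum]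
  refine Finset.sum_congr rfl fun n hn => ?_
  rw [map_smul]
  congr 1
  have h := polySlash_mul γ' (pow_mem_polyDeg (linSeries_mem_polyDeg (γ 0 0) (γ 0 1)) n)
    (pow_mem_polyDeg (linSeries_mem_polyDeg (γ 1 0) (γ 1 1)) (N - n))
  rw [polySlash_pow γ' (linSeries_mem_polyDeg _ _), polySlash_pow γ' (linSeries_mem_polyDeg _ _),
    polySlash_linSeries, polySlash_linSeries, show 1 * n + 1 * (N - n) = N by simp at hn; omega] at h
  rw [h]
  simp [Matrix.mul_apply, Fin.sum_univ_two]

theorem coeff_polySlash_diagonal {N : ℕ} (p s : ℚ_[5]) {f : ℚ_[5]⟦X⟧} {n : ℕ} (hn : n ≤ N) :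
    PowerSeries.coeff n (polySlash N !![p, 0; 0, s] f) =
      p ^ n * s ^ (N - n) * PowerSeries.coeff n f := by
  have hC (m : ℕ) : (linSeries p 0 ^ m * linSeries 0 s ^ (N - m)) =
      PowerSeries.C (p ^ m * s ^ (N - m)) * PowerSeries.X ^ m := by
    simp [linSeries, mul_pow]; ring
  rw [polySlash_apply, map_sum, Finset.sum_eq_single n]
  · simp only [Matrix.of_apply, Matrix.cons_val', Matrix.cons_val_zero, Matrix.cons_val_one,
      Matrix.cons_val_fin_one]
    rw [hC, PowerSeries.coeff_smul, PowerSeries.coeff_C_mul, PowerSeries.coeff_X_pow_self, mul_one,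
      smul_eq_mul, mul_comm]
  · intro m _ hm
    simp only [Matrix.of_apply, Matrix.cons_val', Matrix.cons_val_zero, Matrix.cons_val_one,
      Matrix.cons_val_fin_one]
    rw [hC, PowerSeries.coeff_smul, PowerSeries.coeff_C_mul, PowerSeries.coeff_X_pow, if_neg hm.symm,
      mul_zero, smul_zero]
  · intro h; simp at h; omega

theorem polySlash_one {N : ℕ} {f : ℚ_[5]⟦X⟧} (hf : f ∈ polyDeg N) : polySlash N 1 f = f := by
  ext n
  by_cases hn : n ≤ N
  · rw [show (1 : Matrix (Fin 2) (Fin 2) ℚ_[5]) = !![1, 0; 0, 1] from Matrix.one_fin_two,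
      coeff_polySlash_diagonal 1 1 hn]
    simp
  · rw [hf n (by omega), polySlash_mem N 1 f n (by omega)]

/-! ### Quaternions acting through the splitting -/

/-- The matrix over `ℚ_5` of a rational quaternion. -/
def quatMat : ℍ[ℚ] →+* Matrix (Fin 2) (Fin 2) ℚ_[5] := (split : ℍ[ℚ_[5]] →+* _).comp (toLocal 5)

theorem quatMat_apply (x : ℍ[ℚ]) : quatMat x =
    !![(x.re : ℚ_[5]) + nu * x.imJ, x.imI - nu * x.imK; -x.imI - nu * x.imK, x.re - nu * x.imJ] := rfl

/-- The quaternion `i`. -/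
def qI : ℍ[ℚ] := quat 0 1 0 0
/-- The quaternion `j`. -/
def qJ : ℍ[ℚ] := quat 0 0 1 0
/-- The quaternion `(1 + i + j + k) / 2`. -/
def qW : ℍ[ℚ] := quat (1 / 2) (1 / 2) (1 / 2) (1 / 2)
/-- The quaternion `1 + j`. -/
def qP : ℍ[ℚ] := quat 1 0 1 0

/-- The five quaternions of norm `5` that describe `U_5`. -/
def heckeQuat : Fin 5 → ℍ[ℚ] :=
  ![quat (-2) 0 1 0, quat (1 / 2) (-3 / 2) (-3 / 2) (-1 / 2), quat (1 / 2) (1 / 2) (-3 / 2) (-3 / 2),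
    quat (1 / 2) (-1 / 2) (-3 / 2) (3 / 2), quat (1 / 2) (3 / 2) (-3 / 2) (1 / 2)]

/-- Polynomials of degree at most `N` whose exponents are `a` modulo `4`. -/
def gradedPart (N a : ℕ) : Submodule ℚ_[5] ℚ_[5]⟦X⟧ where
  carrier := {f | f ∈ polyDeg N ∧ ∀ n, n % 4 ≠ a % 4 → PowerSeries.coeff n f = 0}
  zero_mem' := ⟨zero_mem _, fun _ _ => by simp⟩
  add_mem' := fun {f g} hf hg => ⟨add_mem hf.1 hg.1, fun n hn => by
    rw [map_add, hf.2 n hn, hg.2 n hn, add_zero]⟩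
  smul_mem' := fun c f hf => ⟨Submodule.smul_mem _ _ hf.1, fun n hn => by
    rw [PowerSeries.coeff_smul, hf.2 n hn, smul_zero]⟩

/-- Polynomials in the graded part that are invariant under the Hurwitz units. -/
def invariantPart (N a : ℕ) : Submodule ℚ_[5] ℚ_[5]⟦X⟧ :=
  gradedPart N a ⊓ LinearMap.ker (polySlash N (quatMat qI) - LinearMap.id) ⊓
    LinearMap.ker (polySlash N (quatMat qW) - LinearMap.id)

theorem mem_invariantPart {N a : ℕ} {f : ℚ_[5]⟦X⟧} : f ∈ invariantPart N a ↔
    f ∈ gradedPart N a ∧ polySlash N (quatMat qI) f = f ∧ polySlash N (quatMat qW) f = f := by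
  simp [invariantPart, and_assoc, sub_eq_zero]

/-- The sum over the Hurwitz units modulo the powers of `j`. -/
def unitTrace (N : ℕ) : ℚ_[5]⟦X⟧ →ₗ[ℚ_[5]] ℚ_[5]⟦X⟧ :=
  polySlash N (quatMat 1) + polySlash N (quatMat qW) + polySlash N (quatMat (qW * qW)) +
    polySlash N (quatMat qI) + polySlash N (quatMat (qI * qW)) + polySlash N (quatMat (qI * qW * qW))

theorem nu_ne_zero : nu ≠ 0 := fun h => by have := nu_sq; rw [h] at this; norm_num at this

theorem nu_pow_four : nu ^ 4 = 1 := by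
  rw [show nu ^ 4 = (nu ^ 2) ^ 2 by ring, nu_sq]; norm_num

theorem nu_pow_mod (m : ℕ) : nu ^ m = nu ^ (m % 4) := by
  conv_lhs => rw [← Nat.div_add_mod m 4, pow_add, pow_mul, nu_pow_four, one_pow, one_mul]

theorem nu_pow_injOn {m n : ℕ} (h : nu ^ m = nu ^ n) : m % 4 = n % 4 := by
  rw [nu_pow_mod m, nu_pow_mod n] at h
  have hs := nu_sq
  have h3 : nu ^ 3 = -nu := by rw [pow_succ, hs]; ring
  have hm : m % 4 < 4 := Nat.mod_lt _ (by norm_num)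
  have hn : n % 4 < 4 := Nat.mod_lt _ (by norm_num)
  generalize m % 4 = s at *
  generalize n % 4 = t at *
  have n1 : nu ≠ 1 := fun h => by rw [h] at hs; norm_num at hs
  have n2 : nu ≠ -1 := fun h => by rw [h] at hs; norm_num at hs
  have n3 : nu ≠ -nu := fun h => nu_ne_zero (self_eq_neg.mp h)
  have n4 : (1 : ℚ_[5]) ≠ -1 := by norm_num
  have n5 : (1 : ℚ_[5]) ≠ -nu := fun h => n2 (by linear_combination h)
  have n6 : (-1 : ℚ_[5]) ≠ -nu := fun h => n1 (by linear_combination h)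
  interval_cases s <;> interval_cases t <;>
    simp_all [eq_comm]

theorem one_sub_nu_ne_zero : 1 - nu ≠ 0 := fun h => by
  have hs := nu_sq
  have : nu = 1 := by linear_combination -h
  rw [this] at hs; norm_num at hs

theorem quatMat_qP : quatMat qP = !![1 + nu, 0; 0, 1 - nu] := by
  rw [quatMat_apply]; simp [qP]

theorem polySlash_qP_coeff {N : ℕ} {f : ℚ_[5]⟦X⟧} {n : ℕ} (hn : n ≤ N) :
    PowerSeries.coeff n (polySlash N (quatMat qP) f) =
      (1 - nu) ^ N * nu ^ n * PowerSeries.coeff n f := by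
  rw [quatMat_qP, coeff_polySlash_diagonal _ _ hn]
  have : 1 + nu = (1 - nu) * nu := by linear_combination nu_sq
  rw [this, mul_pow]
  have : (1 - nu) ^ N = (1 - nu) ^ n * (1 - nu) ^ (N - n) := by rw [← pow_add]; congr 1; omega
  rw [this]; ring

/-- `1 + j` is diagonal with ratio of entries `ν`, which has order 4, so its eigenspaces are the
residue classes of exponents modulo 4. -/
theorem mem_gradedPart_iff {N a : ℕ} {f : ℚ_[5]⟦X⟧} (hf : f ∈ polyDeg N) : f ∈ gradedPart N a ↔
    polySlash N (quatMat qP) f = ((1 - nu) ^ N * nu ^ a) • f := by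
  constructor
  · rintro ⟨-, h⟩
    ext n
    by_cases hn : n ≤ N
    · rw [polySlash_qP_coeff hn, PowerSeries.coeff_smul, smul_eq_mul]
      by_cases hna : n % 4 = a % 4
      · rw [nu_pow_mod n, nu_pow_mod a, hna]
      · rw [h n hna, mul_zero, mul_zero]
    · rw [polySlash_mem N _ f n (by omega), PowerSeries.coeff_smul, hf n (by omega), smul_zero]
  · intro h
    refine ⟨hf, fun n hn => ?_⟩
    by_cases hnN : n ≤ N
    · have := congrArg (PowerSeries.coeff n) h
      rw [polySlash_qP_coeff hnN, PowerSeries.coeff_smul, smul_eq_mul, mul_assoc, mul_assoc] at this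
      have := mul_left_cancel₀ (pow_ne_zero _ one_sub_nu_ne_zero) this
      by_contra hc
      exact hn (nu_pow_injOn (mul_right_cancel₀ hc this))
    · exact hf n (by omega)

theorem polySlash_neg {N : ℕ} (hN : Even N) (γ : Matrix (Fin 2) (Fin 2) ℚ_[5]) (f : ℚ_[5]⟦X⟧) :
    polySlash N (-γ) f = polySlash N γ f := by
  rw [polySlash_apply, polySlash_apply]
  refine Finset.sum_congr rfl fun n hn => ?_
  have hl (c d : ℚ_[5]) : linSeries (-c) (-d) = -linSeries c d := by
    simp only [linSeries, map_neg]; ring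
  simp only [Matrix.neg_apply, hl]
  rw [neg_pow, neg_pow (linSeries (γ 1 0) (γ 1 1)), mul_mul_mul_comm, ← pow_add,
    show n + (N - n) = N by simp at hn; omega, hN.neg_one_pow, one_mul]

/-- On `z^n` with `n ≡ a` modulo 4 the eigenvalue is `ν^N (-1)^(N-n)` with `N = 2a + 4x`; both
factors equal `(-1)^a`. This is why only weights congruent to `2a + 2` modulo 4 matter. -/
theorem polySlash_qJ {x a : ℕ} {f : ℚ_[5]⟦X⟧} (hf : f ∈ gradedPart (2 * a + 4 * x) a) :
    polySlash (2 * a + 4 * x) (quatMat qJ) f = f := by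
  have hJ : quatMat qJ = !![nu, 0; 0, -nu] := by rw [quatMat_apply]; simp [qJ]
  ext n
  by_cases hn : n ≤ 2 * a + 4 * x
  · rw [hJ, coeff_polySlash_diagonal _ _ hn]
    by_cases hna : n % 4 = a % 4
    · have h1 : nu ^ n * (-nu) ^ (2 * a + 4 * x - n) = 1 := by
        rw [neg_pow, mul_left_comm, ← pow_add, show n + (2 * a + 4 * x - n) = 2 * a + 4 * x by omega,
          pow_add, pow_mul, pow_mul, nu_pow_four, one_pow, mul_one, nu_sq, ← pow_add]
        refine Even.neg_one_pow ?_
        rw [Nat.even_iff]; omega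
      rw [h1, one_mul]
    · rw [hf.2 n hna, mul_zero]
  · rw [polySlash_mem _ _ f n (by omega), hf.1 n (by omega)]

section

variable {x a : ℕ} {f : ℚ_[5]⟦X⟧}

theorem polySlash_quatMat_mul (N : ℕ) (u v : ℍ[ℚ]) (f : ℚ_[5]⟦X⟧) :
    polySlash N (quatMat v) (polySlash N (quatMat u) f) = polySlash N (quatMat (u * v)) f := by
  rw [polySlash_comp, map_mul]

theorem even_weight (x a : ℕ) : Even (2 * a + 4 * x) := ⟨a + 2 * x, by ring⟩

theorem polySlash_quatMat_neg {N : ℕ} (hN : Even N) (u : ℍ[ℚ]) (f : ℚ_[5]⟦X⟧) :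
    polySlash N (quatMat (-u)) f = polySlash N (quatMat u) f := by
  rw [map_neg, polySlash_neg hN]

theorem polySlash_qJ_mul (hf : f ∈ gradedPart (2 * a + 4 * x) a) (u : ℍ[ℚ]) :
    polySlash (2 * a + 4 * x) (quatMat (qJ * u)) f = polySlash (2 * a + 4 * x) (quatMat u) f := by
  rw [← polySlash_quatMat_mul, polySlash_qJ hf]

theorem polySlash_neg_qJ_mul (hf : f ∈ gradedPart (2 * a + 4 * x) a) (u : ℍ[ℚ]) :
    polySlash (2 * a + 4 * x) (quatMat (-(qJ * u))) f = polySlash (2 * a + 4 * x) (quatMat u) f := by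
  rw [polySlash_quatMat_neg (even_weight x a), polySlash_qJ_mul hf]

end

section

variable {x a : ℕ} {f : ℚ_[5]⟦X⟧}

theorem qW_cubed : qW * qW * qW = -1 := by
  ext <;> simp [qW] <;> norm_num

theorem unitTrace_apply (N : ℕ) (f : ℚ_[5]⟦X⟧) : unitTrace N f =
    polySlash N (quatMat 1) f + polySlash N (quatMat qW) f + polySlash N (quatMat (qW * qW)) f +
    polySlash N (quatMat qI) f + polySlash N (quatMat (qI * qW)) f +
    polySlash N (quatMat (qI * qW * qW)) f := rfl

/-- Right multiplication by `i` or `ω` permutes the six cosets `⟨j⟩u` of units, and so does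
conjugation by `1 + j`, which normalises the unit group and commutes with `j`. Since `f` is fixed by
`j` and by `-1`, representatives of cosets may be exchanged; the identities `e1, …, e6` record the
permutations. -/
theorem unitTrace_mem (hf : f ∈ gradedPart (2 * a + 4 * x) a) :
    unitTrace (2 * a + 4 * x) f ∈ invariantPart (2 * a + 4 * x) a := by
  have hN := even_weight x a
  set N := 2 * a + 4 * x with hNdef
  have hneg (u : ℍ[ℚ]) := polySlash_quatMat_neg hN u f
  have hj (u : ℍ[ℚ]) := polySlash_qJ_mul hf u
  have hnj (u : ℍ[ℚ]) := polySlash_neg_qJ_mul hf u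
  rw [← hNdef] at hj hnj
  have hpoly : unitTrace N f ∈ polyDeg N := by
    rw [unitTrace_apply]
    exact add_mem (add_mem (add_mem (add_mem (add_mem (polySlash_mem _ _ _) (polySlash_mem _ _ _))
      (polySlash_mem _ _ _)) (polySlash_mem _ _ _)) (polySlash_mem _ _ _)) (polySlash_mem _ _ _)
  rw [mem_invariantPart, mem_gradedPart_iff hpoly]
  refine ⟨?_, ?_, ?_⟩
  · have hP := (mem_gradedPart_iff hf.1).mp hf
    have hPu (u : ℍ[ℚ]) : polySlash N (quatMat (qP * u)) f =
        ((1 - nu) ^ N * nu ^ a) • polySlash N (quatMat u) f := by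
      rw [← polySlash_quatMat_mul, hP, map_smul]
    have e1 : (1 : ℍ[ℚ]) * qP = qP * 1 := by rw [one_mul, mul_one]
    have e2 : qW * qP = qP * -(qJ * (qW * qW)) := by
      ext <;> simp [qW, qP, qJ] <;> norm_num
    have e3 : qW * qW * qP = qP * -(qJ * (qI * qW)) := by
      ext <;> simp [qW, qP, qJ, qI] <;> norm_num
    have e4 : qI * qP = qP * -(qJ * qI) := by
      ext <;> simp [qP, qJ, qI]
    have e5 : qI * qW * qP = qP * (qI * qW * qW) := by
      ext <;> simp [qW, qP, qI] <;> norm_num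
    have e6 : qI * qW * qW * qP = qP * -qW := by
      ext <;> simp [qW, qP, qI] <;> norm_num
    rw [unitTrace_apply]
    simp only [map_add, polySlash_quatMat_mul, e1, e2, e3, e4, e5, e6, hPu, hneg, hj, smul_add]
    abel
  · have e1 : (1 : ℍ[ℚ]) * qI = qI := one_mul _
    have e2 : qW * qI = qJ * qW := by ext <;> simp [qW, qJ, qI]
    have e3 : qW * qW * qI = -(qJ * (qI * qW * qW)) := by
      ext <;> simp [qW, qJ, qI] <;> norm_num
    have e4 : qI * qI = -1 := by ext <;> simp [qI]
    have e5 : qI * qW * qI = -(qJ * (qI * qW)) := by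
      ext <;> simp [qW, qJ, qI]
    have e6 : qI * qW * qW * qI = -(qJ * (qW * qW)) := by
      ext <;> simp [qW, qJ, qI] <;> norm_num
    rw [unitTrace_apply]
    simp only [map_add, polySlash_quatMat_mul, e1, e2, e3, e4, e5, e6, hneg, hj]
    abel
  · have e1 : (1 : ℍ[ℚ]) * qW = qW := one_mul _
    have e3 : qI * qW * qW * qW = -qI := by
      rw [mul_assoc, mul_assoc, ← mul_assoc qW, qW_cubed, mul_neg_one]
    rw [unitTrace_apply]
    simp only [map_add, polySlash_quatMat_mul, e1, qW_cubed, e3, hneg]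
    abel

/-- Up to left multiplication by powers of `j`, which fix `f`, the five quaternions are `u *
heckeQuat 0` with `u` running over the coset representatives except `i`. Adding and subtracting the
missing term completes the sum to a trace. -/
theorem sum_polySlash_heckeQuat (hf : f ∈ gradedPart (2 * a + 4 * x) a) :
    ∑ s, polySlash (2 * a + 4 * x) (quatMat (heckeQuat s)) f =
      polySlash (2 * a + 4 * x) (quatMat (heckeQuat 0)) (unitTrace (2 * a + 4 * x) f) -
        polySlash (2 * a + 4 * x) (quatMat (qI * heckeQuat 0)) f := by
  have hj (u : ℍ[ℚ]) := polySlash_qJ_mul hf u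
  have hnj (u : ℍ[ℚ]) := polySlash_neg_qJ_mul hf u
  have e1 : heckeQuat 1 = qW * qW * heckeQuat 0 := by
    ext <;> simp [heckeQuat, qW] <;> norm_num
  have e2 : heckeQuat 2 = -(qJ * (qI * qW * heckeQuat 0)) := by
    ext <;> simp [heckeQuat, qW, qJ, qI] <;> norm_num
  have e3 : heckeQuat 3 = qJ * (qW * heckeQuat 0) := by
    ext <;> simp [heckeQuat, qW, qJ] <;> norm_num
  have e4 : heckeQuat 4 = -(qJ * (qI * qW * qW * heckeQuat 0)) := by
    ext <;> simp [heckeQuat, qW, qJ, qI] <;> norm_num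
  rw [Fin.sum_univ_five, e1, e2, e3, e4, hj, hnj, hnj, unitTrace_apply]
  simp only [map_add, polySlash_quatMat_mul, one_mul]
  abel

end

/-! ### Rank of the truncated matrix in classical weights -/

theorem X_pow_mem_gradedPart {N a m : ℕ} (hm : m ≤ N) (hma : m % 4 = a % 4) :
    PowerSeries.X ^ m ∈ gradedPart N a :=
  ⟨X_pow_mem_polyDeg hm, fun n hn => by
    rw [PowerSeries.coeff_X_pow, if_neg]; rintro rfl; exact hn hma⟩

instance (N : ℕ) : FiniteDimensional ℚ_[5] (polyDeg N) := by
  have h : polyDeg N ≤ Submodule.span ℚ_[5]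
      ((fun n : ℕ => (PowerSeries.X ^ n : ℚ_[5]⟦X⟧)) '' Set.Iic N) := by
    intro f hf
    rw [eq_sum_of_mem_polyDeg hf]
    refine Submodule.sum_mem _ fun n hn => Submodule.smul_mem _ _ (Submodule.subset_span ⟨n, ?_, rfl⟩)
    simp at hn
    simpa using hn
  have := FiniteDimensional.span_of_finite ℚ_[5]
    ((Set.finite_Iic N).image fun n : ℕ => (PowerSeries.X ^ n : ℚ_[5]⟦X⟧))
  exact Submodule.finiteDimensional_of_le h

theorem gradedPart_le (N a : ℕ) : gradedPart N a ≤ polyDeg N := fun _ h => h.1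

theorem invariantPart_le (N a : ℕ) : invariantPart N a ≤ gradedPart N a := fun _ h => h.1.1

instance (N a : ℕ) : FiniteDimensional ℚ_[5] (gradedPart N a) :=
  Submodule.finiteDimensional_of_le (gradedPart_le N a)

instance (N a : ℕ) : FiniteDimensional ℚ_[5] (invariantPart N a) :=
  Submodule.finiteDimensional_of_le (invariantPart_le N a)

theorem rank_le_of_factor {n : ℕ} (B : Matrix (Fin n) (Fin n) ℚ_[5])
    (V : Submodule ℚ_[5] ℚ_[5]⟦X⟧) [FiniteDimensional ℚ_[5] V]
    (L : ℚ_[5]⟦X⟧ →ₗ[ℚ_[5]] ℚ_[5]⟦X⟧) (e : Fin n → ℕ) (v : Fin n → ℚ_[5]⟦X⟧) (hv : ∀ j, v j ∈ V)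
    (hB : ∀ i j, B i j = PowerSeries.coeff (e i) (L (v j))) :
    B.rank ≤ Module.finrank ℚ_[5] V := by
  let L1 : (Fin n → ℚ_[5]) →ₗ[ℚ_[5]] V := Fintype.linearCombination ℚ_[5] fun j => ⟨v j, hv j⟩
  let L2 : V →ₗ[ℚ_[5]] (Fin n → ℚ_[5]) :=
    LinearMap.pi fun i => (PowerSeries.coeff (e i)).comp (L.comp V.subtype)
  have : B.mulVecLin = L2 ∘ₗ L1 := by
    refine LinearMap.ext fun c => funext fun i => ?_
    simp only [Matrix.mulVecLin_apply, Matrix.mulVec, dotProduct, LinearMap.comp_apply, L2, L1,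
      LinearMap.pi_apply, Fintype.linearCombination_apply, map_sum, map_smul, hB,
      Submodule.subtype_apply, smul_eq_mul]
    exact Finset.sum_congr rfl fun j _ => mul_comm _ _
  rw [Matrix.rank, this, LinearMap.range_comp]
  exact (Submodule.finrank_map_le _ _).trans (Submodule.finrank_le _)

theorem rank_le_of_columns {n : ℕ} (B : Matrix (Fin n) (Fin n) ℚ_[5]) (m : ℕ)
    (hB : ∀ i j, B i j ≠ 0 → n ≤ (j : ℕ) + m) : B.rank ≤ m := by
  classical
  let D : Fin n → ℚ_[5] := fun j => if n ≤ (j : ℕ) + m then 1 else 0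
  have hBD : B = B * Matrix.diagonal D := by
    ext i j
    rw [Matrix.mul_diagonal]
    by_cases h : n ≤ (j : ℕ) + m
    · simp [D, h]
    · have : B i j = 0 := by by_contra hc; exact h (hB i j hc)
      simp [this]
  rw [hBD]
  refine (Matrix.rank_mul_le_right _ _).trans ?_
  rw [Matrix.rank_diagonal, Fintype.card_subtype]
  have hsub : (Finset.univ.filter fun j : Fin n => D j ≠ 0).card ≤ (Finset.Ico (n - m) n).card := by
    refine Finset.card_le_card_of_injOn (fun j => (j : ℕ)) ?_ (Fin.val_injective.injOn)
    intro j hj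
    have hj' : n ≤ (j : ℕ) + m := by
      by_contra h
      simp [D, h] at hj
    simp only [Finset.coe_Ico, Set.mem_Ico]
    exact ⟨by omega, j.2⟩
  rw [Nat.card_Ico] at hsub
  omega

theorem rank_add_le_add_rank {n : ℕ} (A B : Matrix (Fin n) (Fin n) ℚ_[5]) :
    (A + B).rank ≤ A.rank + B.rank := by
  rw [Matrix.rank, Matrix.rank, Matrix.rank, Matrix.mulVecLin_add]
  exact (Submodule.finrank_mono (LinearMap.range_add_le _ _)).trans
    (Submodule.finrank_add_le_finrank_add_finrank _ _)

theorem quatMat_qI_mul_heckeQuat_zero :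
    quatMat (qI * heckeQuat 0) = !![0, -2 - nu; 2 - nu, 0] := by
  rw [quatMat_apply]
  simp [heckeQuat, qI]

theorem coeff_polySlash_antidiagonal {N m i : ℕ} (hm : m ≤ N) (b c : ℚ_[5])
    (h : PowerSeries.coeff i (polySlash N !![0, b; c, 0] (PowerSeries.X ^ m)) ≠ 0) : i + m = N := by
  rw [polySlash_X_pow hm] at h
  simp only [Matrix.of_apply, Matrix.cons_val', Matrix.cons_val_zero, Matrix.cons_val_one,
    Matrix.cons_val_fin_one] at h
  have e : linSeries 0 b ^ m * linSeries c 0 ^ (N - m) =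
      PowerSeries.C (b ^ m * c ^ (N - m)) * PowerSeries.X ^ (N - m) := by
    simp [linSeries, mul_pow]; ring
  rw [e, PowerSeries.coeff_C_mul, PowerSeries.coeff_X_pow] at h
  by_contra hc
  exact h (by rw [if_neg (by omega), mul_zero])

/-- The truncated matrix has small rank in classical weights. -/
theorem rank_slashMinor_le {n x a : ℕ} (hn : n ≤ x) (ha : a < 4) :
    (slashMinor (fun s => quatMat (heckeQuat s)) n ((2 * a + 4 * x + 2 : ℕ) : ℤ) a).rank ≤
      Module.finrank ℚ_[5] (invariantPart (2 * a + 4 * x) a) + (2 * n - (x + 1)) := by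
  set N := 2 * a + 4 * x with hN
  have hmem (j : Fin n) : (PowerSeries.X ^ (4 * (j : ℕ) + a) : ℚ_[5]⟦X⟧) ∈ gradedPart N a :=
    X_pow_mem_gradedPart (by have := j.2; omega) (by omega)
  let B₁ : Matrix (Fin n) (Fin n) ℚ_[5] := Matrix.of fun i j => PowerSeries.coeff (4 * (i : ℕ) + a)
    (polySlash N (quatMat (heckeQuat 0)) (unitTrace N (PowerSeries.X ^ (4 * (j : ℕ) + a))))
  let B₂ : Matrix (Fin n) (Fin n) ℚ_[5] := Matrix.of fun i j => -PowerSeries.coeff (4 * (i : ℕ) + a)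
    (polySlash N (quatMat (qI * heckeQuat 0)) (PowerSeries.X ^ (4 * (j : ℕ) + a)))
  have hsum : slashMinor (fun s => quatMat (heckeQuat s)) n ((N + 2 : ℕ) : ℤ) a = B₁ + B₂ := by
    ext i j
    simp only [slashMinor, Matrix.of_apply, Matrix.add_apply, B₁, B₂]
    rw [← sub_eq_add_neg, ← map_sub, ← sum_polySlash_heckeQuat (hmem j), map_sum]
    exact Finset.sum_congr rfl fun s _ => by rw [slash_eq_polySlash _ (hmem j).1]
  have h1 : B₁.rank ≤ Module.finrank ℚ_[5] (invariantPart N a) :=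
    rank_le_of_factor B₁ _ (polySlash N (quatMat (heckeQuat 0))) (fun i => 4 * (i : ℕ) + a)
      (fun j => unitTrace N (PowerSeries.X ^ (4 * (j : ℕ) + a))) (fun j => unitTrace_mem (hmem j))
      fun i j => rfl
  -- A nonzero entry needs `(4i + a) + (4j + a) = 2a + 4x`, that is `i + j = x`; as `i < n`, only
  -- the columns `j ≥ x + 1 - n` can be nonzero.
  have h2 : B₂.rank ≤ 2 * n - (x + 1) := by
    refine rank_le_of_columns B₂ _ fun i j hij => ?_
    have hi := i.2
    have hj := j.2
    simp only [B₂, Matrix.of_apply, quatMat_qI_mul_heckeQuat_zero, ne_eq, neg_eq_zero] at hij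
    have := coeff_polySlash_antidiagonal (by omega) _ _ hij
    omega
  rw [hsum]
  exact (rank_add_le_add_rank _ _).trans (add_le_add h1 h2)

/-! ### The Hurwitz order and class number one -/

/-- The Hurwitz order. -/
def hurwitz : Subring ℍ[ℚ] where
  carrier := {x | ∃ a b c d : ℤ, x = quat ((a : ℚ) / 2) (a / 2 + b) (a / 2 + c) (a / 2 + d)}
  zero_mem' := ⟨0, 0, 0, 0, by ext <;> simp⟩
  one_mem' := ⟨2, -1, -1, -1, by ext <;> simp⟩
  add_mem' := by
    rintro _ _ ⟨a, b, c, d, rfl⟩ ⟨a', b', c', d', rfl⟩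
    refine ⟨a + a', b + b', c + c', d + d', ?_⟩
    ext <;> simp <;> ring
  neg_mem' := by
    rintro _ ⟨a, b, c, d, rfl⟩
    refine ⟨-a, -b, -c, -d, ?_⟩
    ext <;> simp <;> ring
  mul_mem' := by
    rintro _ _ ⟨a, b, c, d, rfl⟩ ⟨a', b', c', d', rfl⟩
    refine ⟨-(a * a' + a * (b' + c' + d') + (b + c + d) * a' + 2 * (b * b' + c * c' + d * d')),
      a * a' + a * (b' + d') + (b + c) * a' + b * b' + c * c' + d * d' + c * d' - d * c',
      a * a' + a * (b' + c') + (c + d) * a' + b * b' + c * c' + d * d' + d * b' - b * d',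
      a * a' + a * (c' + d') + (b + d) * a' + b * b' + c * c' + d * d' + b * c' - c * b', ?_⟩
    ext <;> simp <;> ring

theorem normSq_quat (a b c d : ℚ) : Quaternion.normSq (quat a b c d) = a ^ 2 + b ^ 2 + c ^ 2 + d ^ 2 := by
  simp [Quaternion.normSq_def']

theorem exists_normSq_eq_natCast {x : ℍ[ℚ]} (hx : x ∈ hurwitz) :
    ∃ m : ℕ, Quaternion.normSq x = m := by
  have h0 : 0 ≤ Quaternion.normSq x := Quaternion.normSq_nonneg
  obtain ⟨a, b, c, d, rfl⟩ := hx
  have e : Quaternion.normSq (quat ((a : ℚ) / 2) (a / 2 + b) (a / 2 + c) (a / 2 + d)) =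
      ((a ^ 2 + a * (b + c + d) + b ^ 2 + c ^ 2 + d ^ 2 : ℤ) : ℚ) := by
    rw [normSq_quat]; push_cast; ring
  rw [e] at h0 ⊢
  obtain ⟨m, hm⟩ := Int.eq_ofNat_of_zero_le (Int.cast_nonneg_iff.mp h0)
  exact ⟨m, by rw [hm]; simp⟩

theorem star_mem_hurwitz {x : ℍ[ℚ]} (hx : x ∈ hurwitz) : star x ∈ hurwitz := by
  obtain ⟨a, b, c, d, rfl⟩ := hx
  refine ⟨a, -a - b, -a - c, -a - d, ?_⟩
  ext <;> simp <;> ring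

theorem toLocal_mem_localOrder (p : ℕ) [Fact p.Prime] {x : ℍ[ℚ]} (hx : x ∈ hurwitz) :
    toLocal p x ∈ localOrder p := by
  obtain ⟨a, b, c, d, rfl⟩ := hx
  exact ⟨a, b, c, d, by ext <;> simp [toLocal]⟩

/-- Rounding twice the real part leaves a squared error of at most `1/16`, the three other
coordinates at most `1/4` each, in total at most `13/16`. -/
theorem exists_hurwitz_normSq_sub_lt_one (x : ℍ[ℚ]) :
    ∃ y ∈ hurwitz, Quaternion.normSq (x - y) < 1 := by
  set a := round (2 * x.re)
  set b := round (x.imI - a / 2)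
  set c := round (x.imJ - a / 2)
  set d := round (x.imK - a / 2)
  refine ⟨_, ⟨a, b, c, d, rfl⟩, ?_⟩
  have ha := abs_sub_round (2 * x.re)
  have hb := abs_sub_round (x.imI - a / 2)
  have hc := abs_sub_round (x.imJ - a / 2)
  have hd := abs_sub_round (x.imK - a / 2)
  rw [Quaternion.normSq_def']
  simp only [Quaternion.re_sub, Quaternion.imI_sub, Quaternion.imJ_sub, Quaternion.imK_sub, quat_re,
    quat_imI, quat_imJ, quat_imK]
  have sq {y : ℚ} (h : |y| ≤ 1 / 2) : y ^ 2 ≤ 1 / 4 := by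
    rw [← sq_abs]; nlinarith [abs_nonneg y]
  have h1 := sq ha
  have h2 := sq hb
  have h3 := sq hc
  have h4 := sq hd
  nlinarith

/-- Every right ideal of the Hurwitz order with two generators, one of which is not zero, is
principal. -/
theorem exists_generator {x y : ℍ[ℚ]} (hx : x ∈ hurwitz) (hy : y ∈ hurwitz) (hy0 : y ≠ 0) :
    ∃ δ ≠ 0, (∃ s ∈ hurwitz, x = δ * s) ∧ (∃ t ∈ hurwitz, y = δ * t) ∧
      ∃ a ∈ hurwitz, ∃ b ∈ hurwitz, δ = x * a + y * b := by
  classical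
  let I : Set ℍ[ℚ] := {z | ∃ a ∈ hurwitz, ∃ b ∈ hurwitz, z = x * a + y * b}
  have hI : ∃ m : ℕ, ∃ z ∈ I, z ≠ 0 ∧ Quaternion.normSq z = m := by
    obtain ⟨m, hm⟩ := exists_normSq_eq_natCast hy
    exact ⟨m, y, ⟨0, zero_mem _, 1, one_mem _, by simp⟩, hy0, hm⟩
  -- A nonzero element of least norm generates, by division with remainder.
  obtain ⟨δ, hδI, hδ0, hδ⟩ := Nat.find_spec hI
  have hmin (z : ℍ[ℚ]) (hz : z ∈ I) (hlt : Quaternion.normSq z < Quaternion.normSq δ) : z = 0 := by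
    by_contra hz0
    obtain ⟨a, ha, b, hb, e⟩ := hz
    obtain ⟨m, hm⟩ := exists_normSq_eq_natCast (x := z)
      (e ▸ add_mem (mul_mem hx ha) (mul_mem hy hb))
    refine Nat.find_min hI (m := m) ?_ ⟨z, ⟨a, ha, b, hb, e⟩, hz0, hm⟩
    rw [hδ, hm] at hlt
    exact_mod_cast hlt
  have hdiv (z : ℍ[ℚ]) (hz : z ∈ I) : ∃ s ∈ hurwitz, z = δ * s := by
    obtain ⟨s, hs, hlt⟩ := exists_hurwitz_normSq_sub_lt_one (δ⁻¹ * z)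
    refine ⟨s, hs, ?_⟩
    have e : z - δ * s = δ * (δ⁻¹ * z - s) := by
      rw [mul_sub, mul_inv_cancel_left₀ hδ0]
    rw [← sub_eq_zero]
    refine hmin _ ?_ ?_
    · obtain ⟨a, ha, b, hb, rfl⟩ := hz
      obtain ⟨a', ha', b', hb', e'⟩ := hδI
      refine ⟨a - a' * s, sub_mem ha (mul_mem ha' hs), b - b' * s, sub_mem hb (mul_mem hb' hs), ?_⟩
      rw [e']; noncomm_ring
    · rw [e, map_mul]
      have : 0 < Quaternion.normSq δ :=
        lt_of_le_of_ne Quaternion.normSq_nonneg (Ne.symm (by simpa using hδ0))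
      nlinarith
  exact ⟨δ, hδ0, hdiv x ⟨1, one_mem _, 0, zero_mem _, by simp⟩,
    hdiv y ⟨0, zero_mem _, 1, one_mem _, by simp⟩, hδI⟩

theorem exists_int_approx (p : ℕ) [Fact p.Prime] (N : ℕ) (a : ℤ_[p]) :
    ∃ (m : ℤ) (e : ℤ_[p]), a = m + p ^ N * e := by
  have h := PadicInt.appr_spec N a
  rw [Ideal.mem_span_singleton] at h
  obtain ⟨e, he⟩ := h
  exact ⟨a.appr N, e, by rw [← he]; push_cast; ring⟩

theorem natCast_eq_quat {R : Type} [CommRing R] (m : ℕ) : (m : ℍ[R]) = quat (m : R) 0 0 0 := by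
  ext <;> simp

theorem natCast_pow_eq_quat {R : Type} [CommRing R] (m N : ℕ) :
    (m : ℍ[R]) ^ N = quat ((m : R) ^ N) 0 0 0 := by
  rw [← Nat.cast_pow, natCast_eq_quat, Nat.cast_pow]

theorem exists_hurwitz_approx (p : ℕ) [Fact p.Prime] (N : ℕ) {h : ℍ[ℚ_[p]]}
    (hh : h ∈ localOrder p) :
    ∃ x ∈ hurwitz, ∃ w ∈ localOrder p, h = toLocal p x + (p : ℍ[ℚ_[p]]) ^ N * w := by
  obtain ⟨a, b, c, d, rfl⟩ := hh
  obtain ⟨a, a', rfl⟩ := exists_int_approx p N a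
  obtain ⟨b, b', rfl⟩ := exists_int_approx p N b
  obtain ⟨c, c', rfl⟩ := exists_int_approx p N c
  obtain ⟨d, d', rfl⟩ := exists_int_approx p N d
  refine ⟨_, ⟨a, b, c, d, rfl⟩, _, ⟨a', b', c', d', rfl⟩, ?_⟩
  rw [natCast_pow_eq_quat]
  ext <;> simp [toLocal] <;> ring

theorem exists_pow_mul_mem (p : ℕ) [Fact p.Prime] (h : ℍ[ℚ_[p]]) :
    ∃ M : ℕ, ∀ m ≥ M, (p : ℍ[ℚ_[p]]) ^ m * h ∈ localOrder p := by
  have hq (q : ℚ_[p]) : ∀ᶠ m : ℕ in Filter.atTop, ‖(p : ℚ_[p]) ^ m * q‖ ≤ 1 := by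
    have ht : Filter.Tendsto (fun m : ℕ => (p : ℚ_[p]) ^ m * q) Filter.atTop (nhds (0 * q)) :=
      (tendsto_pow_atTop_nhds_zero_of_norm_lt_one Padic.norm_p_lt_one).mul_const q
    rw [zero_mul] at ht
    have := ht.norm
    rw [norm_zero] at this
    exact (this.eventually_lt_const one_pos).mono fun _ h => h.le
  obtain ⟨M, hM⟩ := Filter.eventually_atTop.mp
    ((hq h.re).and ((hq h.imI).and ((hq h.imJ).and (hq h.imK))))
  refine ⟨M, fun m hm => ?_⟩
  obtain ⟨h1, h2, h3, h4⟩ := hM m hm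
  rw [natCast_pow_eq_quat]
  exact mem_localOrder_of_integral _ _ (by simpa using h1) (by simpa using h2) (by simpa using h3)
    (by simpa using h4)

theorem mem_localUnits_iff {p : ℕ} [Fact p.Prime] {u : (ℍ[ℚ_[p]])ˣ} :
    u ∈ localUnits p ↔ (u : ℍ[ℚ_[p]]) ∈ localOrder p ∧
      ((u⁻¹ : (ℍ[ℚ_[p]])ˣ) : ℍ[ℚ_[p]]) ∈ localOrder p :=
  Submonoid.mem_units_iff _ _

/-- The map `Dˣ → (D ⊗ ℚ_p)ˣ`. -/
def toLocalUnits (p : ℕ) [Fact p.Prime] : (ℍ[ℚ])ˣ →* (ℍ[ℚ_[p]])ˣ :=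
  Units.map (toLocal p).toMonoidHom

theorem coe_toLocalUnits (p : ℕ) [Fact p.Prime] (x : (ℍ[ℚ])ˣ) :
    (toLocalUnits p x : ℍ[ℚ_[p]]) = toLocal p x := rfl

theorem mem_localOrder_natCast_inv {p : ℕ} [Fact p.Prime] {m : ℕ} (hm : ¬ p ∣ m) {x : ℍ[ℚ_[p]]}
    (hx : x ∈ localOrder p) : quat (m : ℚ_[p])⁻¹ 0 0 0 * x ∈ localOrder p := by
  have h : ‖(m : ℚ_[p])‖ = 1 := (Padic.norm_natCast_eq_one_iff).mpr
    ((Nat.Prime.coprime_iff_not_dvd Fact.out).mpr hm)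
  exact mul_mem (mem_localOrder_of_integral _ _ (by simp [h]) (by simp) (by simp) (by simp)) hx

/-- An element of the Hurwitz order that divides `m` is a unit at all primes not dividing `m`. -/
theorem toLocalUnits_mem_localUnits {q : ℕ} [Fact q.Prime] {m : ℕ} (hm : ¬ q ∣ m) {δ : (ℍ[ℚ])ˣ}
    (hδ : (δ : ℍ[ℚ]) ∈ hurwitz) {t : ℍ[ℚ]} (ht : t ∈ hurwitz) (h : (m : ℍ[ℚ]) = δ * t) :
    toLocalUnits q δ ∈ localUnits q := by
  rw [mem_localUnits_iff, ← map_inv, coe_toLocalUnits, coe_toLocalUnits]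
  refine ⟨toLocal_mem_localOrder q hδ, ?_⟩
  have hm0 : (m : ℚ_[q]) ≠ 0 := by
    rw [Nat.cast_ne_zero]; rintro rfl; exact hm (dvd_zero q)
  have e : t = ((δ⁻¹ : (ℍ[ℚ])ˣ) : ℍ[ℚ]) * (m : ℍ[ℚ]) := by rw [h, Units.inv_mul_cancel_left]
  have e' : toLocal q ((δ⁻¹ : (ℍ[ℚ])ˣ) : ℍ[ℚ]) = quat (m : ℚ_[q])⁻¹ 0 0 0 * toLocal q t := by
    have e2 : quat (m : ℚ_[q])⁻¹ 0 0 0 * (m : ℍ[ℚ_[q]]) = 1 := by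
      rw [natCast_eq_quat]; ext <;> simp [hm0]
    rw [e, map_mul, map_natCast, ← (Nat.cast_commute m _).eq, ← mul_assoc, e2, one_mul]
  rw [e']
  exact mem_localOrder_natCast_inv hm (toLocal_mem_localOrder q ht)

/-- Used with `x = h`, `y = h⁻¹`, and `p`, `q`, `r` the powers of the prime with exponents `M1`,
`M2`, `N`: the factor `p` can be taken out of `h⁻¹ δ`, leaving an integral expression. -/
theorem quotient_identity {A : Type*} [Ring A] {x y p q r w s t : A} (c1 : y * p = p * y)
    (c2 : y * r = r * y) (c3 : r = p * q) (h : y * x = 1) :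
    y * ((p * x - r * w) * s + r * t) = p * ((1 - q * y * w) * s + q * y * t) := by
  have e : y * ((p * x - r * w) * s + r * t) = y * p * x * s - y * r * w * s + y * r * t := by
    noncomm_ring
  rw [e, c1, c2, mul_assoc p y x, h, c3]
  noncomm_ring

/-- Class number one, one prime at a time. -/
theorem exists_local_generator (p : ℕ) [Fact p.Prime] (h : (ℍ[ℚ_[p]])ˣ) :
    ∃ δ : (ℍ[ℚ])ˣ, (toLocalUnits p δ)⁻¹ * h ∈ localUnits p ∧
      ∀ (q : ℕ) [Fact q.Prime], q ≠ p → toLocalUnits q δ ∈ localUnits q := by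
  have hp : (p : ℍ[ℚ]) ≠ 0 := by
    rw [natCast_eq_quat]
    intro h
    have := congrArg (fun z : ℍ[ℚ] => z.re) h
    exact (Fact.out : p.Prime).ne_zero (by simpa using this)
  obtain ⟨M1, hM1⟩ := exists_pow_mul_mem p (h : ℍ[ℚ_[p]])
  obtain ⟨M2, hM2⟩ := exists_pow_mul_mem p ((h⁻¹ : (ℍ[ℚ_[p]])ˣ) : ℍ[ℚ_[p]])
  let π : (ℍ[ℚ])ˣ := Units.mk0 (p : ℍ[ℚ]) hp
  have hπ : toLocal p (π : ℍ[ℚ]) = p := map_natCast _ _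
  -- With this exponent `p^N` lies in `p^M1 h O_p`. So replacing `p^M1 h` by a Hurwitz approximation
  -- modulo `p^N` and adjoining `p^N` gives a global right ideal that is `p^M1 h O_p` at `p` and
  -- trivial elsewhere; `δ` generates it.
  let N := M1 + M2
  obtain ⟨x, hx, w, hw, hxw⟩ := exists_hurwitz_approx p N (hM1 M1 le_rfl)
  have hpN : (p : ℍ[ℚ]) ^ N ≠ 0 := pow_ne_zero _ hp
  obtain ⟨δ, hδ0, ⟨s, hs, hxs⟩, ⟨t, ht, hyt⟩, a, ha, b, hb, hab⟩ :=
    exists_generator hx (pow_mem (natCast_mem hurwitz p) N) hpN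
  let δ' : (ℍ[ℚ])ˣ := Units.mk0 δ hδ0
  have hδ : δ ∈ hurwitz := by
    rw [hab]; exact add_mem (mul_mem hx ha) (mul_mem (pow_mem (natCast_mem hurwitz p) N) hb)
  have hdvd {q : ℕ} [Fact q.Prime] (hq : q ≠ p) (m : ℕ) : ¬ q ∣ p ^ m := fun hd =>
    hq ((Nat.prime_dvd_prime_iff_eq Fact.out Fact.out).mp ((Fact.out : q.Prime).dvd_of_dvd_pow hd))
  refine ⟨(π ^ M1)⁻¹ * δ', ?_, fun q _ hq => ?_⟩
  · have hO {z : ℍ[ℚ]} (hz : z ∈ hurwitz) := toLocal_mem_localOrder p hz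
    have hδinv : toLocal p (((δ')⁻¹ : (ℍ[ℚ])ˣ) : ℍ[ℚ]) * toLocal p δ = 1 := by
      rw [← map_mul]; simp [δ', hδ0]
    have comm (z : ℍ[ℚ_[p]]) (m : ℕ) : z * (p : ℍ[ℚ_[p]]) ^ m = (p : ℍ[ℚ_[p]]) ^ m * z :=
      ((Nat.cast_commute p z).pow_left m).eq.symm
    rw [mem_localUnits_iff]
    constructor
    · have e : (((toLocalUnits p ((π ^ M1)⁻¹ * δ'))⁻¹ * h : (ℍ[ℚ_[p]])ˣ) : ℍ[ℚ_[p]]) =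
          toLocal p s + toLocal p t * w := by
        rw [← map_inv, mul_inv_rev, inv_inv, map_mul, Units.val_mul, Units.val_mul, coe_toLocalUnits,
          coe_toLocalUnits, Units.val_pow_eq_pow_val, map_pow, hπ, mul_assoc, hxw, hxs, map_mul,
          mul_add, ← mul_assoc, hδinv, one_mul]
        congr 1
        rw [← mul_assoc, show (p : ℍ[ℚ_[p]]) ^ N = toLocal p δ * toLocal p t by
          rw [← map_mul, ← hyt]; simp, ← mul_assoc, hδinv, one_mul]
      rw [e]
      exact add_mem (hO hs) (mul_mem (hO ht) hw)
    · have e : ((((toLocalUnits p ((π ^ M1)⁻¹ * δ'))⁻¹ * h)⁻¹ : (ℍ[ℚ_[p]])ˣ) : ℍ[ℚ_[p]]) =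
          (1 - (p : ℍ[ℚ_[p]]) ^ M2 * ((h⁻¹ : (ℍ[ℚ_[p]])ˣ) : ℍ[ℚ_[p]]) * w) * toLocal p a +
            (p : ℍ[ℚ_[p]]) ^ M2 * ((h⁻¹ : (ℍ[ℚ_[p]])ˣ) : ℍ[ℚ_[p]]) * toLocal p b := by
        have hc : ((toLocalUnits p (π ^ M1) : (ℍ[ℚ_[p]])ˣ) : ℍ[ℚ_[p]]) = (p : ℍ[ℚ_[p]]) ^ M1 := by
          rw [coe_toLocalUnits, Units.val_pow_eq_pow_val, map_pow, hπ]
        have key : (p : ℍ[ℚ_[p]]) ^ M1 * ((((toLocalUnits p ((π ^ M1)⁻¹ * δ'))⁻¹ * h)⁻¹ :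
            (ℍ[ℚ_[p]])ˣ) : ℍ[ℚ_[p]]) = ((h⁻¹ : (ℍ[ℚ_[p]])ˣ) : ℍ[ℚ_[p]]) * toLocal p δ := by
          rw [← hc, ← Units.val_mul, show toLocal p δ = ((toLocalUnits p δ' : (ℍ[ℚ_[p]])ˣ) : ℍ[ℚ_[p]])
            from rfl, ← Units.val_mul]
          congr 1
          have hcom : h⁻¹ * (toLocalUnits p (π ^ M1))⁻¹ = (toLocalUnits p (π ^ M1))⁻¹ * h⁻¹ := by
            rw [← mul_inv_rev, ← mul_inv_rev]
            congr 1
            ext1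
            rw [Units.val_mul, Units.val_mul, hc, comm]
          rw [mul_inv_rev, inv_inv, map_mul, ← mul_assoc h⁻¹, map_inv, hcom, ← mul_assoc,
            ← mul_assoc, mul_inv_cancel, one_mul]
        have h2 : (p : ℍ[ℚ_[p]]) ^ M1 * ((1 - (p : ℍ[ℚ_[p]]) ^ M2 * ((h⁻¹ : (ℍ[ℚ_[p]])ˣ) : ℍ[ℚ_[p]]) * w)
            * toLocal p a + (p : ℍ[ℚ_[p]]) ^ M2 * ((h⁻¹ : (ℍ[ℚ_[p]])ˣ) : ℍ[ℚ_[p]]) * toLocal p b) =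
            ((h⁻¹ : (ℍ[ℚ_[p]])ˣ) : ℍ[ℚ_[p]]) * toLocal p δ := by
          have hx' : toLocal p x = (p : ℍ[ℚ_[p]]) ^ M1 * (h : ℍ[ℚ_[p]]) - (p : ℍ[ℚ_[p]]) ^ N * w :=
            eq_sub_of_add_eq hxw.symm
          rw [hab, map_add, map_mul, map_mul, map_pow, map_natCast, hx']
          exact (quotient_identity (comm _ _) (comm _ _) (pow_add _ _ _) (Units.inv_mul h)).symm
        rw [← hc] at key h2
        exact (Units.mul_right_inj _).mp (key.trans h2.symm)
      rw [e]
      exact add_mem (mul_mem (sub_mem (one_mem _) (mul_mem (hM2 M2 le_rfl) hw)) (hO ha))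
        (mul_mem (hM2 M2 le_rfl) (hO hb))
  · rw [map_mul, map_inv]
    refine mul_mem (inv_mem ?_) ?_
    · refine toLocalUnits_mem_localUnits (hdvd hq M1) (δ := π ^ M1)
        (pow_mem (natCast_mem hurwitz p) M1) (one_mem _) ?_
      simp [π]
    · refine toLocalUnits_mem_localUnits (hdvd hq N) (δ := δ') hδ ht ?_
      rw [Nat.cast_pow, hyt]; rfl

/-! ### From one prime to all primes -/

theorem diag_apply (δ : (ℍ[ℚ])ˣ) (p : Nat.Primes) : diag δ p = toLocalUnits (p : ℕ) δ := rfl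

theorem diag_mul (δ ε : (ℍ[ℚ])ˣ) : diag (δ * ε) = diag δ * diag ε := by
  ext1 p
  rw [RestrictedProduct.mul_apply, diag_apply, diag_apply, diag_apply, map_mul]

theorem diag_one : diag 1 = 1 := by
  ext1 p
  rw [diag_apply, map_one, RestrictedProduct.one_apply]

theorem diag_inv (δ : (ℍ[ℚ])ˣ) : diag δ⁻¹ = (diag δ)⁻¹ :=
  eq_inv_of_mul_eq_one_left (by rw [← diag_mul, inv_mul_cancel, diag_one])

theorem mat5_mul (g h : Df) : mat5 (g * h) = mat5 g * mat5 h := by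
  simp [mat5, RestrictedProduct.mul_apply]

theorem mat5_one : mat5 1 = 1 := by
  simp [mat5, RestrictedProduct.one_apply]

theorem mat5_diag (δ : (ℍ[ℚ])ˣ) : mat5 (diag δ) = quatMat δ := rfl

theorem exists_global_generator (s : Finset Nat.Primes) (g : Df)
    (hg : ∀ p ∉ s, g p ∈ localUnits (p : ℕ)) :
    ∃ δ : (ℍ[ℚ])ˣ, ∀ p : Nat.Primes, (diag δ * g) p ∈ localUnits (p : ℕ) := by
  classical
  induction s using Finset.induction_on generalizing g with
  | empty => exact ⟨1, fun p => by rw [diag_one, one_mul]; exact hg p (by simp)⟩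
  | insert p s _ ih =>
    obtain ⟨δ, hδ, hδ'⟩ := exists_local_generator (p : ℕ) (g p)
    obtain ⟨ε, hε⟩ := ih (diag δ⁻¹ * g) fun q hq => by
      rw [RestrictedProduct.mul_apply, diag_apply, map_inv]
      by_cases hqp : q = p
      · subst hqp; exact hδ
      · exact mul_mem (inv_mem (hδ' q fun h => hqp (Subtype.ext h))) (hg q (by simp [hq, hqp]))
    exact ⟨ε * δ⁻¹, by rw [diag_mul, mul_assoc]; exact hε⟩

/-- The quaternion algebra has class number one. -/
theorem exists_diag_mul_mem_localUnits (g : Df) :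
    ∃ δ : (ℍ[ℚ])ˣ, ∀ p : Nat.Primes, (diag δ * g) p ∈ localUnits (p : ℕ) := by
  have h : {p : Nat.Primes | ¬ g p ∈ localUnits (p : ℕ)}.Finite := g.2
  exact exists_global_generator h.toFinset g fun p hp => by simpa using hp

/-! ### Integrality at five -/

theorem norm_two_five : ‖(2 : ℚ_[5])‖ = 1 := by
  have := (Padic.norm_natCast_eq_one_iff (p := 5) (n := 2)).mpr (by norm_num)
  simpa using this

theorem norm_nu_le : ‖nu‖ ≤ 1 := nuInt.2

theorem norm_add_le_one {x y : ℚ_[5]} (hx : ‖x‖ ≤ 1) (hy : ‖y‖ ≤ 1) : ‖x + y‖ ≤ 1 :=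
  (Padic.nonarchimedean x y).trans (max_le hx hy)

theorem norm_sub_le_one {x y : ℚ_[5]} (hx : ‖x‖ ≤ 1) (hy : ‖y‖ ≤ 1) : ‖x - y‖ ≤ 1 := by
  rw [sub_eq_add_neg]; exact norm_add_le_one hx (by rwa [norm_neg])

theorem norm_mul_le_one {x y : ℚ_[5]} (hx : ‖x‖ ≤ 1) (hy : ‖y‖ ≤ 1) : ‖x * y‖ ≤ 1 := by
  rw [norm_mul]; exact mul_le_one₀ hx (norm_nonneg _) hy

theorem norm_half_le_one {x : ℚ_[5]} (hx : ‖x‖ ≤ 1) : ‖x / 2‖ ≤ 1 := by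
  rwa [norm_div, norm_two_five, div_one]

/-- 2 is a unit at 5 and `ν` is integral, so the splitting and its inverse have integral
coefficients. -/
theorem mem_localOrder_five_iff {x : ℍ[ℚ_[5]]} :
    x ∈ localOrder 5 ↔ ∀ i j, ‖split x i j‖ ≤ 1 := by
  constructor
  · rintro ⟨a, b, c, d, rfl⟩
    have ha := norm_half_le_one a.2
    have hb := norm_add_le_one ha b.2
    have hc := norm_add_le_one ha c.2
    have hd := norm_add_le_one ha d.2
    have hc' := norm_mul_le_one norm_nu_le hc
    have hd' := norm_mul_le_one norm_nu_le hd
    intro i j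
    fin_cases i <;> fin_cases j
    · exact norm_add_le_one ha hc'
    · exact norm_sub_le_one hb hd'
    · exact norm_sub_le_one (by rw [← norm_neg] at hb; exact hb) hd'
    · exact norm_sub_le_one ha hc'
  · intro h
    have hn : ‖-nu‖ ≤ 1 := by simpa using norm_nu_le
    rw [← split.symm_apply_apply x]
    refine mem_localOrder_of_integral _ _ ?_ ?_ ?_ ?_
    · exact norm_half_le_one (norm_add_le_one (h 0 0) (h 1 1))
    · exact norm_half_le_one (norm_sub_le_one (h 0 1) (h 1 0))
    · exact norm_half_le_one (norm_mul_le_one hn (norm_sub_le_one (h 0 0) (h 1 1)))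
    · exact norm_half_le_one (norm_mul_le_one norm_nu_le (norm_add_le_one (h 0 1) (h 1 0)))

theorem norm_det_le_one {M : Matrix (Fin 2) (Fin 2) ℚ_[5]} (h : ∀ i j, ‖M i j‖ ≤ 1) :
    ‖M.det‖ ≤ 1 := by
  rw [Matrix.det_fin_two]
  exact norm_sub_le_one (norm_mul_le_one (h 0 0) (h 1 1)) (norm_mul_le_one (h 0 1) (h 1 0))

theorem mem_localUnits_five_iff {u : (ℍ[ℚ_[5]])ˣ} :
    u ∈ localUnits 5 ↔ IsGL2Z5 (split (u : ℍ[ℚ_[5]])) := by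
  have h1 : split (u : ℍ[ℚ_[5]]) * split ((u⁻¹ : (ℍ[ℚ_[5]])ˣ) : ℍ[ℚ_[5]]) = 1 := by
    rw [← map_mul, Units.mul_inv, map_one]
  rw [mem_localUnits_iff, mem_localOrder_five_iff, mem_localOrder_five_iff, IsGL2Z5]
  refine and_congr_right fun hu => ⟨fun hi => ?_, fun hd i j => ?_⟩
  · have hdet := congrArg (fun M => ‖Matrix.det M‖) h1
    simp only [Matrix.det_mul, norm_mul, Matrix.det_one, norm_one] at hdet
    have b1 := norm_det_le_one hu
    have b2 := norm_det_le_one hi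
    nlinarith [norm_nonneg (split (u : ℍ[ℚ_[5]])).det]
  · have hd0 : IsUnit (split (u : ℍ[ℚ_[5]])).det := by
      rw [isUnit_iff_ne_zero]; intro h; rw [h] at hd; simp at hd
    rw [← Matrix.inv_eq_right_inv h1, Matrix.inv_def, Ring.inverse_eq_inv', Matrix.smul_apply,
      smul_eq_mul, norm_mul, norm_inv, hd, inv_one, one_mul, Matrix.adjugate_fin_two]
    fin_cases i <;> fin_cases j
    · exact hu 1 1
    · simpa using hu 0 1
    · simpa using hu 1 0
    · exact hu 0 0

theorem mem_fullLevel_iff {u : Df} : u ∈ fullLevel ↔ ∀ p : Nat.Primes, u p ∈ localUnits (p : ℕ) := by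
  constructor
  · rintro ⟨h, h5⟩ p
    by_cases hp : p = five
    · subst hp; exact mem_localUnits_five_iff.mpr h5
    · exact h p hp
  · exact fun h => ⟨fun p _ => h p, mem_localUnits_five_iff.mp (h five)⟩

theorem mul_mem_fullLevel {u v : Df} (hu : u ∈ fullLevel) (hv : v ∈ fullLevel) :
    u * v ∈ fullLevel := by
  rw [mem_fullLevel_iff] at *
  exact fun p => mul_mem (hu p) (hv p)

theorem inv_mem_fullLevel {u : Df} (hu : u ∈ fullLevel) : u⁻¹ ∈ fullLevel := by
  rw [mem_fullLevel_iff] at *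
  exact fun p => inv_mem (hu p)

theorem exists_eq_diag_mul_fullLevel (g : Df) : ∃ δ : (ℍ[ℚ])ˣ, ∃ u ∈ fullLevel, g = diag δ * u := by
  obtain ⟨δ, hδ⟩ := exists_diag_mul_mem_localUnits g
  exact ⟨δ⁻¹, diag δ * g, mem_fullLevel_iff.mpr hδ, by rw [diag_inv, inv_mul_cancel_left]⟩

theorem gamma1Level_subset_fullLevel : gamma1Level ⊆ fullLevel := by
  rintro u ⟨h, h5⟩
  obtain ⟨h00, h01, h10, h11⟩ := h5
  have h11' : ‖mat5 u 1 1‖ = 1 := norm_eq_one_of_norm_sub_one_lt h11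
  refine ⟨h, fun i j => ?_, ?_⟩
  · fin_cases i <;> fin_cases j
    exacts [h00.le, h01, h10.le, h11'.le]
  · rw [Matrix.det_fin_two]
    have e1 : ‖mat5 u 0 0 * mat5 u 1 1‖ = 1 := by rw [norm_mul, h00, h11', one_mul]
    have e2 : ‖mat5 u 0 1 * mat5 u 1 0‖ < 1 := by
      rw [norm_mul]; nlinarith [norm_nonneg (mat5 u 0 1), norm_nonneg (mat5 u 1 0)]
    rw [sub_eq_add_neg, Padic.add_eq_max_of_ne (by rw [e1, norm_neg]; exact e2.ne'), norm_neg, e1,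
      max_eq_left e2.le]

/-! ### Hurwitz units -/

/-- The unit of the Hurwitz order defined by a quaternion of norm one. -/
def hurwitzUnit (x : ℍ[ℚ]) (h : Quaternion.normSq x = 1) : (ℍ[ℚ])ˣ :=
  ⟨x, star x, by rw [Quaternion.self_mul_star, h]; rfl, by rw [Quaternion.star_mul_self, h]; rfl⟩

theorem diag_hurwitzUnit_mem_fullLevel {x : ℍ[ℚ]} (hx : x ∈ hurwitz) (h : Quaternion.normSq x = 1) :
    diag (hurwitzUnit x h) ∈ fullLevel := by
  rw [mem_fullLevel_iff]
  intro p
  exact (mem_localUnits_iff (u := toLocalUnits (p : ℕ) (hurwitzUnit x h))).mpr ⟨toLocal_mem_localOrder _ hx,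
    toLocal_mem_localOrder _ (star_mem_hurwitz hx)⟩

theorem exists_int_of_norm_le_one {q : ℚ} (h : ∀ p : Nat.Primes, ‖(q : ℚ_[(p : ℕ)])‖ ≤ 1) :
    ∃ m : ℤ, q = m := by
  refine ⟨q.num, ?_⟩
  have : q.den = 1 := by
    by_contra hd
    obtain ⟨p, hp, hpd⟩ := Nat.exists_prime_and_dvd hd
    have := Fact.mk hp
    have h1 : ‖(q : ℚ_[p])‖ ≤ 1 := h ⟨p, hp⟩
    have h2 : ‖((q.num : ℤ) : ℚ_[p])‖ < 1 := by
      have e : ((q.num : ℤ) : ℚ_[p]) = (q : ℚ_[p]) * ((q.den : ℕ) : ℚ_[p]) := by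
        exact_mod_cast (Rat.mul_den_eq_num q).symm
      have h3 : ‖((q.den : ℕ) : ℚ_[p])‖ < 1 := (Padic.norm_natCast_lt_one_iff).mpr hpd
      rw [e, norm_mul]
      nlinarith [norm_nonneg (q : ℚ_[p]), norm_nonneg ((q.den : ℕ) : ℚ_[p])]
    have h4 : (p : ℤ) ∣ q.num := (Padic.norm_intCast_lt_one_iff).mp h2
    have := Nat.Coprime.eq_one_of_dvd (Nat.Coprime.coprime_dvd_left (Int.natCast_dvd.mp h4) q.reduced)
      hpd
    exact hp.one_lt.ne' this
  exact (Rat.coe_int_num_of_den_eq_one this).symm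

theorem mem_hurwitz_of_forall {x : ℍ[ℚ]} (h : ∀ p : Nat.Primes, toLocal (p : ℕ) x ∈ localOrder (p : ℕ)) :
    x ∈ hurwitz := by
  have key : ∀ p : Nat.Primes, ‖((2 * x.re : ℚ) : ℚ_[(p : ℕ)])‖ ≤ 1 ∧
      ‖((x.imI - x.re : ℚ) : ℚ_[(p : ℕ)])‖ ≤ 1 ∧ ‖((x.imJ - x.re : ℚ) : ℚ_[(p : ℕ)])‖ ≤ 1 ∧
      ‖((x.imK - x.re : ℚ) : ℚ_[(p : ℕ)])‖ ≤ 1 := by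
    intro p
    obtain ⟨a, b, c, d, e⟩ := h p
    have e0 := congrArg (fun z => z.re) e
    have e1 := congrArg (fun z => z.imI) e
    have e2 := congrArg (fun z => z.imJ) e
    have e3 := congrArg (fun z => z.imK) e
    simp only [toLocal, RingHom.coe_mk, MonoidHom.coe_mk, OneHom.coe_mk, quat_re, quat_imI, quat_imJ,
      quat_imK] at e0 e1 e2 e3
    push_cast
    refine ⟨?_, ?_, ?_, ?_⟩
    · rw [e0, mul_div_cancel₀ _ (two_ne_zero)]; exact a.2
    · rw [e0, e1, add_sub_cancel_left]; exact b.2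
    · rw [e0, e2, add_sub_cancel_left]; exact c.2
    · rw [e0, e3, add_sub_cancel_left]; exact d.2
  obtain ⟨a, ha⟩ := exists_int_of_norm_le_one fun p => (key p).1
  obtain ⟨b, hb⟩ := exists_int_of_norm_le_one fun p => (key p).2.1
  obtain ⟨c, hc⟩ := exists_int_of_norm_le_one fun p => (key p).2.2.1
  obtain ⟨d, hd⟩ := exists_int_of_norm_le_one fun p => (key p).2.2.2
  refine ⟨a, b, c, d, ?_⟩
  ext
  · simp; linarith
  · simp; linarith
  · simp; linarith
  · simp; linarith

/-- Both the element and its inverse are everywhere locally integral, hence Hurwitz; their norms are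
natural numbers with product 1. -/
theorem normSq_eq_one_of_mem_fullLevel {ε : (ℍ[ℚ])ˣ} (h : diag ε ∈ fullLevel) :
    (ε : ℍ[ℚ]) ∈ hurwitz ∧ Quaternion.normSq (ε : ℍ[ℚ]) = 1 := by
  have h' := fun p => mem_localUnits_iff.mp (mem_fullLevel_iff.mp h p)
  have h1 : (ε : ℍ[ℚ]) ∈ hurwitz := mem_hurwitz_of_forall fun p => (h' p).1
  have h2 : ((ε⁻¹ : (ℍ[ℚ])ˣ) : ℍ[ℚ]) ∈ hurwitz := mem_hurwitz_of_forall fun p => by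
    have := (h' p).2
    rwa [diag_apply, ← map_inv, coe_toLocalUnits] at this
  obtain ⟨m, hm⟩ := exists_normSq_eq_natCast h1
  obtain ⟨m', hm'⟩ := exists_normSq_eq_natCast h2
  have e : (m : ℚ) * m' = 1 := by
    rw [← hm, ← hm', ← map_mul, Units.mul_inv, map_one]
  have : m * m' = 1 := by exact_mod_cast e
  exact ⟨h1, by rw [hm, Nat.eq_one_of_mul_eq_one_right this, Nat.cast_one]⟩

/-! ### The twenty-four Hurwitz units -/

/-- The quaternion with the given doubled coordinates. -/
def halfQuat (t : ℤ × ℤ × ℤ × ℤ) : ℍ[ℚ] :=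
  quat ((t.1 : ℚ) / 2) ((t.2.1 : ℚ) / 2) ((t.2.2.1 : ℚ) / 2) ((t.2.2.2 : ℚ) / 2)

/-- Doubled coordinates of the Hurwitz units up to sign. -/
def unitListPos : List (ℤ × ℤ × ℤ × ℤ) :=
  [(2, 0, 0, 0), (0, 2, 0, 0), (0, 0, 2, 0), (0, 0, 0, 2), (1, 1, 1, 1), (-1, 1, -1, 1),
    (-1, 1, 1, -1), (-1, -1, 1, 1), (-1, 1, 1, 1), (-1, -1, -1, 1), (-1, 1, -1, -1), (-1, -1, 1, -1)]

/-- Doubled coordinates of the Hurwitz units. -/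
def unitList : List (ℤ × ℤ × ℤ × ℤ) :=
  unitListPos ++ unitListPos.map fun t => (-t.1, -t.2.1, -t.2.2.1, -t.2.2.2)

theorem halfQuat_neg (t : ℤ × ℤ × ℤ × ℤ) :
    halfQuat (-t.1, -t.2.1, -t.2.2.1, -t.2.2.2) = -halfQuat t := by
  ext <;> simp [halfQuat, neg_div]

theorem exists_unitList {x : ℍ[ℚ]} (hx : x ∈ hurwitz) (h : Quaternion.normSq x = 1) :
    ∃ t ∈ unitList, x = halfQuat t := by
  obtain ⟨a, b, c, d, rfl⟩ := hx
  refine ⟨(a, a + 2 * b, a + 2 * c, a + 2 * d), ?_, by ext <;> simp [halfQuat] <;> ring⟩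
  rw [normSq_quat] at h
  have e : a ^ 2 + (a + 2 * b) ^ 2 + (a + 2 * c) ^ 2 + (a + 2 * d) ^ 2 = 4 := by
    have : ((a ^ 2 + (a + 2 * b) ^ 2 + (a + 2 * c) ^ 2 + (a + 2 * d) ^ 2 : ℤ) : ℚ) = 4 := by
      push_cast; linear_combination 4 * h
    exact_mod_cast this
  have bd {y : ℤ} (hy : y ^ 2 ≤ 4) : -2 ≤ y ∧ y ≤ 2 := by constructor <;> nlinarith
  obtain ⟨h1, h2⟩ := bd (y := a) (by nlinarith [sq_nonneg (a + 2 * b), sq_nonneg (a + 2 * c), sq_nonneg (a + 2 * d)])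
  obtain ⟨h3, h4⟩ := bd (y := a + 2 * b) (by nlinarith [sq_nonneg a, sq_nonneg (a + 2 * c), sq_nonneg (a + 2 * d)])
  obtain ⟨h5, h6⟩ := bd (y := a + 2 * c) (by nlinarith [sq_nonneg (a + 2 * b), sq_nonneg a, sq_nonneg (a + 2 * d)])
  obtain ⟨h7, h8⟩ := bd (y := a + 2 * d) (by nlinarith [sq_nonneg (a + 2 * b), sq_nonneg (a + 2 * c), sq_nonneg a])
  interval_cases a <;>
  · have b1 : -2 ≤ b := by omega
    have b2 : b ≤ 2 := by omega
    have c1 : -2 ≤ c := by omega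
    have c2 : c ≤ 2 := by omega
    have d1 : -2 ≤ d := by omega
    have d2 : d ≤ 2 := by omega
    clear h bd
    interval_cases b <;> (first | omega | (interval_cases c <;> (first | omega | (interval_cases d <;>
      (first | omega | decide)))))

/-- Up to sign, each unit is one of `1, i, j, ij` times a power of `ω`, so multiplicative properties
need checking only on generators. -/
theorem halfQuat_induction {P : ℍ[ℚ] → Prop} (h1 : P 1) (hneg : ∀ x, P x → P (-x))
    (hI : ∀ x, P x → P (qI * x)) (hJ : ∀ x, P x → P (qJ * x)) (hW : ∀ x, P x → P (qW * x)) :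
    ∀ t ∈ unitList, P (halfQuat t) := by
  have hpos : ∀ t ∈ unitListPos, P (halfQuat t) := by
    have cong {x y : ℍ[ℚ]} (hx : P x) (e : y = x) : P y := e ▸ hx
    have w := hW _ h1
    have w2 := hW _ w
    simp only [unitListPos, List.forall_mem_cons, List.not_mem_nil, false_imp_iff, implies_true,
      and_true]
    refine ⟨cong h1 ?_, cong (hI _ h1) ?_, cong (hJ _ h1) ?_, cong (hI _ (hJ _ h1)) ?_, cong w ?_,
      cong (hI _ w) ?_, cong (hJ _ w) ?_, cong (hI _ (hJ _ w)) ?_, cong w2 ?_, cong (hI _ w2) ?_,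
      cong (hJ _ w2) ?_, cong (hI _ (hJ _ w2)) ?_⟩ <;>
    ext <;> simp [halfQuat, qI, qJ, qW] <;> norm_num
  intro t ht
  rcases List.mem_append.mp ht with ht | ht
  · exact hpos t ht
  · obtain ⟨s, hs, rfl⟩ := List.mem_map.mp ht
    rw [halfQuat_neg]
    exact hneg _ (hpos s hs)

theorem halfQuat_mem_hurwitz {t : ℤ × ℤ × ℤ × ℤ} (ht : t ∈ unitList) :
    halfQuat t ∈ hurwitz ∧ Quaternion.normSq (halfQuat t) = 1 := by
  have mul {x y : ℍ[ℚ]} (hx : x ∈ hurwitz ∧ Quaternion.normSq x = 1)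
      (hy : y ∈ hurwitz ∧ Quaternion.normSq y = 1) :
      x * y ∈ hurwitz ∧ Quaternion.normSq (x * y) = 1 :=
    ⟨mul_mem hx.1 hy.1, by rw [map_mul, hx.2, hy.2, one_mul]⟩
  refine halfQuat_induction (P := fun x => x ∈ hurwitz ∧ Quaternion.normSq x = 1)
    ⟨one_mem _, map_one _⟩ (fun x hx => ⟨neg_mem hx.1, by rw [Quaternion.normSq_neg, hx.2]⟩)
    (fun x => mul ⟨⟨0, 1, 0, 0, ?_⟩, ?_⟩) (fun x => mul ⟨⟨0, 0, 1, 0, ?_⟩, ?_⟩)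
    (fun x => mul ⟨⟨1, 0, 0, 0, ?_⟩, ?_⟩) t ht
  · ext <;> simp [qI]
  · rw [qI, normSq_quat]; norm_num
  · ext <;> simp [qJ]
  · rw [qJ, normSq_quat]; norm_num
  · ext <;> simp [qW]
  · rw [qW, normSq_quat]; norm_num

/-- Invariant polynomials are invariant under all Hurwitz units. -/
theorem polySlash_of_mem_fullLevel {x a : ℕ} {f : ℚ_[5]⟦X⟧} (hf : f ∈ invariantPart (2 * a + 4 * x) a)
    {ε : (ℍ[ℚ])ˣ} (h : diag ε ∈ fullLevel) :
    polySlash (2 * a + 4 * x) (quatMat ε) f = f := by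
  obtain ⟨h1, h2⟩ := normSq_eq_one_of_mem_fullLevel h
  obtain ⟨t, ht, e⟩ := exists_unitList h1 h2
  obtain ⟨hg, hI, hW⟩ := mem_invariantPart.mp hf
  have mul {u : ℍ[ℚ]} (hu : polySlash (2 * a + 4 * x) (quatMat u) f = f) (y : ℍ[ℚ])
      (hy : polySlash (2 * a + 4 * x) (quatMat y) f = f) :
      polySlash (2 * a + 4 * x) (quatMat (u * y)) f = f := by
    rw [← polySlash_quatMat_mul, hu, hy]
  rw [e]
  refine halfQuat_induction (P := fun y => polySlash (2 * a + 4 * x) (quatMat y) f = f) ?_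
    (fun y hy => ?_) (mul hI) (mul ?_) (mul hW) t ht
  · rw [map_one, polySlash_one hg.1]
  · rw [polySlash_quatMat_neg (even_weight x a), hy]
  · have := polySlash_qJ_mul hg 1
    rwa [mul_one, map_one, polySlash_one hg.1] at this

/-- Modulo 5, with `ν = 2`, the lower rows of the 24 units exhaust the 24 nonzero vectors of `𝔽₅²`.
The equations are doubled to match the doubled coordinates. -/
theorem exists_unitList_row :
    ∀ s t : ZMod 5, (s ≠ 0 ∨ t ≠ 0) → ∃ q ∈ unitList,
      -(q.2.1 : ZMod 5) - 2 * q.2.2.2 = 2 * s ∧ (q.1 : ZMod 5) - 2 * q.2.2.1 = 2 * t := by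
  decide

theorem norm_lt_one_iff_toZMod (x : ℤ_[5]) : ‖(x : ℚ_[5])‖ < 1 ↔ PadicInt.toZMod x = 0 := by
  rw [← RingHom.mem_ker, PadicInt.ker_toZMod, IsLocalRing.mem_maximalIdeal, PadicInt.mem_nonunits]; rfl

theorem toZMod_nuInt : PadicInt.toZMod nuInt = 2 := by
  obtain ⟨y, hy⟩ : (5 : ℤ_[5]) ∣ nuInt - 2 := exists_nu.choose_spec.2
  rw [eq_add_of_sub_eq hy, map_add, map_mul, map_ofNat, map_ofNat]
  have : (5 : ZMod 5) = 0 := rfl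
  rw [this]; ring

/-- A matrix in `GL₂(ℤ_5)` can be moved into `Iw_{5,1}` by a Hurwitz unit. -/
theorem exists_unit_mul_isIw51 {M : Matrix (Fin 2) (Fin 2) ℚ_[5]} (hM : IsGL2Z5 M) :
    ∃ t ∈ unitList, ‖(quatMat (halfQuat t) * M) 1 0‖ < 1 ∧
      ‖(quatMat (halfQuat t) * M) 1 1 - 1‖ < 1 := by
  obtain ⟨hbd, hdet⟩ := hM
  let m (i j : Fin 2) : ℤ_[5] := ⟨M i j, hbd i j⟩
  let z := PadicInt.toZMod (p := 5)
  have hm (i j : Fin 2) : M i j = (m i j : ℚ_[5]) := rfl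
  have hD : z (m 0 0) * z (m 1 1) - z (m 0 1) * z (m 1 0) ≠ 0 := by
    rw [← map_mul, ← map_mul, ← map_sub]
    intro h
    have := (norm_lt_one_iff_toZMod _).mpr h
    rw [Matrix.det_fin_two, hm, hm, hm, hm] at hdet
    push_cast at this
    linarith
  generalize hd : z (m 0 0) * z (m 1 1) - z (m 0 1) * z (m 1 0) = D at hD
  -- The required lower row is `(0, 1) M⁻¹ = (-m₁₀, m₀₀) / det M` modulo 5.
  obtain ⟨q, hq, hs, ht⟩ := exists_unitList_row (-(z (m 1 0)) * D⁻¹) (z (m 0 0) * D⁻¹) (by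
    by_contra! h
    have h1 := (mul_eq_zero.mp h.1).resolve_right (inv_ne_zero hD)
    have h2 := (mul_eq_zero.mp h.2).resolve_right (inv_ne_zero hD)
    rw [neg_eq_zero] at h1
    rw [h1, h2] at hd
    exact hD (by rw [← hd]; ring))
  have h2 (y : ℚ_[5]) : ‖2 * y‖ = ‖y‖ := by rw [norm_mul, norm_two_five, one_mul]
  have row (j : Fin 2) : 2 * (quatMat (halfQuat q) * M) 1 j =
      (((-(q.2.1 : ℤ_[5]) - nuInt * q.2.2.2) * m 0 j + (q.1 - nuInt * q.2.2.1) * m 1 j : ℤ_[5]) :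
        ℚ_[5]) := by
    rw [Matrix.mul_apply, Fin.sum_univ_two, hm, hm, quatMat_apply]
    simp only [halfQuat, quat_re, quat_imI, quat_imJ, quat_imK, Matrix.of_apply, Matrix.cons_val',
      Matrix.cons_val_zero, Matrix.cons_val_one, Matrix.cons_val_fin_one]
    push_cast
    rw [nu]
    ring
  refine ⟨q, hq, ?_, ?_⟩
  · rw [← h2, row, norm_lt_one_iff_toZMod]
    simp only [map_add, map_mul, map_sub, map_neg, map_intCast, toZMod_nuInt]
    rw [hs, ht]
    change 2 * (-z (m 1 0) * D⁻¹) * z (m 0 0) + 2 * (z (m 0 0) * D⁻¹) * z (m 1 0) = 0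
    ring
  · rw [← h2, mul_sub, row, mul_one, ← padicInt_coe_two, ← PadicInt.coe_sub, norm_lt_one_iff_toZMod]
    simp only [map_add, map_mul, map_sub, map_neg, map_intCast, toZMod_nuInt, map_ofNat]
    rw [hs, ht]
    change 2 * (-z (m 1 0) * D⁻¹) * z (m 0 1) + 2 * (z (m 0 0) * D⁻¹) * z (m 1 1) - 2 = 0
    linear_combination 2 * D⁻¹ * hd + 2 * (inv_mul_cancel₀ hD)

theorem mem_gamma1Level_of_fullLevel {u : Df} (hu : u ∈ fullLevel) (h0 : ‖mat5 u 1 0‖ < 1)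
    (h1 : ‖mat5 u 1 1 - 1‖ < 1) : u ∈ gamma1Level := by
  obtain ⟨h, hbd, hdet⟩ := hu
  refine ⟨h, ?_, hbd 0 1, h0, h1⟩
  have h11 : ‖mat5 u 1 1‖ = 1 := norm_eq_one_of_norm_sub_one_lt h1
  have e2 : ‖mat5 u 0 1 * mat5 u 1 0‖ < 1 := by
    rw [norm_mul]; nlinarith [norm_nonneg (mat5 u 0 1), norm_nonneg (mat5 u 1 0), hbd 0 1]
  rw [Matrix.det_fin_two] at hdet
  refine le_antisymm (hbd 0 0) ?_
  by_contra! hlt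
  have e1 : ‖mat5 u 0 0 * mat5 u 1 1‖ < 1 := by rwa [norm_mul, h11, mul_one]
  have := (Padic.nonarchimedean (mat5 u 0 0 * mat5 u 1 1) (-(mat5 u 0 1 * mat5 u 1 0))).trans_lt
    (max_lt e1 (by rwa [norm_neg]))
  rw [← sub_eq_add_neg, hdet] at this
  exact lt_irrefl _ this

theorem exists_eq_diag_mul_gamma1Level (g : Df) :
    ∃ δ : (ℍ[ℚ])ˣ, ∃ u ∈ gamma1Level, g = diag δ * u := by
  obtain ⟨δ, u, hu, rfl⟩ := exists_eq_diag_mul_fullLevel g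
  obtain ⟨t, ht, hrow⟩ := exists_unit_mul_isIw51 hu.2
  obtain ⟨h1, h2⟩ := halfQuat_mem_hurwitz ht
  refine ⟨δ * (hurwitzUnit _ h2)⁻¹, diag (hurwitzUnit _ h2) * u,
    mem_gamma1Level_of_fullLevel (mul_mem_fullLevel (diag_hurwitzUnit_mem_fullLevel h1 h2) hu) ?_ ?_,
    by rw [diag_mul, diag_inv, mul_assoc, inv_mul_cancel_left]⟩
  · rw [mat5_mul]; exact hrow.1
  · rw [mat5_mul]; exact hrow.2

/-! ### The operator `U_5` in terms of global quaternions -/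

/-- From `7² = -1 + 50` one gets `(ν - 7)(ν + 7) = -50`, and `ν + 7` is a unit because `ν ≡ 2`
modulo 5. Two digits of precision suffice for all later congruences. -/
theorem exists_nu_eq : ∃ h : ℚ_[5], ‖h‖ ≤ 1 ∧ nu = 7 + 50 * h := by
  have hs := nu_sq
  have h5 := norm_five
  have h9 : ‖nu + 7‖ = 1 := by
    have e : ‖nu - 2‖ < 1 := by
      have := (norm_lt_one_iff_toZMod (nuInt - 2)).mpr (by
        rw [map_sub, toZMod_nuInt, map_ofNat]; rfl)
      rwa [PadicInt.coe_sub, padicInt_coe_two] at this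
    have e9 : ‖(9 : ℚ_[5])‖ = 1 := by
      have := (Padic.norm_natCast_eq_one_iff (p := 5) (n := 9)).mpr (by norm_num)
      simpa using this
    rw [show nu + 7 = (nu - 2) + 9 by ring, Padic.add_eq_max_of_ne (by rw [e9]; exact e.ne), e9,
      max_eq_right e.le]
  have hne : nu + 7 ≠ 0 := by intro h; rw [h] at h9; simp at h9
  refine ⟨-(nu + 7)⁻¹, by rw [norm_neg, norm_inv, h9, inv_one], ?_⟩
  field_simp
  linear_combination hs

theorem norm_five_mul_add_le {y : ℚ_[5]} (hy : ‖y‖ ≤ 1) (m m' : ℤ) : ‖5 * ((m : ℚ_[5]) + m' * y)‖ ≤ 5⁻¹ := by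
  rw [norm_mul, norm_five]
  have := norm_add_le_one (Padic.norm_int_le_one (p := 5) m)
    (norm_mul_le_one (Padic.norm_int_le_one (p := 5) m') hy)
  linarith [norm_nonneg ((m : ℚ_[5]) + m' * y)]

theorem norm_five_mul_add_lt {y : ℚ_[5]} (hy : ‖y‖ ≤ 1) (m m' : ℤ) : ‖5 * ((m : ℚ_[5]) + m' * y)‖ < 1 :=
  (norm_five_mul_add_le hy m m').trans_lt (by norm_num)

theorem quatMat_heckeQuat {h : ℚ_[5]} (hh : nu = 7 + 50 * h) (s : Fin 5) :
    quatMat (heckeQuat s) = ![!![5 + 50 * h, 0; 0, -9 - 50 * h],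
      !![-10 - 75 * h, 2 + 25 * h; 5 + 25 * h, 11 + 75 * h],
      !![-10 - 75 * h, 11 + 75 * h; 10 + 75 * h, 11 + 75 * h],
      !![-10 - 75 * h, -11 - 75 * h; -10 - 75 * h, 11 + 75 * h],
      !![-10 - 75 * h, -2 - 25 * h; -5 - 25 * h, 11 + 75 * h]] s := by
  rw [quatMat_apply, hh]
  ext i j
  fin_cases s <;> fin_cases i <;> fin_cases j <;> simp [heckeQuat] <;> ring

/-- The constants `ζ` are `0, ν, 1, -1, -ν` in this order: all five roots of `ζ^5 = ζ`. -/
theorem isHeckeMatrix_heckeQuat (s : Fin 5) : IsHeckeMatrix (quatMat (heckeQuat s)) := by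
  obtain ⟨h, hh, hnu⟩ := exists_nu_eq
  have hb (m m' : ℤ) := norm_five_mul_add_le hh m m'
  have e4 := nu_pow_four
  have e2 := nu_sq
  rw [IsHeckeMatrix, quatMat_heckeQuat hnu]
  fin_cases s
  · refine ⟨?_, by simp, ?_, 0, by simp, by simp, by simp⟩
    · convert hb 1 10 using 2; simp; ring
    · convert hb (-2) (-10) using 2; simp; ring
  · refine ⟨?_, ?_, ?_, nu, norm_nu_le, by linear_combination nu * e4, ?_⟩
    · convert hb (-2) (-15) using 2; simp; ring
    · convert hb 1 5 using 2; simp; ring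
    · convert hb 2 15 using 2; simp; ring
    · simp; rw [hnu] at e2 ⊢; linear_combination (-3 / 2) * e2
  · refine ⟨?_, ?_, ?_, 1, by simp, by simp, by simp⟩
    · convert hb (-2) (-15) using 2; simp; ring
    · convert hb 2 15 using 2; simp; ring
    · convert hb 2 15 using 2; simp; ring
  · refine ⟨?_, ?_, ?_, -1, by simp, by ring, by simp; ring⟩
    · convert hb (-2) (-15) using 2; simp; ring
    · convert hb (-2) (-15) using 2; simp; ring
    · convert hb 2 15 using 2; simp; ring
  · refine ⟨?_, ?_, ?_, -nu, by simpa using norm_nu_le, by linear_combination (-nu) * e4, ?_⟩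
    · convert hb (-2) (-15) using 2; simp; ring
    · convert hb (-1) (-5) using 2; simp; ring
    · convert hb 2 15 using 2; simp; ring
    · simp; rw [hnu] at e2 ⊢; linear_combination (3 / 2) * e2

theorem heckeQuat_mem_hurwitz (s : Fin 5) :
    heckeQuat s ∈ hurwitz ∧ Quaternion.normSq (heckeQuat s) = 5 := by
  fin_cases s
  · refine ⟨⟨-4, 2, 3, 2, ?_⟩, ?_⟩
    · ext <;> simp [heckeQuat] <;> norm_num
    · simp [heckeQuat, normSq_quat]; norm_num
  · refine ⟨⟨1, -2, -2, -1, ?_⟩, ?_⟩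
    · ext <;> simp [heckeQuat] <;> norm_num
    · simp [heckeQuat, normSq_quat]; norm_num
  · refine ⟨⟨1, 0, -2, -2, ?_⟩, ?_⟩
    · ext <;> simp [heckeQuat] <;> norm_num
    · simp [heckeQuat, normSq_quat]; norm_num
  · refine ⟨⟨1, -1, -2, 1, ?_⟩, ?_⟩
    · ext <;> simp [heckeQuat] <;> norm_num
    · simp [heckeQuat, normSq_quat]; norm_num
  · refine ⟨⟨1, 1, -2, 0, ?_⟩, ?_⟩
    · ext <;> simp [heckeQuat] <;> norm_num
    · simp [heckeQuat, normSq_quat]; norm_num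

/-- The quaternions describing `U_5`, as elements of `Dˣ`. -/
def heckeUnit (s : Fin 5) : (ℍ[ℚ])ˣ := Units.mk0 (heckeQuat s) fun h => by
  have := (heckeQuat_mem_hurwitz s).2
  rw [h] at this; simp at this

theorem single_apply_of_ne {p q : Nat.Primes} (h : q ≠ p) (u : (ℍ[ℚ_[(p : ℕ)]])ˣ) :
    single p u q = 1 := Function.update_of_ne h _ _

theorem single_apply_self (p : Nat.Primes) (u : (ℍ[ℚ_[(p : ℕ)]])ˣ) : single p u p = u :=
  Function.update_self _ _ _

theorem mat5_at5 (M : GL (Fin 2) ℚ_[5]) : mat5 (at5 M) = M := by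
  rw [mat5, at5, single_apply_self]
  exact split.apply_symm_apply _

theorem mat5_inv (g : Df) : mat5 g⁻¹ * mat5 g = 1 := by
  rw [← mat5_mul, inv_mul_cancel, mat5_one]

theorem coe_vMat (i : ℕ) : (vMat i : Matrix (Fin 2) (Fin 2) ℚ_[5]) = !![5, 0; 5 * (i : ℚ_[5]), 1] := rfl

theorem mat5_at5_vMat_inv (i : ℕ) : mat5 (at5 (vMat i))⁻¹ = !![5⁻¹, 0; -(i : ℚ_[5]), 1] := by
  refine left_inv_eq_right_inv (mat5_inv _) ?_
  rw [mat5_at5, coe_vMat, Matrix.mul_fin_two, Matrix.one_fin_two]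
  simp
  ring

/-- A Hurwitz quaternion of norm 5 is a local unit away from 5. At 5 the quaternions are chosen so
that removing `v_s` on the right leaves a matrix in `Iw_{5,1}`. -/
theorem heckeUnit_mul_mem_gamma1Level (s : Fin 5) :
    diag (heckeUnit s) * (at5 (vMat s))⁻¹ ∈ gamma1Level := by
  refine ⟨fun p hp => ?_, ?_⟩
  · rw [RestrictedProduct.mul_apply, RestrictedProduct.inv_apply, at5, single_apply_of_ne hp, inv_one,
      mul_one]
    obtain ⟨h1, h2⟩ := heckeQuat_mem_hurwitz s
    refine toLocalUnits_mem_localUnits (m := 5) (fun h => hp (Subtype.ext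
      ((Nat.prime_dvd_prime_iff_eq p.2 (by norm_num)).mp h))) h1 (star_mem_hurwitz h1) ?_
    rw [show ((heckeUnit s : (ℍ[ℚ])ˣ) : ℍ[ℚ]) = heckeQuat s from rfl, Quaternion.self_mul_star, h2]
    rfl
  · obtain ⟨h, hh, hnu⟩ := exists_nu_eq
    have hb (m m' : ℤ) := norm_five_mul_add_lt hh m m'
    have hi (m m' : ℤ) : ‖(m : ℚ_[5]) + m' * h‖ ≤ 1 :=
      norm_add_le_one (Padic.norm_int_le_one (p := 5) m)
        (norm_mul_le_one (Padic.norm_int_le_one (p := 5) m') hh)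
    rw [mat5_mul, mat5_diag, mat5_at5_vMat_inv, show ((heckeUnit s : (ℍ[ℚ])ˣ) : ℍ[ℚ]) = heckeQuat s
      from rfl, quatMat_heckeQuat hnu]
    fin_cases s
    · refine ⟨norm_eq_one_of_norm_sub_one_lt ?_, ?_, ?_, ?_⟩
      · convert hb 0 2 using 2; simp; ring
      · simp
      · simp
      · convert hb (-2) (-10) using 2; simp; ring
    · refine ⟨norm_eq_one_of_norm_sub_one_lt ?_, ?_, ?_, ?_⟩
      · convert hb (-1) (-8) using 2; simp; ring
      · convert hi 2 25 using 2; simp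
      · convert hb (-2) (-14) using 2; simp; ring
      · convert hb 2 15 using 2; simp; ring
    · refine ⟨norm_eq_one_of_norm_sub_one_lt ?_, ?_, ?_, ?_⟩
      · convert hb (-5) (-33) using 2; simp; ring
      · convert hi 11 75 using 2; simp
      · convert hb (-4) (-27) using 2; simp; ring
      · convert hb 2 15 using 2; simp; ring
    · refine ⟨norm_eq_one_of_norm_sub_one_lt ?_, ?_, ?_, ?_⟩
      · convert hb 6 42 using 2; simp; ring
      · convert hi (-11) (-75) using 2; simp; ring
      · convert hb (-7) (-48) using 2; simp; ring
      · convert hb 2 15 using 2; simp; ring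
    · refine ⟨norm_eq_one_of_norm_sub_one_lt ?_, ?_, ?_, ?_⟩
      · convert hb 1 17 using 2; simp; ring
      · convert hi (-2) (-25) using 2; simp; ring
      · convert hb (-9) (-61) using 2; simp; ring
      · convert hb 2 15 using 2; simp; ring

/-- Write `δ` for the global quaternion. Left invariance gives `φ(v⁻¹) = φ(δ v⁻¹) = φ(1) ‖ (δ v⁻¹)`,
since `δ v⁻¹` lies in the level; acting by `v` leaves `φ(1) ‖ δ`. The argument uses only `φ(1)`, so
the form chosen in `basisForm` is irrelevant. -/
theorem heckeEntry_eq {k : ℤ} {j : ℕ}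
    (h : ∃ φ, IsOverconvergentForm k φ ∧ φ 1 = PowerSeries.X ^ j) (i : ℕ) :
    heckeEntry k i j =
      ∑ s : Fin 5, PowerSeries.coeff i (slash k (quatMat (heckeQuat s)) (PowerSeries.X ^ j)) := by
  have hφ : basisForm k j = h.choose := by rw [basisForm, dif_pos h]
  obtain ⟨⟨-, hD, hU⟩, h1⟩ := h.choose_spec
  rw [heckeEntry, hφ, heckeU5, Finset.sum_range, map_sum]
  refine Finset.sum_congr rfl fun s _ => ?_
  congr 1
  have hmem := heckeUnit_mul_mem_gamma1Level s
  have e : h.choose (1 * (at5 (vMat s))⁻¹) =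
      slash k (mat5 (diag (heckeUnit s) * (at5 (vMat s))⁻¹)) (PowerSeries.X ^ j) := by
    have hu := hU 1 _ hmem
    rw [h1, one_mul] at hu
    rw [one_mul, ← hD (heckeUnit s), hu]
  rw [e, coe_vMat, slash_slash_X_pow]
  · rw [← coe_vMat, ← mat5_at5, mat5_mul, mul_assoc, mat5_inv, mul_one]; rfl
  · have := norm_eq_one_of_norm_sub_one_lt hmem.2.2.2.2
    rw [← norm_pos_iff, this]; exact one_pos
  · exact one_ne_zero

theorem slash_zero_series (k : ℤ) (γ : Matrix (Fin 2) (Fin 2) ℚ_[5]) : slash k γ 0 = 0 := by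
  ext i
  simp [slash]

theorem heckeEntry_eq_zero {k : ℤ} {j : ℕ}
    (h : ¬ ∃ φ, IsOverconvergentForm k φ ∧ φ 1 = PowerSeries.X ^ j) (i : ℕ) :
    heckeEntry k i j = 0 := by
  rw [heckeEntry, basisForm, dif_neg h, heckeU5]
  simp [slash_zero_series]

/-- Either the matrix of `U_5` is given by global quaternions, or its determinant vanishes. -/
theorem det_heckeMinor (n : ℕ) (k : ℤ) (a : ℕ) :
    (heckeMinor n k a).det = 0 ∨
      heckeMinor n k a = slashMinor (fun s => quatMat (heckeQuat s)) n k a := by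
  -- If some form were missing, `basisForm` would default to 0 and give a zero column, so existence
  -- of the forms need not be proved.
  by_cases h : ∀ j : Fin n, ∃ φ, IsOverconvergentForm k φ ∧
      φ 1 = PowerSeries.X ^ (4 * (j : ℕ) + a)
  · right
    ext i j
    exact heckeEntry_eq (h j) _
  · left
    push Not at h
    obtain ⟨j, hj⟩ := h
    exact Matrix.det_eq_zero_of_column_eq_zero j fun i =>
      heckeEntry_eq_zero (by push Not; exact hj) _

/-! ### Dimensions of spaces of classical forms -/

/-- The prime `2`. -/
abbrev two : Nat.Primes := ⟨2, Nat.prime_two⟩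

/-- The quaternion `1 + j` as an element of `Dˣ`. -/
def unifUnit : (ℍ[ℚ])ˣ where
  val := qP
  inv := quat (1 / 2) 0 (-1 / 2) 0
  val_inv := by ext <;> simp [qP] <;> norm_num
  inv_val := by ext <;> simp [qP] <;> norm_num

theorem toLocalUnits_unifUnit : toLocalUnits 2 unifUnit = unif2 := by
  ext1
  rw [coe_toLocalUnits]
  ext <;> simp [toLocal, unif2, unifUnit, qP]

theorem toLocalUnits_unifUnit_mem {p : Nat.Primes} (hp : p ≠ two) :
    toLocalUnits (p : ℕ) unifUnit ∈ localUnits (p : ℕ) := by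
  have h1 : qP ∈ hurwitz := ⟨2, -1, 0, -1, by ext <;> simp [qP]⟩
  refine toLocalUnits_mem_localUnits (m := 2) (fun h => hp (Subtype.ext
    ((Nat.prime_dvd_prime_iff_eq p.2 Nat.prime_two).mp h))) h1 (star_mem_hurwitz h1) ?_
  rw [show (unifUnit : ℍ[ℚ]) = qP from rfl, natCast_eq_quat]
  ext <;> simp [qP]; norm_num

theorem conj_unif2_mem {x : ℍ[ℚ_[2]]} (hx : x ∈ localOrder 2) :
    ((unif2⁻¹ : (ℍ[ℚ_[2]])ˣ) : ℍ[ℚ_[2]]) * (x * unif2) ∈ localOrder 2 := by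
  obtain ⟨a, b, c, d, rfl⟩ := hx
  rw [show ((unif2⁻¹ : (ℍ[ℚ_[2]])ˣ) : ℍ[ℚ_[2]]) = quat (1 / 2) 0 (-1 / 2) 0 from rfl,
    show (unif2 : ℍ[ℚ_[2]]) = quat 1 0 1 0 from rfl]
  refine ⟨a, -a - d, c, b, ?_⟩
  ext <;> simp <;> ring

theorem conj_unif2_mem_localUnits {u : (ℍ[ℚ_[2]])ˣ} (hu : u ∈ localUnits 2) :
    unif2⁻¹ * (u * unif2) ∈ localUnits 2 := by
  rw [mem_localUnits_iff] at hu ⊢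
  refine ⟨conj_unif2_mem hu.1, ?_⟩
  rw [mul_inv_rev, mul_inv_rev, inv_inv, mul_assoc]
  exact conj_unif2_mem hu.2

theorem diag_inv_mul_single_mem {u : Df} (hu : u ∈ fullLevel) :
    diag unifUnit⁻¹ * (u * single two unif2) ∈ fullLevel := by
  rw [mem_fullLevel_iff] at hu ⊢
  intro p
  rw [RestrictedProduct.mul_apply, RestrictedProduct.mul_apply, diag_apply, map_inv]
  by_cases hp : p = two
  · subst hp
    rw [single_apply_self]
    change (toLocalUnits 2 unifUnit)⁻¹ * _ ∈ localUnits 2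
    rw [toLocalUnits_unifUnit]
    exact conj_unif2_mem_localUnits (hu two)
  · rw [single_apply_of_ne hp, mul_one]
    exact mul_mem (inv_mem (toLocalUnits_unifUnit_mem hp)) (hu p)

theorem mat5_single_two (u : (ℍ[ℚ_[2]])ˣ) : mat5 (single two u) = 1 := by
  have h : five ≠ two := fun h => by have := congrArg Subtype.val h; simp at this
  rw [mat5, single_apply_of_ne h, Units.val_one, map_one]

/-- `(1 - ν)(-1 - ν)/2 = -1` and `ν(-ν) = 1`: for even degree, the eigenvalue of `1 + j` on
polynomials is inverse to that of `U_2`. -/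
theorem eigenvalue_mul {N : ℕ} (hN : Even N) (a : ℕ) : ((1 - nu) ^ N * nu ^ a) *
    (((-1 - nu) / 2) ^ N * (-nu) ^ a) = 1 := by
  have h2 := nu_sq
  have h1 : (1 - nu) * ((-1 - nu) / 2) = -1 := by linear_combination (1 / 2) * h2
  have h3 : nu * (-nu) = 1 := by linear_combination -h2
  rw [mul_mul_mul_comm, ← mul_pow, ← mul_pow, h1, h3, hN.neg_one_pow, one_pow, one_mul]

theorem polySlash_quatMat_inv_cancel (N : ℕ) (f : ℚ_[5]⟦X⟧) (δ : (ℍ[ℚ])ˣ)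
    (hf : f ∈ polyDeg N) :
    polySlash N (quatMat δ) (polySlash N (quatMat ((δ⁻¹ : (ℍ[ℚ])ˣ) : ℍ[ℚ])) f) = f := by
  rw [polySlash_quatMat_mul, Units.inv_mul, map_one, polySlash_one hf]

/-- The sign is forced by the level at 5: the lower right entry `(-1 - ν)/2` is congruent to 1
modulo 5, whereas the other sign would give `-1`. -/
theorem neg_unifUnit_inv_mul_single_mem :
    diag (-unifUnit)⁻¹ * single two unif2 ∈ gamma1Level := by
  have hfull : diag (-unifUnit)⁻¹ * single two unif2 ∈ fullLevel := by
    have h1 : (-1 : ℍ[ℚ]) ∈ hurwitz := neg_mem (one_mem _)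
    have h2 : Quaternion.normSq (-1 : ℍ[ℚ]) = 1 := by rw [Quaternion.normSq_neg, map_one]
    have e : diag (-unifUnit)⁻¹ * single two unif2 =
        diag (hurwitzUnit _ h2) * (diag unifUnit⁻¹ * (1 * single two unif2)) := by
      rw [one_mul, ← mul_assoc, ← diag_mul]
      congr 2
      ext1
      rw [inv_neg, Units.val_mul, Units.val_neg]
      exact (neg_one_mul _).symm
    rw [e]
    refine mul_mem_fullLevel (diag_hurwitzUnit_mem_fullLevel h1 h2) (diag_inv_mul_single_mem ?_)
    rw [mem_fullLevel_iff]
    exact fun p => one_mem _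
  have hmat : mat5 (diag (-unifUnit)⁻¹ * single two unif2) =
      !![(-1 + nu) / 2, 0; 0, (-1 - nu) / 2] := by
    rw [mat5_mul, mat5_single_two, mul_one, mat5_diag]
    have e : ((((-unifUnit)⁻¹ : (ℍ[ℚ])ˣ)) : ℍ[ℚ]) = quat (-1 / 2) 0 (1 / 2) 0 := by
      rw [inv_neg, Units.val_neg, show ((unifUnit⁻¹ : (ℍ[ℚ])ˣ) : ℍ[ℚ]) = quat (1 / 2) 0 (-1 / 2) 0
        from rfl]
      ext <;> simp; norm_num; norm_num
    rw [e, quatMat_apply]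
    ext i j
    fin_cases i <;> fin_cases j <;> simp <;> ring
  obtain ⟨h, hh, hnu⟩ := exists_nu_eq
  refine mem_gamma1Level_of_fullLevel hfull (by rw [hmat]; simp) ?_
  rw [hmat, hnu]
  convert norm_five_mul_add_lt hh (-1) (-5) using 2
  simp; ring

section

variable {x a N : ℕ}

/-- The uniformizer at 2 is the global element `-(1 + j)` times an element of the level, so `U_2`
acts on `φ(1)` through the inverse of `1 + j`. -/
theorem eval_one_mem_gradedPart (hN : Even N) {φ : Df → ℚ_[5]⟦X⟧}
    (hφ : φ ∈ classicalPart (N + 2) a gamma1Level) :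
    φ 1 ∈ gradedPart N a := by
  obtain ⟨⟨h1, h2, h3⟩, h4⟩ := hφ
  have hf : φ 1 ∈ polyDeg N := isPolyOfWeight_iff.mp (h1 1)
  rw [mem_gradedPart_iff hf]
  have h5 : φ (single two unif2) = (((-1 - nu) / 2) ^ N * (-nu) ^ a) • φ 1 := by
    have := congrFun (Module.End.mem_eigenspace_iff.mp h4) 1
    rw [← one_mul (single two unif2)]
    exact this
  have h6 := h3 1 _ neg_unifUnit_inv_mul_single_mem
  rw [one_mul, h2, h5, slash_eq_polySlash _ hf, mat5_mul, mat5_single_two, mul_one, mat5_diag] at h6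
  have h7 := congrArg (polySlash N (quatMat ((-unifUnit : (ℍ[ℚ])ˣ) : ℍ[ℚ]))) h6
  rw [polySlash_quatMat_inv_cancel _ _ _ hf, map_smul, Units.val_neg,
    polySlash_quatMat_neg hN] at h7
  change _ • polySlash N (quatMat qP) (φ 1) = _ at h7
  conv_rhs => rw [← h7]
  rw [smul_smul, eigenvalue_mul hN, one_smul]

/-- Evaluation of classical forms at `1`. -/
def evalOne {N : ℕ} (hN : Even N) (a : ℕ) : classicalPart (N + 2) a gamma1Level →ₗ[ℚ_[5]]
    gradedPart N a where
  toFun φ := ⟨(φ : Df → ℚ_[5]⟦X⟧) 1, eval_one_mem_gradedPart hN φ.2⟩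
  map_add' _ _ := rfl
  map_smul' _ _ := rfl

theorem evalOne_injective (hN : Even N) : Function.Injective (evalOne hN a) := by
  rw [← LinearMap.ker_eq_bot, LinearMap.ker_eq_bot']
  rintro ⟨φ, hφ⟩ h
  have h1 : φ 1 = 0 := congrArg Subtype.val h
  ext1
  funext g
  obtain ⟨δ, u, hu, rfl⟩ := exists_eq_diag_mul_gamma1Level g
  change φ (diag δ * u) = 0
  rw [hφ.1.2.1, ← one_mul u, hφ.1.2.2 1 u hu, h1, slash_zero]

theorem finrank_gradedPart_le (ha : a < 4) :
    Module.finrank ℚ_[5] (gradedPart (2 * a + 4 * x) a) ≤ x + 1 := by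
  let c : gradedPart (2 * a + 4 * x) a →ₗ[ℚ_[5]] (Fin (x + 1) → ℚ_[5]) :=
    (LinearMap.pi fun i : Fin (x + 1) => PowerSeries.coeff (4 * (i : ℕ) + a)).comp
      (Submodule.subtype _)
  have hc : Function.Injective c := by
    rw [← LinearMap.ker_eq_bot, LinearMap.ker_eq_bot']
    rintro ⟨f, hf⟩ h
    ext n
    change PowerSeries.coeff n f = 0
    by_cases hn : n % 4 = a % 4
    · by_cases hN : n ≤ 2 * a + 4 * x
      · have := congrFun h ⟨(n - a) / 4, by omega⟩
        have e : 4 * ((n - a) / 4) + a = n := by omega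
        simpa [c, e] using this
      · exact hf.1 n (by omega)
    · exact hf.2 n hn
  simpa using LinearMap.finrank_le_finrank_of_injective hc

theorem dIw_le (ha : a < 4) : dIw (2 * a + 4 * x + 2) a ≤ x + 1 :=
  (LinearMap.finrank_le_finrank_of_injective (evalOne_injective (even_weight x a))).trans
    (finrank_gradedPart_le ha)

theorem dIw_eq_zero (hN : Even N) (h : N < a) (ha : a < 4) : dIw (N + 2) a = 0 := by
  have hbot : gradedPart N a = ⊥ := by
    rw [eq_bot_iff]
    rintro f ⟨h1, h2⟩
    refine (Submodule.mem_bot _).mpr (PowerSeries.ext fun n => ?_)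
    by_cases hn : n ≤ N
    · exact h2 n (by omega)
    · exact h1 n (by omega)
  have := LinearMap.finrank_le_finrank_of_injective (evalOne_injective (a := a) hN)
  rw [hbot, finrank_bot] at this
  exact Nat.le_zero.mp this

instance : FiniteDimensional ℚ_[5] (classicalPart (2 * a + 4 * x + 2) a gamma1Level) :=
  Module.Finite.of_injective (evalOne (even_weight x a) a) (evalOne_injective _)

theorem classicalPart_mono {k a : ℕ} {U V : Set Df} (h : U ⊆ V) :
    classicalPart k a V ≤ classicalPart k a U :=
  fun _ hφ => ⟨⟨hφ.1.1, hφ.1.2.1, fun g u hu => hφ.1.2.2 g u (h hu)⟩, hφ.2⟩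

instance : FiniteDimensional ℚ_[5] (classicalPart (2 * a + 4 * x + 2) a fullLevel) :=
  Submodule.finiteDimensional_of_le (classicalPart_mono gamma1Level_subset_fullLevel)

/-- The component in `fullLevel` of an element of `D_fˣ`. -/
def levelPart (g : Df) : Df := (exists_eq_diag_mul_fullLevel g).choose_spec.choose

/-- The classical form of full level with a given value at `1`. -/
def invariantForm (N : ℕ) : ℚ_[5]⟦X⟧ →ₗ[ℚ_[5]] (Df → ℚ_[5]⟦X⟧) :=
  LinearMap.pi fun g => polySlash N (mat5 (levelPart g))

/-- Two decompositions of the same idele differ by a global element of the full level, a Hurwitz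
unit, which fixes `f`; so the chosen decomposition does not matter. -/
theorem invariantForm_apply {f : ℚ_[5]⟦X⟧} (hf : f ∈ invariantPart (2 * a + 4 * x) a) (δ : (ℍ[ℚ])ˣ)
    {u : Df} (hu : u ∈ fullLevel) :
    invariantForm (2 * a + 4 * x) f (diag δ * u) = polySlash (2 * a + 4 * x) (mat5 u) f := by
  obtain ⟨hv, he⟩ := (exists_eq_diag_mul_fullLevel (diag δ * u)).choose_spec.choose_spec
  set ε := (exists_eq_diag_mul_fullLevel (diag δ * u)).choose
  change levelPart (diag δ * u) ∈ fullLevel at hv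
  change diag δ * u = diag ε * levelPart (diag δ * u) at he
  change polySlash _ (mat5 (levelPart (diag δ * u))) f = _
  generalize levelPart (diag δ * u) = v at hv he
  have e : v = diag (ε⁻¹ * δ) * u := by
    rw [diag_mul, mul_assoc, he, diag_inv, inv_mul_cancel_left]
  have hmem : diag (ε⁻¹ * δ) ∈ fullLevel := by
    have := mul_mem_fullLevel hv (inv_mem_fullLevel hu)
    rwa [e, mul_inv_cancel_right] at this
  rw [e, mat5_mul, ← polySlash_comp, mat5_diag, polySlash_of_mem_fullLevel hf hmem]

theorem invariantForm_mem {f : ℚ_[5]⟦X⟧} (hf : f ∈ invariantPart (2 * a + 4 * x) a) :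
    invariantForm (2 * a + 4 * x) f ∈ classicalPart (2 * a + 4 * x + 2) a fullLevel := by
  refine ⟨⟨fun g => isPolyOfWeight_iff.mpr (polySlash_mem _ _ _), fun δ g => ?_, fun g u hu => ?_⟩, ?_⟩
  · obtain ⟨ε, v, hv, rfl⟩ := exists_eq_diag_mul_fullLevel g
    rw [← mul_assoc, ← diag_mul, invariantForm_apply hf _ hv, invariantForm_apply hf _ hv]
  · obtain ⟨ε, v, hv, rfl⟩ := exists_eq_diag_mul_fullLevel g
    rw [mul_assoc, invariantForm_apply hf _ (mul_mem_fullLevel hv hu), invariantForm_apply hf _ hv,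
      slash_eq_polySlash _ (polySlash_mem _ _ _), polySlash_comp, mat5_mul]
  · refine Module.End.mem_eigenspace_iff.mpr ?_
    funext g
    obtain ⟨ε, v, hv, rfl⟩ := exists_eq_diag_mul_fullLevel g
    have hg := (mem_invariantPart.mp hf).1
    change invariantForm (2 * a + 4 * x) f (diag ε * v * single two unif2) =
      (((-1 - nu) / 2) ^ (2 * a + 4 * x) * (-nu) ^ a) • invariantForm (2 * a + 4 * x) f (diag ε * v)
    have e : diag ε * v * single two unif2 =
        diag (ε * unifUnit) * (diag unifUnit⁻¹ * (v * single two unif2)) := by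
      rw [diag_mul, diag_inv]; group
    rw [e, invariantForm_apply hf _ (diag_inv_mul_single_mem hv), invariantForm_apply hf _ hv,
      mat5_mul, mat5_mul, mat5_single_two, mul_one, mat5_diag, ← polySlash_comp, ← map_smul]
    congr 1
    have h1 := (mem_gradedPart_iff hg.1).mp hg
    have h2 := congrArg (polySlash (2 * a + 4 * x) (quatMat ((unifUnit⁻¹ : (ℍ[ℚ])ˣ) : ℍ[ℚ]))) h1
    have h3 : polySlash (2 * a + 4 * x) (quatMat ((unifUnit⁻¹ : (ℍ[ℚ])ˣ) : ℍ[ℚ]))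
        (polySlash (2 * a + 4 * x) (quatMat qP) f) = f := by
      rw [polySlash_quatMat_mul, show qP * ((unifUnit⁻¹ : (ℍ[ℚ])ˣ) : ℍ[ℚ]) = 1 from unifUnit.val_inv,
        map_one, polySlash_one hg.1]
    rw [h3, map_smul] at h2
    conv_rhs => rw [h2]
    rw [smul_smul, (mul_comm _ _).trans (eigenvalue_mul (even_weight x a) a), one_smul]

/-- An invariant polynomial extends to a form of full level and is recovered as its value at 1. -/
theorem finrank_invariantPart_le_dUnr :
    Module.finrank ℚ_[5] (invariantPart (2 * a + 4 * x) a) ≤ dUnr (2 * a + 4 * x + 2) a := by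
  let Φ : invariantPart (2 * a + 4 * x) a →ₗ[ℚ_[5]] classicalPart (2 * a + 4 * x + 2) a fullLevel :=
    (invariantForm (2 * a + 4 * x)).restrict fun _ => invariantForm_mem
  refine LinearMap.finrank_le_finrank_of_injective (f := Φ) ?_
  rw [← LinearMap.ker_eq_bot, LinearMap.ker_eq_bot']
  rintro ⟨f, hf⟩ h
  have h1 : invariantForm (2 * a + 4 * x) f = 0 := congrArg Subtype.val h
  have h2 := congrFun h1 (diag 1 * 1)
  rw [invariantForm_apply hf 1 (mem_fullLevel_iff.mpr fun p => one_mem _), mat5_one,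
    polySlash_one (mem_invariantPart.mp hf).1.1] at h2
  exact Subtype.ext h2

end

/-! ### Invariant polynomials -/

/-- Simultaneous eigenvectors: `f` has degree at most `N`, exponents `≡ e` modulo `4`, and is
invariant under the Hurwitz units. -/
def IsInvariant (N e : ℕ) (f : ℚ_[5]⟦X⟧) : Prop :=
  f ∈ polyDeg N ∧ polySlash N (quatMat qP) f = ((1 - nu) ^ N * nu ^ e) • f ∧
    polySlash N (quatMat qI) f = f ∧ polySlash N (quatMat qW) f = f

theorem IsInvariant.mul {N N' e e' : ℕ} {f g : ℚ_[5]⟦X⟧} (hf : IsInvariant N e f)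
    (hg : IsInvariant N' e' g) : IsInvariant (N + N') (e + e') (f * g) := by
  obtain ⟨h1, h2, h3, h4⟩ := hf
  obtain ⟨h1', h2', h3', h4'⟩ := hg
  refine ⟨mul_mem_polyDeg h1 h1', ?_, ?_, ?_⟩
  · rw [polySlash_mul _ h1 h1', h2, h2', smul_mul_smul_comm]
    congr 1; ring
  · rw [polySlash_mul _ h1 h1', h3, h3']
  · rw [polySlash_mul _ h1 h1', h4, h4']

theorem IsInvariant.pow {N e : ℕ} {f : ℚ_[5]⟦X⟧} (hf : IsInvariant N e f) (m : ℕ) :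
    IsInvariant (N * m) (e * m) (f ^ m) := by
  induction m with
  | zero =>
    have h1 : (1 : ℚ_[5]⟦X⟧) ∈ polyDeg 0 := fun n hn => by
      rw [PowerSeries.coeff_one, if_neg (by omega)]
    have h (γ : Matrix (Fin 2) (Fin 2) ℚ_[5]) : polySlash 0 γ 1 = 1 := by
      simpa using polySlash_X_pow (N := 0) (n := 0) le_rfl γ
    simp only [mul_zero, pow_zero]
    exact ⟨h1, by rw [h]; simp, h _, h _⟩
  | succ m ih => rw [pow_succ, mul_add, mul_add, mul_one, mul_one]; exact ih.mul hf

/-- The invariant form of degree `6`. -/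
def invT : ℚ_[5]⟦X⟧ := PowerSeries.X ^ 5 - PowerSeries.X ^ 1
/-- The invariant form of degree `8`. -/
def invW : ℚ_[5]⟦X⟧ := PowerSeries.X ^ 8 + (14 : ℚ_[5]) • PowerSeries.X ^ 4 + PowerSeries.X ^ 0
/-- The invariant form of degree `12`. -/
def invX : ℚ_[5]⟦X⟧ := PowerSeries.X ^ 12 - (33 : ℚ_[5]) • PowerSeries.X ^ 8 -
  (33 : ℚ_[5]) • PowerSeries.X ^ 4 + PowerSeries.X ^ 0

theorem quatMat_qI : quatMat qI = !![0, 1; -1, 0] := by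
  rw [quatMat_apply]; simp [qI]

theorem quatMat_qW :
    quatMat qW = !![(1 + nu) / 2, (1 - nu) / 2; -((1 + nu) / 2), (1 - nu) / 2] := by
  rw [quatMat_apply]
  ext i j
  fin_cases i <;> fin_cases j <;> simp [qW] <;> ring

theorem smul_ofNat_series (m : ℕ) [m.AtLeastTwo] (f : ℚ_[5]⟦X⟧) :
    (OfNat.ofNat m : ℚ_[5]) • f = (OfNat.ofNat m : ℚ_[5]⟦X⟧) * f := by
  rw [PowerSeries.smul_eq_C_mul, map_ofNat]

/-- With `A = (1 + ν)/2` and `B = (1 - ν)/2`, invariance under `ω` becomes a polynomial identity in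
`X`, `A`, `B` modulo `4A⁴ = 4B⁴ = -1` and `2AB = 1`. -/
theorem exists_qW_series : ∃ A B : ℚ_[5]⟦X⟧, 4 * A ^ 4 = -1 ∧ 4 * B ^ 4 = -1 ∧ 2 * A * B = 1 ∧
    linSeries ((1 + nu) / 2) ((1 - nu) / 2) = B + A * PowerSeries.X ∧
    linSeries (-((1 + nu) / 2)) ((1 - nu) / 2) = B - A * PowerSeries.X := by
  have h2 := nu_sq
  refine ⟨PowerSeries.C ((1 + nu) / 2), PowerSeries.C ((1 - nu) / 2), ?_, ?_, ?_, rfl, ?_⟩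
  · rw [← map_pow, ← map_ofNat (PowerSeries.C (R := ℚ_[5])), ← map_mul, ← map_one PowerSeries.C,
      ← map_neg]
    congr 1
    linear_combination (nu ^ 2 / 4 + nu + 5 / 4) * h2
  · rw [← map_pow, ← map_ofNat (PowerSeries.C (R := ℚ_[5])), ← map_mul, ← map_one PowerSeries.C,
      ← map_neg]
    congr 1
    linear_combination (nu ^ 2 / 4 - nu + 5 / 4) * h2
  · rw [← map_ofNat (PowerSeries.C (R := ℚ_[5])), ← map_mul, ← map_mul, ← map_one PowerSeries.C]
    congr 1
    linear_combination (-1 / 2) * h2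
  · rw [linSeries, map_neg]; ring

theorem linSeries_zero_one : linSeries 0 1 = 1 := by simp [linSeries]

theorem linSeries_neg_one_zero : linSeries (-1) 0 = -PowerSeries.X := by simp [linSeries]

theorem isInvariant_invT : IsInvariant 6 1 invT := by
  have hg : invT ∈ gradedPart 6 1 :=
    sub_mem (X_pow_mem_gradedPart (by norm_num) rfl) (X_pow_mem_gradedPart (by norm_num) rfl)
  refine ⟨hg.1, (mem_gradedPart_iff hg.1).mp hg, ?_, ?_⟩
  · rw [invT, map_sub, polySlash_X_pow (by norm_num), polySlash_X_pow (by norm_num), quatMat_qI]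
    simp [linSeries_zero_one, linSeries_neg_one_zero]
    ring
  · obtain ⟨A, B, hA, hB, hAB, h1, h2⟩ := exists_qW_series
    rw [invT, map_sub, polySlash_X_pow (by norm_num), polySlash_X_pow (by norm_num), quatMat_qW]
    simp only [Matrix.of_apply, Matrix.cons_val', Matrix.cons_val_zero, Matrix.cons_val_one,
      Matrix.cons_val_fin_one, h1, h2, Nat.reduceSub]
    linear_combination (PowerSeries.X * (4 * B ^ 4) - PowerSeries.X ^ 5 * (4 * A ^ 4)) * hAB +
      PowerSeries.X * hB - PowerSeries.X ^ 5 * hA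

theorem isInvariant_invW : IsInvariant 8 0 invW := by
  have hg : invW ∈ gradedPart 8 0 :=
    add_mem (add_mem (X_pow_mem_gradedPart (by norm_num) rfl)
      (Submodule.smul_mem _ _ (X_pow_mem_gradedPart (by norm_num) rfl)))
      (X_pow_mem_gradedPart (by norm_num) rfl)
  refine ⟨hg.1, (mem_gradedPart_iff hg.1).mp hg, ?_, ?_⟩
  · rw [invW, map_add, map_add, map_smul, polySlash_X_pow (by norm_num),
      polySlash_X_pow (by norm_num), polySlash_X_pow (by norm_num), quatMat_qI, smul_ofNat_series,
      smul_ofNat_series]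
    simp [linSeries_zero_one, linSeries_neg_one_zero]
    ring
  · obtain ⟨A, B, hA, hB, hAB, h1, h2⟩ := exists_qW_series
    rw [invW, map_add, map_add, map_smul, polySlash_X_pow (by norm_num),
      polySlash_X_pow (by norm_num), polySlash_X_pow (by norm_num), quatMat_qW, smul_ofNat_series,
      smul_ofNat_series]
    simp only [Matrix.of_apply, Matrix.cons_val', Matrix.cons_val_zero, Matrix.cons_val_one,
      Matrix.cons_val_fin_one, h1, h2, Nat.reduceSub]
    linear_combination PowerSeries.X ^ 8 * (4 * A ^ 4 - 1) * hA +
      14 * PowerSeries.X ^ 4 * (4 * B ^ 4 * hA - hB) + (4 * B ^ 4 - 1) * hB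

theorem isInvariant_invX : IsInvariant 12 0 invX := by
  have hg : invX ∈ gradedPart 12 0 :=
    add_mem (sub_mem (sub_mem (X_pow_mem_gradedPart (by norm_num) rfl)
      (Submodule.smul_mem _ _ (X_pow_mem_gradedPart (by norm_num) rfl)))
      (Submodule.smul_mem _ _ (X_pow_mem_gradedPart (by norm_num) rfl)))
      (X_pow_mem_gradedPart (by norm_num) rfl)
  refine ⟨hg.1, (mem_gradedPart_iff hg.1).mp hg, ?_, ?_⟩
  · rw [invX, map_add, map_sub, map_sub, map_smul, map_smul, polySlash_X_pow (by norm_num),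
      polySlash_X_pow (by norm_num), polySlash_X_pow (by norm_num), polySlash_X_pow (by norm_num),
      quatMat_qI, smul_ofNat_series, smul_ofNat_series, smul_ofNat_series, smul_ofNat_series]
    simp [linSeries_zero_one, linSeries_neg_one_zero]
    ring
  · obtain ⟨A, B, hA, hB, hAB, h1, h2⟩ := exists_qW_series
    rw [invX, map_add, map_sub, map_sub, map_smul, map_smul, polySlash_X_pow (by norm_num),
      polySlash_X_pow (by norm_num), polySlash_X_pow (by norm_num), polySlash_X_pow (by norm_num),
      quatMat_qW, smul_ofNat_series, smul_ofNat_series, smul_ofNat_series, smul_ofNat_series]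
    simp only [Matrix.of_apply, Matrix.cons_val', Matrix.cons_val_zero,
      Matrix.cons_val_one, Matrix.cons_val_fin_one, h1, h2, Nat.reduceSub]
    linear_combination -PowerSeries.X ^ 12 * (16 * A ^ 8 - 4 * A ^ 4 + 1) * hA +
      33 * PowerSeries.X ^ 8 * (4 * B ^ 4 * (4 * A ^ 4 - 1) * hA + hB) +
      33 * PowerSeries.X ^ 4 * (4 * A ^ 4 * (4 * B ^ 4 - 1) * hB + hA) -
      (16 * B ^ 8 - 4 * B ^ 4 + 1) * hB

theorem linearIndependent_X_pow_mul {d : ℕ} (m : ℕ → ℕ) (hm : StrictMono m)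
    (G F : Fin d → ℚ_[5]⟦X⟧) (hG : ∀ i, PowerSeries.constantCoeff (G i) ≠ 0)
    (hF : ∀ i : Fin d, F i = PowerSeries.X ^ m i * G i) : LinearIndependent ℚ_[5] F := by
  rw [Fintype.linearIndependent_iff]
  intro c hc i
  induction i using WellFoundedLT.induction with
  | ind i ih =>
  have h := congrArg (PowerSeries.coeff (m i)) hc
  rw [map_sum, Finset.sum_eq_single i, PowerSeries.coeff_smul, hF, PowerSeries.coeff_X_pow_mul',
    if_pos le_rfl, Nat.sub_self, map_zero] at h
  · exact (mul_eq_zero.mp h).resolve_right (by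
      rw [PowerSeries.coeff_zero_eq_constantCoeff_apply]; exact hG i)
  · intro j _ hj
    rcases lt_or_gt_of_ne hj with hlt | hgt
    · rw [ih j hlt, zero_smul, map_zero]
    · rw [PowerSeries.coeff_smul, hF, PowerSeries.coeff_X_pow_mul', if_neg (not_le.mpr (hm hgt)),
        smul_zero]
  · intro h; exact absurd (Finset.mem_univ i) h

/-- `invT ^ 4` and `invW ^ 3` both have degree 24, so exchanging one for the other gives `q / 3 + 1`
invariants of the same degree. They are independent because their orders of vanishing at 0, which
are `a + 4i`, differ. -/
theorem le_finrank_invariantPart (a g q : ℕ) :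
    q / 3 + 1 ≤ Module.finrank ℚ_[5] (invariantPart (2 * a + 4 * (a + 3 * g + 2 * q)) a) := by
  let F (i : ℕ) : ℚ_[5]⟦X⟧ := invT ^ (a + 4 * i) * invW ^ (q - 3 * i) * invX ^ g
  have hF (i : Fin (q / 3 + 1)) : F i ∈ invariantPart (2 * a + 4 * (a + 3 * g + 2 * q)) a := by
    have h := ((isInvariant_invT.pow (a + 4 * i)).mul (isInvariant_invW.pow (q - 3 * i))).mul
      (isInvariant_invX.pow g)
    have e : 6 * (a + 4 * (i : ℕ)) + 8 * (q - 3 * i) + 12 * g =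
      2 * a + 4 * (a + 3 * g + 2 * q) := by have := i.2; omega
    rw [e] at h
    obtain ⟨h1, h2, h3, h4⟩ := h
    refine mem_invariantPart.mpr ⟨(mem_gradedPart_iff h1).mpr ?_, h3, h4⟩
    rw [h2]
    congr 2
    rw [show 1 * (a + 4 * (i : ℕ)) + 0 * (q - 3 * i) + 0 * g = 4 * i + a by ring, pow_add, pow_mul,
      nu_pow_four, one_pow, one_mul]
  have hT : invT = PowerSeries.X * (PowerSeries.X ^ 4 - 1) := by rw [invT]; ring
  have hli : LinearIndependent ℚ_[5] fun i : Fin (q / 3 + 1) => F i :=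
    linearIndependent_X_pow_mul (fun i => a + 4 * i) (fun i j h => by simpa using h)
      (fun i => (PowerSeries.X ^ 4 - 1) ^ (a + 4 * (i : ℕ)) * invW ^ (q - 3 * i) * invX ^ g) _
      (fun i => by simp [invW, invX])
      (fun i => by simp only [F]; rw [hT, mul_pow]; ring)
  have hli' : LinearIndependent ℚ_[5] fun i : Fin (q / 3 + 1) =>
      (⟨F i, hF i⟩ : invariantPart (2 * a + 4 * (a + 3 * g + 2 * q)) a) :=
    LinearIndependent.of_comp (Submodule.subtype _) hli
  simpa using hli'.fintype_card_le_finrank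

/-! ### Counting ghost multiplicities -/

/-- The dimension of the space of invariants in weight `2a + 4x + 2`. -/
def invDim (a x : ℕ) : ℕ := (x + 6 - a - 3 * ((x + a) % 2)) / 6

theorem invDim_le_dUnr (a x : ℕ) : invDim a x ≤ dUnr (2 * a + 4 * x + 2) a := by
  by_cases hx : a + 3 * ((x + a) % 2) ≤ x
  -- `x = a + 3g + 2q` with `g` the parity of `x + a`, so that `invX` is used at most once.
  · have h := (le_finrank_invariantPart a ((x + a) % 2) ((x - a - 3 * ((x + a) % 2)) / 2)).trans
      finrank_invariantPart_le_dUnr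
    rw [show a + 3 * ((x + a) % 2) + 2 * ((x - a - 3 * ((x + a) % 2)) / 2) = x by omega] at h
    refine le_trans ?_ h
    rw [invDim]; omega
  · have : invDim a x = 0 := by rw [invDim]; omega
    omega

/-- An upper bound for the ghost multiplicity in weight `2a + 4x + 2`. -/
def multBound (a n x : ℕ) : ℕ := min n (x + 1 - n) - invDim a x

theorem ghostMult_le (n a x : ℕ) (ha : a < 4) :
    ghostMult n a (2 * a + 4 * x + 2) ≤ multBound a n x := by
  have h1 := dIw_le (x := x) ha
  have h2 := invDim_le_dUnr a x
  rw [ghostMult, multBound]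
  split_ifs <;> omega

/-- Ghost multiplicity plus the rank bound is at most `n`: the corank accounts for the whole
multiplicity. -/
theorem ghostMult_add_le (n a x : ℕ) (ha : a < 4) :
    n ≤ x ∧ ghostMult n a (2 * a + 4 * x + 2) + (dUnr (2 * a + 4 * x + 2) a + (2 * n - (x + 1))) ≤ n ∨
      ghostMult n a (2 * a + 4 * x + 2) = 0 := by
  have h1 := dIw_le (x := x) ha
  rw [ghostMult]
  split_ifs <;> omega

/-- Weights at which the multiplicity grows. -/
def growSet (a n : ℕ) : Finset ℕ := insert (6 * n + a + 1) (Finset.Ico (2 * n + 1) (6 * n + a))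

/-- Weights at which the multiplicity drops. -/
def dropSet (a n : ℕ) : Finset ℕ :=
  if (n + 5 - a) % 5 = 1 then Finset.Ico (n + (n - a) / 5) (2 * n)
  else Finset.Ico (n + (n + 5 - a) / 5) (2 * n)

theorem of_mem_dropSet {a n x : ℕ} (ha : a < 4) (hx : x ∈ dropSet a n) :
    n ≤ x ∧ x < 2 * n ∧ n + invDim a x ≤ x := by
  rw [dropSet] at hx
  rw [invDim]
  split_ifs at hx with h
  · rw [Finset.mem_Ico] at hx
    obtain ⟨w, hw⟩ : ∃ w, n = 5 * w + 1 + a := ⟨(n - a) / 5, by omega⟩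
    obtain ⟨y, rfl⟩ : ∃ y, x = n + w + y := ⟨x - (n + w), by omega⟩
    subst hw
    refine ⟨by omega, by omega, ?_⟩
    -- At the left endpoint `x + a` is odd, which lowers `invDim` to `w`; this is why the interval
    -- may start one weight earlier in this residue class.
    rcases Nat.eq_zero_or_pos y with rfl | hy <;> omega
  · rw [Finset.mem_Ico] at hx
    omega

/-- From `x = 6n + a` on, `invDim` exceeds `n`, except at `x = 6n + a + 1`, where the parity
correction lowers it to `n`. -/
theorem of_not_mem_growSet {a n x : ℕ} (ha : a < 4) (hx : x ∉ growSet a n) :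
    x ≤ 2 * n ∨ n < invDim a x := by
  simp only [growSet, Finset.mem_insert, Finset.mem_Ico] at hx
  rw [invDim]
  omega

/-- Passing from `n` to `n + 1`, the minimum of `n` and `x + 1 - n` rises by 1 for `x > 2n`, is
unchanged at `x = 2n` and falls by 1 for `n ≤ x < 2n`. The two sets select weights where truncated
subtraction of `invDim` does not hide the change. -/
theorem multBound_succ_le (a n x : ℕ) (ha : a < 4) :
    multBound a (n + 1) x + (if x ∈ dropSet a n then 1 else 0) ≤
      multBound a n x + (if x ∈ growSet a n then 1 else 0) := by
  rw [multBound, multBound]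
  split_ifs with h1 h2 h2
  · have := of_mem_dropSet ha h1; omega
  · have := of_mem_dropSet ha h1; omega
  · omega
  · have := of_not_mem_growSet ha h2; omega

theorem card_growSet_le (a n : ℕ) : (growSet a n).card ≤ 4 * n + a - 1 + 1 := by
  refine (Finset.card_insert_le _ _).trans ?_
  rw [Nat.card_Ico]; omega

theorem sum_multBound_succ_le (a n X : ℕ) (ha : a < 4) (hX : 2 * n ≤ X) :
    ∑ x ∈ Finset.range X, multBound a (n + 1) x + (dropSet a n).card ≤
      ∑ x ∈ Finset.range X, multBound a n x + (4 * n + a - 1 + 1) := by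
  have h := Finset.sum_le_sum fun x (_ : x ∈ Finset.range X) => multBound_succ_le a n x ha
  rw [Finset.sum_add_distrib, Finset.sum_add_distrib, ← Finset.card_filter, ← Finset.card_filter] at h
  have h1 : (dropSet a n).card ≤ ((Finset.range X).filter (· ∈ dropSet a n)).card := by
    refine Finset.card_le_card fun x hx => Finset.mem_filter.mpr ⟨?_, hx⟩
    rw [dropSet] at hx
    split_ifs at hx <;> simp only [Finset.mem_Ico, Finset.mem_range] at * <;> omega
  have h2 : ((Finset.range X).filter (· ∈ growSet a n)).card ≤ 4 * n + a - 1 + 1 :=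
    (Finset.card_le_card fun x hx => (Finset.mem_filter.mp hx).2).trans (card_growSet_le a n)
  omega

/-- The bound for the determinant of the matrix of `U_5`. -/
def detBound (a n : ℕ) : ℕ := ∑ i ∈ Finset.range n, (4 * i + a - (4 * i + a) / 5)

/-- The excess 1 arises when `n ≡ a` modulo 5. It is repaid at the next step, where `dropSet` has
its extra element. -/
theorem sum_multBound_le (a n X : ℕ) (ha : a < 4) (hX : 2 * n ≤ X) :
    ∑ x ∈ Finset.range X, multBound a (n + 1) x ≤
      detBound a (n + 1) + if (4 * n + a) % 5 = 0 then 1 else 0 := by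
  induction n with
  | zero =>
    have h := sum_multBound_succ_le a 0 X ha hX
    have h0 : ∑ x ∈ Finset.range X, multBound a 0 x = 0 := by simp [multBound]
    rw [h0] at h
    simp only [detBound, Finset.sum_range_succ, Finset.sum_range_zero]
    split_ifs <;> omega
  | succ n ih =>
    have h := sum_multBound_succ_le a (n + 1) X ha hX
    have ih := ih (by omega)
    rw [detBound, Finset.sum_range_succ, ← detBound]
    rw [dropSet] at h
    generalize ∑ x ∈ Finset.range X, multBound a (n + 1) x = s at *
    generalize ∑ x ∈ Finset.range X, multBound a (n + 1 + 1) x = t at *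
    generalize detBound a (n + 1) = r at *
    split_ifs at h ih ⊢ <;> rw [Nat.card_Ico] at h <;> omega

theorem sum_ghostMult_le (a n X : ℕ) (ha : a < 4) :
    ∑ x ∈ Finset.range X, ghostMult n a (2 * a + 4 * x + 2) ≤ detBound a n + 1 := by
  cases n with
  | zero => simp [ghostMult]
  | succ n =>
    refine (Finset.sum_le_sum fun x _ => ghostMult_le (n + 1) a x ha).trans ?_
    refine (Finset.sum_le_sum_of_subset (Finset.range_mono (Nat.le_add_right X (2 * n)))).trans ?_
    refine (sum_multBound_le a n _ ha (by omega)).trans ?_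
    split_ifs <;> omega

theorem ghostMult_eq_zero (n a x : ℕ) (ha : a < 4) (hx : 6 * n + a + 3 ≤ x) :
    ghostMult n a (2 * a + 4 * x + 2) = 0 := by
  have h := ghostMult_le n a x ha
  rw [multBound, invDim] at h
  omega

/-- A column `J` divisible by 5 has 4 to spare, since its shift is 4 instead of 0. The map `i ↦ 5i +
a` sends each row penalised by `-4` to such a column, because `4(5i + a) + a = 5(4i + a)`. -/
theorem detBound_le_sum_shifts (a n : ℕ) : (detBound a n : ℤ) ≤
    ∑ i : Fin n, (if 5 * (4 * (i : ℕ) + a) ≤ 4 * (n - 1) + a then (-4 : ℤ) else 0) +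
      ∑ j : Fin n, (4 * ((4 * (j : ℕ) + a) / 5 : ℕ) + colShift (4 * (j : ℕ) + a) : ℤ) := by
  rw [Finset.sum_fin_eq_sum_range, Finset.sum_fin_eq_sum_range, detBound]
  set A := (Finset.range n).filter fun i => 5 * (4 * i + a) ≤ 4 * (n - 1) + a
  set B := (Finset.range n).filter fun j => (4 * j + a) % 5 = 0
  have hAB : A.card ≤ B.card := by
    refine Finset.card_le_card_of_injOn (fun i => 5 * i + a) (fun i hi => ?_)
      fun i _ j _ h => by simpa using h
    simp only [A, B, Finset.coe_filter, Finset.mem_range, Set.mem_ofPred_eq] at hi ⊢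
    omega
  have h1 : ∑ i ∈ Finset.range n, (if h : i < n then
      if 5 * (4 * ((⟨i, h⟩ : Fin n) : ℕ) + a) ≤ 4 * (n - 1) + a then (-4 : ℤ) else 0 else 0) =
      -4 * A.card := by
    rw [Finset.card_filter, Nat.cast_sum, Finset.mul_sum]
    refine Finset.sum_congr rfl fun i hi => ?_
    rw [dif_pos (Finset.mem_range.mp hi)]
    split_ifs <;> simp
  have h2 : ∑ j ∈ Finset.range n, (if h : j < n then
      (4 * ((4 * ((⟨j, h⟩ : Fin n) : ℕ) + a) / 5 : ℕ) +
        colShift (4 * ((⟨j, h⟩ : Fin n) : ℕ) + a) : ℤ) else 0) =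
      ((∑ i ∈ Finset.range n, (4 * i + a - (4 * i + a) / 5) : ℕ) : ℤ) + 4 * B.card := by
    rw [Finset.card_filter, Nat.cast_sum, Nat.cast_sum, Finset.mul_sum, ← Finset.sum_add_distrib]
    refine Finset.sum_congr rfl fun j hj => ?_
    rw [dif_pos (Finset.mem_range.mp hj)]
    simp only [colShift]
    split_ifs <;> push_cast <;> omega
  rw [h1, h2]
  omega

/-! ### Divisibility by the ghost coefficient -/

theorem padicInt_dvd_of_norm_le {x y : ℤ_[5]} (h : ‖y‖ ≤ ‖x‖) : x ∣ y := by
  by_cases hx : x = 0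
  · rw [hx, norm_zero] at h
    rw [hx, zero_dvd_iff]; exact norm_le_zero_iff.mp h
  · have hx' : (x : ℚ_[5]) ≠ 0 := fun h => hx (PadicInt.coe_eq_zero.mp h)
    refine ⟨⟨(y : ℚ_[5]) / x, ?_⟩, ?_⟩
    · rw [norm_div]
      exact div_le_one_of_le₀ h (norm_nonneg _)
    · exact Subtype.ext (mul_div_cancel₀ (y : ℚ_[5]) hx').symm

/-- Weights below `2a + 2` contribute nothing because the Iwahori dimension vanishes, and for `x ≥
6n + a + 3` the multiplicity is zero. -/
theorem ghostCoeff_eq (n a : ℕ) (ha : a < 4) : ghostCoeff n a =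
    ∏ x ∈ Finset.range (6 * n + a + 3),
      (Polynomial.X - Polynomial.C (weightPoint ((2 * a + 4 * x + 2 : ℕ) : ℤ))) ^
        ghostMult n a (2 * a + 4 * x + 2) := by
  have hinj : Function.Injective fun x : ℕ => 2 * a + 4 * x + 2 := fun x y h => by
    simp only at h; omega
  rw [ghostCoeff, ← Finset.prod_image (s := Finset.range (6 * n + a + 3))
    (g := fun x => 2 * a + 4 * x + 2)
    (f := fun l : ℕ => (Polynomial.X - Polynomial.C (weightPoint (l : ℤ))) ^ ghostMult n a l)
    (hinj.injOn)]
  refine finprod_mem_eq_prod_of_subset _ ?_ ?_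
  · rintro l ⟨⟨hl, hla⟩, hm⟩
    have hm' : ghostMult n a l ≠ 0 := fun h => hm (by simp [h])
    have hla' : l % 4 = (2 * a + 2) % 4 := hla
    rw [Finset.coe_image]
    by_cases hx : 2 * a + 2 ≤ l
    · obtain ⟨x, rfl⟩ : ∃ x, l = 2 * a + 4 * x + 2 := ⟨(l - 2 * a - 2) / 4, by omega⟩
      refine ⟨x, ?_, rfl⟩
      rw [Finset.mem_coe, Finset.mem_range]
      by_contra! h
      exact hm' (ghostMult_eq_zero n a x ha h)
    · obtain ⟨N, rfl⟩ : ∃ N, l = N + 2 := ⟨l - 2, by omega⟩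
      have h0 : dIw (N + 2) a = 0 := dIw_eq_zero (by rw [Nat.even_iff]; omega) (by omega) ha
      refine absurd ?_ hm'
      rw [ghostMult, if_neg (by omega)]
  · rintro l hl
    obtain ⟨x, -, rfl⟩ := Finset.mem_image.mp hl
    exact ⟨by omega, by rw [Nat.ModEq]; omega⟩

/-- The valuation of `c` is at least `(E + 3m)/4 ≥ m - 1/4`, and it is an integer. -/
theorem norm_le_of_pow_four_le {c : ℚ_[5]} {E : ℤ} {m : ℕ} (h : ‖c‖ ^ 4 ≤ (5 : ℝ) ^ (-(E + 3 * m)))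
    (hm : (m : ℤ) ≤ E + 1) : ‖c‖ ≤ (5 : ℝ) ^ (-(m : ℤ)) := by
  have h1 := (Padic.norm_le_pow_iff_norm_lt_pow_add_one c (-(m : ℤ))).mpr
  norm_num at h1
  simp only [zpow_neg, zpow_natCast]
  refine h1 ?_
  by_contra! hc
  have h2 : ((5 : ℝ) ^ (-(m : ℤ) + 1)) ^ 4 ≤ ‖c‖ ^ 4 := pow_le_pow_left₀ (by positivity) hc 4
  rw [← zpow_natCast, ← zpow_mul] at h2
  have h3 := (zpow_le_zpow_iff_right₀ (by norm_num : (1 : ℝ) < 5)).mp (h2.trans h)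
  push_cast at h3
  omega

/-- The interpolated determinant is divided by its forced zeros at `X = l - 2`; the valuation left
for the cofactor matches the powers of 5 in `w_k - w_l = 5 (k - l)·unit`. -/
theorem det_slashMinor_eq (n a : ℕ) (ha : a < 4) (k : ℤ) :
    ∃ c : ℚ_[5], ‖c‖ ≤ (5 : ℝ) ^
        (-((∑ x ∈ Finset.range (6 * n + a + 3), ghostMult n a (2 * a + 4 * x + 2) : ℕ) : ℤ)) ∧
      (slashMinor (fun s => quatMat (heckeQuat s)) n k a).det =
        (∏ x ∈ Finset.range (6 * n + a + 3), ((k : ℚ_[5]) - ((2 * a + 4 * x + 2 : ℕ) : ℤ)) ^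
          ghostMult n a (2 * a + 4 * x + 2)) * c := by
  obtain ⟨M, hM, hb⟩ := exists_characteristic_matrix isHeckeMatrix_heckeQuat n a ha
  have hdet (k : ℤ) : evalAt ((k - 2 : ℤ) : ℤ_[5]) M.det =
      (slashMinor (fun s => quatMat (heckeQuat s)) n k a).det := by
    rw [AlgHom.map_det]
    change (M.map (evalAt ((k - 2 : ℤ) : ℤ_[5]))).det = _
    rw [hM, Matrix.det_mul, det_gradedBasisMatrix, mul_one]
  have hdvd (x : ℕ) : linearFactor (((((2 * a + 4 * x + 2 : ℕ) : ℤ) - 2 : ℤ)) : ℤ_[5]) ^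
      ghostMult n a (2 * a + 4 * x + 2) ∣ M.det := by
    rcases ghostMult_add_le n a x ha with ⟨hn, hle⟩ | h0
    · refine linearFactor_pow_dvd_det M _ _ ?_
      rw [hM, Fintype.card_fin]
      have h1 := (Matrix.rank_mul_le_left
        (slashMinor (fun s => quatMat (heckeQuat s)) n ((2 * a + 4 * x + 2 : ℕ) : ℤ) a)
        (gradedBasisMatrix n a)).trans (rank_slashMinor_le hn ha)
      have h2 := finrank_invariantPart_le_dUnr (x := x) (a := a)
      omega
    · rw [h0, pow_zero]; exact one_dvd _
  have hinj : Set.InjOn (fun x : ℕ => (((((2 * a + 4 * x + 2 : ℕ) : ℤ) - 2 : ℤ)) : ℤ_[5]))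
      (Finset.range (6 * n + a + 3)) := fun x _ y _ h => by
    have := Int.cast_injective (α := ℤ_[5]) h
    omega
  obtain ⟨c, hc, he⟩ := (HasBound.det M _ _ hb).exists_evalAt_eq _ _ hinj _ (fun x _ => hdvd x)
    ((k - 2 : ℤ) : ℤ_[5])
  refine ⟨c, ?_, ?_⟩
  · rw [← Nat.cast_sum] at hc
    refine norm_le_of_pow_four_le hc ?_
    have h1 := detBound_le_sum_shifts a n
    have h2 := sum_ghostMult_le a n (6 * n + a + 3) ha
    omega
  · rw [← hdet, he]
    congr 1
    refine Finset.prod_congr rfl fun x _ => ?_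
    congr 1
    rw [PadicInt.coe_intCast, PadicInt.coe_intCast]
    push_cast
    ring

theorem norm_eval_ghostCoeff (n a : ℕ) (ha : a < 4) (k : ℤ) :
    ‖(ghostCoeff n a).eval (weightPoint k)‖ =
      (∏ x ∈ Finset.range (6 * n + a + 3), ‖(k : ℚ_[5]) - ((2 * a + 4 * x + 2 : ℕ) : ℤ)‖ ^
          ghostMult n a (2 * a + 4 * x + 2)) * (5 : ℝ) ^
        (-((∑ x ∈ Finset.range (6 * n + a + 3), ghostMult n a (2 * a + 4 * x + 2) : ℕ) : ℤ)) := by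
  rw [ghostCoeff_eq n a ha, Polynomial.eval_prod, norm_prod, zpow_neg, zpow_natCast, ← inv_pow,
    ← Finset.prod_pow_eq_pow_sum, ← Finset.prod_mul_distrib]
  refine Finset.prod_congr rfl fun x _ => ?_
  rw [Polynomial.eval_pow, norm_pow, ← mul_pow, Polynomial.eval_sub, Polynomial.eval_X,
    Polynomial.eval_C]
  congr 1
  have := norm_weightPoint_sub k ((2 * a + 4 * x + 2 : ℕ) : ℤ)
  rw [norm_mul, norm_five, mul_comm (5⁻¹ : ℝ)] at this
  rw [← this]
  rfl

end QuatHecke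

end

theorem mainTheorem3 (n a : ℕ) (ha : a < 4) (k : ℤ) :
    ∃ d : ℤ_[5], (d : ℚ_[5]) = (QuatHecke.heckeMinor n k a).det ∧
      (QuatHecke.ghostCoeff n a).eval (QuatHecke.weightPoint k) ∣ d := by
  rcases QuatHecke.det_heckeMinor n k a with h | h
  · exact ⟨0, h.symm, dvd_zero _⟩
  · obtain ⟨c, hc, he⟩ := QuatHecke.det_slashMinor_eq n a ha k
    have hle : ‖(QuatHecke.heckeMinor n k a).det‖ ≤
        ‖(QuatHecke.ghostCoeff n a).eval (QuatHecke.weightPoint k)‖ := by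
      rw [h, he, QuatHecke.norm_eval_ghostCoeff n a ha k, norm_mul, norm_prod]
      simp only [norm_pow]
      exact mul_le_mul_of_nonneg_left hc (Finset.prod_nonneg fun _ _ => by positivity)
    exact ⟨⟨_, hle.trans (PadicInt.norm_le_one _)⟩, rfl, QuatHecke.padicInt_dvd_of_norm_le hle⟩
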